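/- Let $\mathbb F$ be $\mathbb R$ or $\mathbb C$; all spaces are Banach spaces over $\mathbb F$. Write $X\overset{c}{\hookrightarrow}Y$ if $X$ is isomorphic (linearly homeomorphic) to a complemented subspace of $Y$, i.e. to the range of a bounded linear projection on $Y$. For Banach spaces $X_1,X_2,\dots$ let $(X_1\oplus X_2\oplus\cdots)_{\ell^p}$ be the space of sequences $(x_i)$, $x_i\in X_i$, with norm $(\sum\|x_i\|^p)^{1/p}<\infty$; when all $X_i=X$ it is written $(\sum^{\oplus}X)_{\ell^p}$. For $2<p<\infty$ and a sequence $w=(w_n)$ of positive reals, let $X_{p,w}$ be the space of scalar sequences $x=(x_n)$ with norm $\max\{(\sum|x_n|^p)^{1/p},(\sum|w_nx_n|^2)^{1/2}\}<\infty$. For $2<p<\infty$ let $X_p=X_{p,w}$, where $w$ is any sequence of positive reals such that $\sum_{w_n<\varepsilon}w_n^{2p/(p-2)}=\infty$ for every $\varepsilon>0$, and let $B_p=(X_{p,v^{(1)}}\oplus X_{p,v^{(2)}}\oplus\cdots)_{\ell^p}$, where $v^{(N)}$ is the constant sequence with value $(1/N)^{(p-2)/(2p)}$. For $1<p<2$ with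 conjugate index $q$ (so $\frac1p+\frac1q=1$), let $X_p=X_q^*$ and $B_p=B_q^*$. **Proposition.** Let $1<p<\infty$, $p\neq2$. Then (for every choice of the sequence $w$ defining $X_p$) (a) $B_p\not\overset{c}{\hookrightarrow}(\sum^{\oplus}\ell^2)_{\ell^p}$, (b) $(\sum^{\oplus}\ell^2)_{\ell^p}\oplus X_p\not\overset{c}{\hookrightarrow}(\sum^{\oplus}\ell^2)_{\ell^p}$, (c) $B_p\not\overset{c}{\hookrightarrow}(\sum^{\oplus}\ell^2)_{\ell^p}\oplus X_p$, (d) $(\sum^{\oplus}\ell^2)_{\ell^p}\oplus X_p\not\overset{c}{\hookrightarrow}B_p$, (e) $B_p\oplus X_p\not\overset{c}{\hookrightarrow}B_p$, (f) $B_p\oplus X_p\not\overset{c}{\hookrightarrow}(\sum^{\oplus}\ell^2)_{\ell^p}\oplus X_p$, (g) $(\sum^{\oplus}X_p)_{\ell^p}\not\overset{c}{\hookrightarrow}B_p\oplus X_p$. -/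

import Mathlib

open scoped ENNReal

noncomputable section

universe u

/-! ### Banach spaces and the relation "isomorphic to a complemented subspace" -/

/-- A Banach space over `𝕜`, bundled (so that a space may be defined by cases on `p`). -/
structure BanachSpace (𝕜 : Type u) [RCLike 𝕜] where
  carrier : Type u
  [normedAddCommGroup : NormedAddCommGroup carrier]
  [normedSpace : NormedSpace 𝕜 carrier]
  [completeSpace : CompleteSpace carrier]

namespace BanachSpace

instance (𝕜 : Type u) [RCLike 𝕜] : CoeSort (BanachSpace 𝕜) (Type u) := ⟨BanachSpace.carrier⟩

attribute [instance] normedAddCommGroup normedSpace completeSpace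

end BanachSpace

/-- `X` is isomorphic to a complemented subspace of `Y`: there is a linear subspace `Y'` of `Y`
that is the range of a bounded linear projection, and a linear homeomorphism of `X` onto `Y'`. -/
def ComplementablyEmbeds (𝕜 : Type*) [RCLike 𝕜] (X Y : Type*)
    [NormedAddCommGroup X] [NormedSpace 𝕜 X] [NormedAddCommGroup Y] [NormedSpace 𝕜 Y] : Prop :=
  ∃ Y' : Submodule 𝕜 Y, Y'.ClosedComplemented ∧ Nonempty (X ≃L[𝕜] Y')

/-! ### Exponents -/

instance fact_one_le_ofReal (p : ℝ) [hp : Fact (1 < p)] : Fact (1 ≤ ENNReal.ofReal p) :=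
  ⟨by simpa using hp.out.le⟩

/-- The conjugate index `q = p / (p - 1)` of `p > 1` satisfies `q > 1`. -/
instance fact_one_lt_conjExponent (p : ℝ) [hp : Fact (1 < p)] : Fact (1 < p.conjExponent) :=
  ⟨(Real.HolderConjugate.conjExponent hp.out).symm.lt⟩

/-! ### The weighted sequence spaces `X_{p,w}` -/

/-- The sequences `x` of scalars for which `∑ |x n| ^ p` and `∑ |w n * x n| ^ 2` are finite. -/
def weightedSubmodule (𝕜 : Type u) [RCLike 𝕜] (p : ℝ) (w : ℕ → ℝ) : Submodule 𝕜 (ℕ → 𝕜) where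
  carrier := {x | Memℓp x (ENNReal.ofReal p) ∧ Memℓp (fun n => (w n : 𝕜) * x n) 2}
  zero_mem' := by
    refine ⟨zero_memℓp, ?_⟩
    simpa using (zero_mem_ℓp' : Memℓp (fun _ : ℕ => (0 : 𝕜)) 2)
  add_mem' := by
    rintro x y ⟨hx, hx'⟩ ⟨hy, hy'⟩
    refine ⟨hx.add hy, ?_⟩
    convert hx'.add hy' using 1
    funext n
    simp [mul_add]
  smul_mem' := by
    rintro c x ⟨hx, hx'⟩
    refine ⟨hx.const_smul c, ?_⟩
    convert hx'.const_smul c using 1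
    funext n
    simp [mul_left_comm]

/-- The space `X_{p,w}`. It is a copy of `weightedSubmodule 𝕜 p w`, carrying its own norm rather
than the topology of pointwise convergence. -/
def WeightedSpace (𝕜 : Type u) [RCLike 𝕜] (p : ℝ) (w : ℕ → ℝ) : Type u :=
  weightedSubmodule 𝕜 p w

namespace WeightedSpace

variable (𝕜 : Type u) [RCLike 𝕜] (p : ℝ) (w : ℕ → ℝ)

instance : AddCommGroup (WeightedSpace 𝕜 p w) :=
  inferInstanceAs (AddCommGroup (weightedSubmodule 𝕜 p w))

instance : Module 𝕜 (WeightedSpace 𝕜 p w) :=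
  inferInstanceAs (Module 𝕜 (weightedSubmodule 𝕜 p w))

/-- The map `x ↦ (x, w x)` into `ℓ^p × ℓ^2` (with the maximum norm), which induces the norm of
`X_{p,w}`. -/
def toProd : WeightedSpace 𝕜 p w →ₗ[𝕜]
    (lp (fun _ : ℕ => 𝕜) (ENNReal.ofReal p) × lp (fun _ : ℕ => 𝕜) 2) where
  toFun x := (⟨x.1, x.2.1⟩, ⟨fun n => (w n : 𝕜) * x.1 n, x.2.2⟩)
  map_add' x y := by
    refine Prod.ext (Subtype.ext rfl) (Subtype.ext ?_)
    funext n
    exact mul_add _ _ _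
  map_smul' c x := by
    refine Prod.ext (Subtype.ext rfl) (Subtype.ext ?_)
    funext n
    exact mul_left_comm _ _ _

theorem toProd_injective : Function.Injective (toProd 𝕜 p w) := by
  intro x y h
  exact Subtype.ext (congrArg (fun z => (z.1 : ℕ → 𝕜)) h)

variable [hp : Fact (1 < p)]

instance : NormedAddCommGroup (WeightedSpace 𝕜 p w) :=
  NormedAddCommGroup.induced _ _ (toProd 𝕜 p w) (toProd_injective 𝕜 p w)

instance : NormedSpace 𝕜 (WeightedSpace 𝕜 p w) :=
  NormedSpace.induced 𝕜 _ _ (toProd 𝕜 p w)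

/-- The norm of `X_{p,w}` is the maximum of the `ℓ^p` norm and the weighted `ℓ^2` norm. -/
theorem norm_eq (x : WeightedSpace 𝕜 p w) :
    ‖x‖ = max ((∑' n, ‖x.1 n‖ ^ p) ^ (1 / p)) ((∑' n, ‖(w n : 𝕜) * x.1 n‖ ^ 2) ^ (1 / 2 : ℝ)) := by
  have h0 : 0 < p := lt_trans one_pos hp.out
  have h1 : ‖x‖ = ‖toProd 𝕜 p w x‖ := rfl
  rw [h1, Prod.norm_def, lp.norm_eq_tsum_rpow (by rwa [ENNReal.toReal_ofReal h0.le]),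
    lp.norm_eq_tsum_rpow (by norm_num), ENNReal.toReal_ofReal h0.le]
  norm_num [toProd]

instance : CompleteSpace (WeightedSpace 𝕜 p w) := by
  have hiso : Isometry (toProd 𝕜 p w) :=
    AddMonoidHomClass.isometry_of_norm (toProd 𝕜 p w) (fun _ => rfl)
  have hp0 : ENNReal.ofReal p ≠ 0 := by
    simpa using lt_trans one_pos hp.out
  have hr : Set.range (toProd 𝕜 p w) = ⋂ n : ℕ, {z | z.2 n = (w n : 𝕜) * z.1 n} := by
    ext z
    simp only [Set.mem_range, Set.mem_iInter, Set.mem_ofPred_eq]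
    constructor
    · rintro ⟨x, rfl⟩ n
      rfl
    · intro h
      have h2 : (fun n => (w n : 𝕜) * z.1 n) = (z.2 : ℕ → 𝕜) := funext fun n => (h n).symm
      refine ⟨⟨z.1, z.1.2, ?_⟩, ?_⟩
      · rw [h2]
        exact z.2.2
      · exact Prod.ext rfl (Subtype.ext h2)
  have hc : IsClosed (Set.range (toProd 𝕜 p w)) := by
    rw [hr]
    refine isClosed_iInter fun n => isClosed_eq ?_ ?_
    · exact (lp.lipschitzWith_one_eval 2 n).continuous.comp continuous_snd
    · exact continuous_const.mul
        ((lp.lipschitzWith_one_eval (ENNReal.ofReal p) n).continuous.comp continuous_fst)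
  exact hiso.isUniformInducing.completeSpace hc.isComplete

end WeightedSpace

/-! ### The spaces `X_p` and `B_p` -/

/-- `w` is a sequence of positive reals and, for every `ε > 0`, the sum of `w n ^ (2p / (p - 2))`
over those `n` with `w n < ε` is infinite. (Here `p > 2`.) -/
def ConditionStar (p : ℝ) (w : ℕ → ℝ) : Prop :=
  (∀ n, 0 < w n) ∧
    ∀ ε : ℝ, 0 < ε → ¬ Summable (fun n : {n : ℕ // w n < ε} => w n ^ (2 * p / (p - 2)))

/-- The sequences `w` by which `X_p` may be realized. For `1 < p < 2` the condition is placed on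
the conjugate index, as `X_p` is then a dual. -/
def RealizingWeight (p : ℝ) (w : ℕ → ℝ) : Prop :=
  if 2 < p then ConditionStar p w else ConditionStar p.conjExponent w

/-- The space `X_p`, realized by the sequence `w`: it is `X_{p,w}` for `2 < p`, and the dual of
`X_{q,w}` for `1 < p < 2`, where `q` is the conjugate index of `p`. -/
def RosenthalX (𝕜 : Type u) [RCLike 𝕜] (p : ℝ) [Fact (1 < p)] (w : ℕ → ℝ) : BanachSpace 𝕜 :=
  if 2 < p then { carrier := WeightedSpace 𝕜 p w }
  else { carrier := StrongDual 𝕜 (WeightedSpace 𝕜 p.conjExponent w) }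

/-- The space `(X_{p,v^(1)} ⊕ X_{p,v^(2)} ⊕ ⋯)_{ℓ^p}`, where `v^(N)` is the constant sequence with
value `(1 / N) ^ ((p - 2) / (2p))`. The index `N` below starts at `0` and stands for `N + 1`. -/
abbrev WeightedSum (𝕜 : Type u) [RCLike 𝕜] (p : ℝ) [Fact (1 < p)] : Type u :=
  lp (fun N : ℕ => WeightedSpace 𝕜 p (fun _ : ℕ => (1 / ((N : ℝ) + 1)) ^ ((p - 2) / (2 * p))))
    (ENNReal.ofReal p)

/-- The space `B_p`: it is `(X_{p,v^(1)} ⊕ X_{p,v^(2)} ⊕ ⋯)_{ℓ^p}` for `2 < p`, and the dual of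
`B_q` for `1 < p < 2`, where `q` is the conjugate index of `p`. -/
def RosenthalB (𝕜 : Type u) [RCLike 𝕜] (p : ℝ) [Fact (1 < p)] : BanachSpace 𝕜 :=
  if 2 < p then { carrier := WeightedSum 𝕜 p }
  else { carrier := StrongDual 𝕜 (WeightedSum 𝕜 p.conjExponent) }

/-- The `ℓ^p` sum `(X ⊕ X ⊕ ⋯)_{ℓ^p}` of countably many copies of `X`. -/
abbrev LpSum (p : ℝ) (X : Type*) [NormedAddCommGroup X] : Type _ :=
  lp (fun _ : ℕ => X) (ENNReal.ofReal p)

/-- The space `ℓ^2` of square-summable sequences of scalars. -/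
abbrev EllTwo (𝕜 : Type*) [RCLike 𝕜] : Type _ := lp (fun _ : ℕ => 𝕜) 2

end

/-! Write `S` for `(∑ ℓ²)_{ℓ^p}`. All seven claims follow from four facts about the identity
operator: that of `X_p` factors neither through `S` nor through `B_p`, that of `B_p` does not factor
through `S ⊕ X_p`, and that of `(∑ X_p)_{ℓ^p}` does not factor through `B_p ⊕ X_p`. For `p < 2`
these are obtained from the conjugate index by dualizing, because `X_{q,w}` and `B_q` are reflexive.

Let `p > 2`. A factorization `P T = 1` is tested on a biorthogonal system `(e i, f i)` that imitates
the unit vectors of `X_{p,v}` with `v = (N+1)^(1/p-1/2)` (`DiagSystem`). Only the diagonal `f i (P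
(T (e i)))` matters, and only along a nonprincipal ultrafilter. Averaging over signs bounds `∑
φ_k(y_k)` by the largest norm of `∑ ±φ_k` times the average norm of `∑ ±y_k` (`sum_re_apply_le`). If
`K` functionals sum to `O(√K)` and the `y_k` are disjoint blocks of an `ℓ^p` sum up to errors
absorbed by type two, then diagonal values at least `η` would give `K η ≲ K^(1/2+1/p)`, which fails
for large `K`. So a diagonal through an `ℓ^p` sum lives on finitely many summands up to a small
error (`eventually_tail_small`), and a diagonal through `X_{p,w}` is governed by the weighted `ℓ²`
parts (`WeightedSpace.eventually_norm_apply_lt`).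

Consequently the diagonal through an `ℓ^p` sum of Hilbert spaces is `O((N+1)^(1/p-1/2))`
(`DiagSystem.eventually_lt_of_lp`), and the diagonal through `X_{p,w}` is `O(δ)` when the weighted
`ℓ²` part of `T` has norm at most `δ` (`DiagSystem.eventually_lt_of_weighted`). That part is small
on late summands of any `ℓ^p` sum (`eventually_single_small`). On a late summand of `B_p` both
diagonals are below `1/2`, yet they add up to `1`.

The space `X_p` contains such systems for all `N` at once, on disjoint blocks. Through an `ℓ^p` sum
whose summands are Hilbertian with constants that depend on the summand, as in `B_p`, suitable
systems `N_k` have their diagonals on disjoint ranges of summands. Normalized sums of `N_k + 1`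
vectors, one for each `k < L`, then have images adding up to `O(L^(1/p))`, while the matching
functionals add up to `O(√L)`, and again `L ≲ L^(1/2+1/p)` is absurd (`false_of_diag_through_lp`).
This handles `X_p` directly and `(∑ X_p)_{ℓ^p}` after passing to a late summand, where the factor
`X_p` of the target becomes negligible. -/

noncomputable section

open Filter Topology

/-! ### Averages over signs -/

/-- The average of `f` over the `2 ^ K` points `x + ∑ k < K, ± y k`. -/
def signAverage {Y : Type*} [AddCommGroup Y] (y : ℕ → Y) (f : Y → ℝ) : ℕ → Y → ℝ
  | 0, x => f x
  | K + 1, x => (signAverage y f K (x + y K) + signAverage y f K (x - y K)) / 2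

/-- A sequence of signs, as scalars. -/
def IsSign {𝕜 : Type*} [RCLike 𝕜] (ε : ℕ → 𝕜) : Prop := ∀ k, ε k = 1 ∨ ε k = -1

theorem IsSign.norm_eq {𝕜 : Type*} [RCLike 𝕜] {ε : ℕ → 𝕜} (h : IsSign ε) (k : ℕ) :
    ‖ε k‖ = 1 := by
  rcases h k with h | h <;> simp [h]

section SignAverage

variable {Y Z : Type*} [AddCommGroup Y] [AddCommGroup Z]

theorem IsSign.update {𝕜 : Type*} [RCLike 𝕜] {ε : ℕ → 𝕜} (h : IsSign ε) (K : ℕ) {c : 𝕜}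
    (hc : c = 1 ∨ c = -1) : IsSign (Function.update ε K c) := by
  intro k
  by_cases hk : k = K
  · subst hk; simpa using hc
  · simpa [hk] using h k

theorem sum_update_sign {𝕜 : Type*} [RCLike 𝕜] [Module 𝕜 Y] (ε : ℕ → 𝕜) (y : ℕ → Y) (K : ℕ)
    (c : 𝕜) : ∑ k ∈ Finset.range (K + 1), Function.update ε K c k • y k =
      ∑ k ∈ Finset.range K, ε k • y k + c • y K := by
  rw [Finset.sum_range_succ, Function.update_self]
  congr 1
  refine Finset.sum_congr rfl fun k hk => ?_
  rw [Function.update_of_ne (Finset.mem_range.1 hk).ne]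

theorem signAverage_mono (𝕜 : Type*) [RCLike 𝕜] [Module 𝕜 Y] {y : ℕ → Y} {f g : Y → ℝ} {K : ℕ}
    {x : Y} (h : ∀ ε : ℕ → 𝕜, IsSign ε → f (x + ∑ k ∈ Finset.range K, ε k • y k) ≤
      g (x + ∑ k ∈ Finset.range K, ε k • y k)) :
    signAverage y f K x ≤ signAverage y g K x := by
  induction K generalizing x with
  | zero => simpa [signAverage] using h 1 (fun _ => Or.inl rfl)
  | succ K ih =>
    have h1 : signAverage y f K (x + y K) ≤ signAverage y g K (x + y K) := by
      refine ih fun ε hε => ?_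
      have := h _ (hε.update K (Or.inl rfl))
      rw [sum_update_sign, one_smul] at this
      rwa [add_assoc, add_comm (y K)]
    have h2 : signAverage y f K (x - y K) ≤ signAverage y g K (x - y K) := by
      refine ih fun ε hε => ?_
      have := h _ (hε.update K (Or.inr rfl))
      rw [sum_update_sign, neg_smul, one_smul] at this
      rwa [sub_eq_add_neg, add_assoc, add_comm (-y K)]
    simp only [signAverage]
    linarith

theorem signAverage_const (y : ℕ → Y) (c : ℝ) (K : ℕ) (x : Y) :
    signAverage y (fun _ => c) K x = c := by
  induction K generalizing x with
  | zero => rfl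
  | succ K ih => simp [signAverage, ih]

theorem signAverage_const_mul (y : ℕ → Y) (f : Y → ℝ) (c : ℝ) (K : ℕ) (x : Y) :
    signAverage y (fun z => c * f z) K x = c * signAverage y f K x := by
  induction K generalizing x with
  | zero => rfl
  | succ K ih => simp only [signAverage, ih]; ring

theorem signAverage_add (y : ℕ → Y) (f g : Y → ℝ) (K : ℕ) (x : Y) :
    signAverage y (fun z => f z + g z) K x = signAverage y f K x + signAverage y g K x := by
  induction K generalizing x with
  | zero => rfl
  | succ K ih => simp only [signAverage, ih]; ring

theorem signAverage_sum {ι : Type*} (s : Finset ι) (y : ℕ → Y) (f : ι → Y → ℝ) (K : ℕ) (x : Y) :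
    signAverage y (fun z => ∑ i ∈ s, f i z) K x = ∑ i ∈ s, signAverage y (f i) K x := by
  induction K generalizing x with
  | zero => rfl
  | succ K ih => simp only [signAverage, ih, ← Finset.sum_add_distrib, Finset.sum_div]

theorem signAverage_comp {F : Type*} [FunLike F Y Z] [AddMonoidHomClass F Y Z] (L : F)
    (y : ℕ → Y) (f : Z → ℝ) (K : ℕ) (x : Y) :
    signAverage y (fun z => f (L z)) K x = signAverage (fun k => L (y k)) f K (L x) := by
  induction K generalizing x with
  | zero => rfl
  | succ K ih => simp only [signAverage, ih, map_add, map_sub]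

theorem signAverage_nonneg (y : ℕ → Y) (f : Y → ℝ) (hf : ∀ z, 0 ≤ f z) (K : ℕ) (x : Y) :
    0 ≤ signAverage y f K x := by
  induction K generalizing x with
  | zero => exact hf x
  | succ K ih =>
    have h1 := ih (x + y K)
    have h2 := ih (x - y K)
    simp only [signAverage]
    linarith

theorem half_add_rpow_le {a b r : ℝ} (ha : 0 ≤ a) (hb : 0 ≤ b) (hr : 1 ≤ r) :
    ((a + b) / 2) ^ r ≤ (a ^ r + b ^ r) / 2 := by
  have h := (convexOn_rpow hr).2 (Set.mem_Ici.2 ha) (Set.mem_Ici.2 hb)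
    (show (0 : ℝ) ≤ 1 / 2 by norm_num) (show (0 : ℝ) ≤ 1 / 2 by norm_num) (by norm_num)
  simp only [smul_eq_mul] at h
  calc _ = (1 / 2 * a + 1 / 2 * b) ^ r := by congr 1; ring
    _ ≤ _ := h
    _ = _ := by ring

/-- Jensen's inequality for averages over signs. -/
theorem signAverage_rpow_le (y : ℕ → Y) (f : Y → ℝ) (hf : ∀ z, 0 ≤ f z) {r : ℝ} (hr : 1 ≤ r)
    (K : ℕ) (x : Y) : (signAverage y f K x) ^ r ≤ signAverage y (fun z => f z ^ r) K x := by
  induction K generalizing x with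
  | zero => rfl
  | succ K ih =>
    simp only [signAverage]
    have h := half_add_rpow_le (signAverage_nonneg y f hf K (x + y K))
      (signAverage_nonneg y f hf K (x - y K)) hr
    have h1 := ih (x + y K)
    have h2 := ih (x - y K)
    linarith

theorem signAverage_le (𝕜 : Type*) [RCLike 𝕜] [Module 𝕜 Y] {y : ℕ → Y} {f : Y → ℝ} {K : ℕ} {c : ℝ}
    (h : ∀ ε : ℕ → 𝕜, IsSign ε → f (∑ k ∈ Finset.range K, ε k • y k) ≤ c) :
    signAverage y f K 0 ≤ c := by
  rw [← signAverage_const y c K 0]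
  exact signAverage_mono 𝕜 fun ε hε => by simpa using h ε hε

end SignAverage

/-! ### Pairings of functionals and vectors under common signs -/

section Trace

variable {𝕜 : Type*} [RCLike 𝕜] {Y : Type*} [NormedAddCommGroup Y] [NormedSpace 𝕜 Y]

/-- The same sign multiplies `φ k` and `y k`, so the cross terms cancel in the average and only the
diagonal remains. -/
theorem signAverage_pairing (φ : ℕ → StrongDual 𝕜 Y) (y : ℕ → Y) (K : ℕ)
    (x : StrongDual 𝕜 Y × Y) :
    signAverage (fun k => (φ k, y k)) (fun z => RCLike.re (z.1 z.2)) K x =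
      RCLike.re (x.1 x.2) + ∑ k ∈ Finset.range K, RCLike.re (φ k (y k)) := by
  induction K generalizing x with
  | zero => simp [signAverage]
  | succ K ih =>
    simp only [signAverage, ih, Finset.sum_range_succ]
    simp
    ring

/-- If all signed sums of the `φ k` have norm at most `A`, then the sum of the `φ k (y k)` is at
most `A` times the average norm of the signed sums of the `y k`. -/
theorem sum_re_apply_le {φ : ℕ → StrongDual 𝕜 Y} (y : ℕ → Y) {K : ℕ} {A : ℝ}
    (hA : ∀ ε : ℕ → 𝕜, IsSign ε → ‖∑ k ∈ Finset.range K, ε k • φ k‖ ≤ A) :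
    ∑ k ∈ Finset.range K, RCLike.re (φ k (y k)) ≤ A * signAverage y (fun z => ‖z‖) K 0 := by
  have h1 := signAverage_pairing φ y K 0
  have h2 : signAverage (fun k => (φ k, y k)) (fun z => RCLike.re (z.1 z.2)) K 0 ≤
      signAverage (fun k => (φ k, y k)) (fun z => A * ‖z.2‖) K 0 := by
    refine signAverage_mono 𝕜 fun ε hε => ?_
    simp only [zero_add]
    refine (RCLike.re_le_norm _).trans ((ContinuousLinearMap.le_opNorm _ _).trans ?_)
    gcongr
    simpa [Prod.fst_sum] using hA ε hε
  have h3 := signAverage_comp (AddMonoidHom.snd (StrongDual 𝕜 Y) Y) (fun k => (φ k, y k))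
    (fun z => ‖z‖) K 0
  simp only [AddMonoidHom.coe_snd, Prod.snd_zero] at h3
  rw [signAverage_const_mul, h3, h1] at h2
  simpa using h2

end Trace

/-! ### Type two -/

/-- The norm is a Hilbertian (semi)norm. -/
def Parallelogram (H : Type*) [NormedAddCommGroup H] : Prop :=
  ∀ x y : H, ‖x + y‖ ^ 2 + ‖x - y‖ ^ 2 = 2 * (‖x‖ ^ 2 + ‖y‖ ^ 2)

theorem Parallelogram.signAverage_eq {H : Type*} [NormedAddCommGroup H] (hH : Parallelogram H)
    (y : ℕ → H) (K : ℕ) (x : H) : signAverage y (fun z => ‖z‖ ^ 2) K x =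
      ‖x‖ ^ 2 + ∑ k ∈ Finset.range K, ‖y k‖ ^ 2 := by
  induction K generalizing x with
  | zero => simp [signAverage]
  | succ K ih =>
    simp only [signAverage, ih, Finset.sum_range_succ]
    linarith [hH x (y K)]

/-- A space of type two. -/
def HasTypeTwo (Y : Type*) [NormedAddCommGroup Y] : Prop :=
  ∃ C : ℝ, 0 ≤ C ∧ ∀ (y : ℕ → Y) (K : ℕ), signAverage y (fun z => ‖z‖ ^ 2) K 0 ≤
    C * ∑ k ∈ Finset.range K, ‖y k‖ ^ 2

theorem HasTypeTwo.prod {Y Z : Type*} [NormedAddCommGroup Y] [NormedAddCommGroup Z]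
    (hY : HasTypeTwo Y) (hZ : HasTypeTwo Z) : HasTypeTwo (Y × Z) := by
  obtain ⟨C, hC, h⟩ := hY
  obtain ⟨D, hD, h'⟩ := hZ
  refine ⟨C + D, by positivity, fun y K => ?_⟩
  have h1 : signAverage y (fun z => ‖z‖ ^ 2) K 0 ≤
      signAverage y (fun z => ‖z.1‖ ^ 2 + ‖z.2‖ ^ 2) K 0 := by
    have key : ∀ z : Y × Z, ‖z‖ ^ 2 ≤ ‖z.1‖ ^ 2 + ‖z.2‖ ^ 2 := by
      intro z
      rw [Prod.norm_def]
      rcases max_choice ‖z.1‖ ‖z.2‖ with h | h <;> rw [h] <;> nlinarith [norm_nonneg z.1]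
    clear h h'
    generalize (0 : Y × Z) = x
    induction K generalizing x with
    | zero => exact key x
    | succ K ih =>
      simp only [signAverage]
      linarith [ih (x + y K), ih (x - y K)]
  have h2 := signAverage_comp (AddMonoidHom.fst Y Z) y (fun z => ‖z‖ ^ 2) K 0
  have h3 := signAverage_comp (AddMonoidHom.snd Y Z) y (fun z => ‖z‖ ^ 2) K 0
  simp only [AddMonoidHom.coe_fst, Prod.fst_zero] at h2
  simp only [AddMonoidHom.coe_snd, Prod.snd_zero] at h3
  rw [signAverage_add, h2, h3] at h1
  refine h1.trans ((add_le_add (h _ K) (h' _ K)).trans ?_)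
  rw [add_mul]
  gcongr with k _ k _
  · exact norm_fst_le _
  · exact norm_snd_le _

theorem HasTypeTwo.comap {Y Z : Type*} [NormedAddCommGroup Y] [NormedAddCommGroup Z]
    (hZ : HasTypeTwo Z) (j : Y →+ Z) {c c' : ℝ} (hj : ∀ y, ‖y‖ ≤ c * ‖j y‖)
    (hj' : ∀ y, ‖j y‖ ≤ c' * ‖y‖) : HasTypeTwo Y := by
  obtain ⟨C, hC, h⟩ := hZ
  refine ⟨c ^ 2 * C * c' ^ 2, by positivity, fun y K => ?_⟩
  have h1 : signAverage y (fun z => ‖z‖ ^ 2) K 0 ≤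
      signAverage y (fun z => c ^ 2 * ‖j z‖ ^ 2) K 0 := by
    have key : ∀ z : Y, ‖z‖ ^ 2 ≤ c ^ 2 * ‖j z‖ ^ 2 := by
      intro z
      rw [← mul_pow]
      gcongr
      exact hj z
    clear h
    generalize (0 : Y) = x
    induction K generalizing x with
    | zero => exact key x
    | succ K ih =>
      simp only [signAverage]
      linarith [ih (x + y K), ih (x - y K)]
  rw [signAverage_const_mul, signAverage_comp j y (fun z => ‖z‖ ^ 2), map_zero] at h1
  refine h1.trans ?_
  rw [mul_assoc, mul_assoc, Finset.mul_sum]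
  gcongr
  refine (h _ K).trans ?_
  gcongr with k
  rw [← mul_pow]
  gcongr
  exact hj' _

/-- A smoothness inequality that passes to `ℓ^p` sums and implies type two. -/
def PSmooth (p C : ℝ) (Y : Type*) [NormedAddCommGroup Y] : Prop :=
  ∀ x y : Y, ‖x + y‖ ^ p + ‖x - y‖ ^ p ≤ 2 * (‖x‖ ^ 2 + C * ‖y‖ ^ 2) ^ (p / 2)

/-- Convexity of `t ^ (p / 2)` turns the condition into its analogue with exponent two. Adding the
vectors one at a time then gives type two with the same constant. -/
theorem PSmooth.hasTypeTwo {p C : ℝ} (hp : 2 ≤ p) (hC : 0 ≤ C) {Y : Type*}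
    [NormedAddCommGroup Y] (h : PSmooth p C Y) : HasTypeTwo Y := by
  have key : ∀ x y : Y, ‖x + y‖ ^ 2 + ‖x - y‖ ^ 2 ≤ 2 * (‖x‖ ^ 2 + C * ‖y‖ ^ 2) := by
    intro x y
    have e : ∀ z : Y, ‖z‖ ^ p = (‖z‖ ^ 2) ^ (p / 2) := by
      intro z
      rw [← Real.rpow_natCast, ← Real.rpow_mul (norm_nonneg _)]
      congr 1
      push_cast
      ring
    have h1 := half_add_rpow_le (sq_nonneg ‖x + y‖) (sq_nonneg ‖x - y‖)
      (show 1 ≤ p / 2 by linarith)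
    have h2 := h x y
    rw [e, e] at h2
    have h3 : ((‖x + y‖ ^ 2 + ‖x - y‖ ^ 2) / 2) ^ (p / 2) ≤
        (‖x‖ ^ 2 + C * ‖y‖ ^ 2) ^ (p / 2) := by linarith
    have := (Real.rpow_le_rpow_iff (by positivity) (by positivity) (by linarith)).1 h3
    linarith
  have : ∀ (y : ℕ → Y) (K : ℕ) (x : Y), signAverage y (fun z => ‖z‖ ^ 2) K x ≤
      ‖x‖ ^ 2 + C * ∑ k ∈ Finset.range K, ‖y k‖ ^ 2 := by
    intro y K
    induction K with
    | zero => intro x; simp [signAverage]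
    | succ K ih =>
      intro x
      simp only [signAverage, Finset.sum_range_succ]
      linarith [ih (x + y K), ih (x - y K), key x (y K)]
  exact ⟨C, hC, fun y K => by simpa using this y K 0⟩

/-- With `b = a t`, the left side is at most `2 a^r cosh (r t)`, and `cosh (r t) ≤ exp (r t² / 2) ^
r`. For `|t| ≤ 1` the inner exponential is at most `1 + (r / 2) exp (r / 2) t²`. -/
theorem two_point_inequality {r a b : ℝ} (hr : 1 ≤ r) (ha : 0 < a) (hb : |b| ≤ a) :
    (a + b) ^ r + (a - b) ^ r ≤ 2 * (a + r / 2 * Real.exp (r / 2) * (b ^ 2 / a)) ^ r := by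
  obtain ⟨t, rfl⟩ : ∃ t, b = a * t := ⟨b / a, by field_simp⟩
  have ht : |t| ≤ 1 := by
    rw [abs_mul, abs_of_pos ha] at hb
    nlinarith
  obtain ⟨ht1, ht2⟩ := abs_le.1 ht
  set E := r / 2 * Real.exp (r / 2)
  have hE : 0 ≤ E := by positivity
  have e1 : a + a * t = a * (1 + t) := by ring
  have e2 : a - a * t = a * (1 - t) := by ring
  have e3 : a + E * ((a * t) ^ 2 / a) = a * (1 + E * t ^ 2) := by field_simp
  rw [e1, e2, e3, Real.mul_rpow ha.le (by linarith), Real.mul_rpow ha.le (by linarith),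
    Real.mul_rpow ha.le (by positivity)]
  have h1 : (1 + t) ^ r ≤ Real.exp (r * t) := by
    rw [mul_comm, Real.exp_mul]
    exact Real.rpow_le_rpow (by linarith) (by linarith [Real.add_one_le_exp t]) (by linarith)
  have h2 : (1 - t) ^ r ≤ Real.exp (-(r * t)) := by
    rw [← mul_neg, mul_comm, Real.exp_mul]
    exact Real.rpow_le_rpow (by linarith) (by linarith [Real.add_one_le_exp (-t)]) (by linarith)
  have h3 := Real.cosh_le_exp_half_sq (r * t)
  rw [Real.cosh_eq] at h3
  have hs : t ^ 2 ≤ 1 := by nlinarith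
  have h4 : Real.exp (r / 2 * t ^ 2) ≤ 1 + E * t ^ 2 := by
    have h5 := Real.add_one_le_exp (-(r / 2 * t ^ 2))
    rw [Real.exp_neg] at h5
    have h6 : 0 < Real.exp (r / 2 * t ^ 2) := Real.exp_pos _
    have h7 : (-(r / 2 * t ^ 2) + 1) * Real.exp (r / 2 * t ^ 2) ≤ 1 := by
      calc _ ≤ (Real.exp (r / 2 * t ^ 2))⁻¹ * Real.exp (r / 2 * t ^ 2) := by gcongr
        _ = 1 := inv_mul_cancel₀ h6.ne'
    have h8 : Real.exp (r / 2 * t ^ 2) ≤ Real.exp (r / 2) := by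
      apply Real.exp_le_exp.2
      nlinarith
    have h9 : r / 2 * t ^ 2 * Real.exp (r / 2 * t ^ 2) ≤ r / 2 * t ^ 2 * Real.exp (r / 2) := by
      gcongr
    have : E * t ^ 2 = r / 2 * t ^ 2 * Real.exp (r / 2) := by ring
    linarith
  have h5 : Real.exp ((r * t) ^ 2 / 2) ≤ (1 + E * t ^ 2) ^ r := by
    have : (r * t) ^ 2 / 2 = (r / 2 * t ^ 2) * r := by ring
    rw [this, Real.exp_mul]
    exact Real.rpow_le_rpow (Real.exp_pos _).le h4 (by linarith)
  have ha' : 0 ≤ a ^ r := by positivity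
  nlinarith

theorem Parallelogram.pSmooth {H : Type*} [NormedAddCommGroup H] (hH : Parallelogram H) {p : ℝ}
    (hp : 2 ≤ p) : PSmooth p (1 + 8 * (p / 2 / 2 * Real.exp (p / 2 / 2))) H := by
  intro x y
  have e : ∀ z : H, ‖z‖ ^ p = (‖z‖ ^ 2) ^ (p / 2) := by
    intro z
    rw [← Real.rpow_natCast, ← Real.rpow_mul (norm_nonneg _)]
    congr 1
    push_cast
    ring
  set E := p / 2 / 2 * Real.exp (p / 2 / 2)
  have hE : 0 ≤ E := by positivity
  set a := ‖x‖ ^ 2 + ‖y‖ ^ 2 with ha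
  rcases (show 0 ≤ a by positivity).eq_or_lt with h0 | h0
  · have hx : x = 0 := by
      have : ‖x‖ ^ 2 = 0 := by nlinarith [sq_nonneg ‖x‖, sq_nonneg ‖y‖]
      simpa using this
    have hy : y = 0 := by
      have : ‖y‖ ^ 2 = 0 := by nlinarith [sq_nonneg ‖x‖, sq_nonneg ‖y‖]
      simpa using this
    have : p ≠ 0 := by linarith
    have h2 : p / 2 ≠ 0 := by positivity
    simp [hx, hy, Real.zero_rpow, this]
  -- In an inner product space `b` is `2 Re ⟪x, y⟫`. The parallelogram law gives `‖x ± y‖² = a ± b`,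
  -- so the two-point inequality applies with exponent `p / 2`.
  · set b := (‖x + y‖ ^ 2 - ‖x - y‖ ^ 2) / 2 with hb
    have hpar := hH x y
    have e1 : ‖x + y‖ ^ 2 = a + b := by rw [ha, hb]; linarith
    have e2 : ‖x - y‖ ^ 2 = a - b := by rw [ha, hb]; linarith
    have hb1 : |b| ≤ a := abs_le.2 ⟨by linarith [sq_nonneg ‖x + y‖], by linarith [sq_nonneg ‖x - y‖]⟩
    have hb2 : b ^ 2 ≤ 8 * ‖y‖ ^ 2 * a := by
      have h1 : |‖x + y‖ - ‖x - y‖| ≤ 2 * ‖y‖ := by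
        refine (abs_norm_sub_norm_le _ _).trans ?_
        have : x + y - (x - y) = y + y := by abel
        rw [this]
        linarith [norm_add_le y y]
      have h2 : ‖x + y‖ + ‖x - y‖ ≤ 2 * (‖x‖ + ‖y‖) := by
        linarith [norm_add_le x y, norm_sub_le x y]
      have h3 : b = (‖x + y‖ - ‖x - y‖) * (‖x + y‖ + ‖x - y‖) / 2 := by rw [hb]; ring
      have h4 : (‖x + y‖ - ‖x - y‖) ^ 2 ≤ (2 * ‖y‖) ^ 2 := by
        rw [← sq_abs]; gcongr
      have h5 : (‖x + y‖ + ‖x - y‖) ^ 2 ≤ (2 * (‖x‖ + ‖y‖)) ^ 2 := by gcongr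
      have h6 : (‖x‖ + ‖y‖) ^ 2 ≤ 2 * a := by rw [ha]; nlinarith [sq_nonneg (‖x‖ - ‖y‖)]
      calc b ^ 2 = (‖x + y‖ - ‖x - y‖) ^ 2 * (‖x + y‖ + ‖x - y‖) ^ 2 / 4 := by rw [h3]; ring
        _ ≤ (2 * ‖y‖) ^ 2 * (2 * (‖x‖ + ‖y‖)) ^ 2 / 4 := by gcongr
        _ = 4 * ‖y‖ ^ 2 * (‖x‖ + ‖y‖) ^ 2 := by ring
        _ ≤ 4 * ‖y‖ ^ 2 * (2 * a) := by gcongr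
        _ = _ := by ring
    rw [e, e, e1, e2]
    refine (two_point_inequality (by linarith) h0 hb1).trans ?_
    have h7 : b ^ 2 / a ≤ 8 * ‖y‖ ^ 2 := by rw [div_le_iff₀ h0]; exact hb2
    gcongr 2 * ?_ ^ (p / 2)
    calc a + E * (b ^ 2 / a) ≤ a + E * (8 * ‖y‖ ^ 2) := by gcongr
      _ = _ := by rw [ha]; ring

theorem parallelogram_of_inner (𝕜 : Type*) [RCLike 𝕜] (H : Type*) [NormedAddCommGroup H]
    [InnerProductSpace 𝕜 H] : Parallelogram H := parallelogram_law_with_norm 𝕜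

/-- Summing the inequalities of the summands leaves the `ℓ^(p/2)` norm of `‖x i‖² + C ‖y i‖²`, which
Minkowski's inequality splits. The constant is unchanged, so the argument can be iterated. -/
theorem PSmooth.lp {p : ℝ} (hp : 2 ≤ p) {C : ℝ} (hC : 0 ≤ C) {G : ℕ → Type*}
    [∀ i, NormedAddCommGroup (G i)] [Fact (1 ≤ ENNReal.ofReal p)] (h : ∀ i, PSmooth p C (G i)) :
    PSmooth p C (lp G (ENNReal.ofReal p)) := by
  intro x y
  have hp0 : 0 < p := by linarith
  have hP : (ENNReal.ofReal p).toReal = p := ENNReal.toReal_ofReal hp0.le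
  have hP0 : 0 < (ENNReal.ofReal p).toReal := by rwa [hP]
  have hs := (lp.hasSum_norm hP0 (x + y)).add (lp.hasSum_norm hP0 (x - y))
  rw [hP] at hs
  refine hasSum_le_of_sum_le hs fun s => ?_
  have e : ∀ t : ℝ, 0 ≤ t → (t ^ 2) ^ (p / 2) = t ^ p := by
    intro t ht
    rw [← Real.rpow_natCast, ← Real.rpow_mul ht]
    congr 1
    push_cast
    ring
  have e' : ∀ t : ℝ, 0 ≤ t → (t ^ p) ^ (1 / (p / 2)) = t ^ 2 := by
    intro t ht
    rw [← e t ht, ← Real.rpow_mul (by positivity), mul_one_div_cancel (by positivity),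
      Real.rpow_one]
  have h1 : ∑ i ∈ s, (‖(x + y) i‖ ^ p + ‖(x - y) i‖ ^ p) ≤
      ∑ i ∈ s, 2 * (‖x i‖ ^ 2 + C * ‖y i‖ ^ 2) ^ (p / 2) :=
    Finset.sum_le_sum fun i _ => h i (x i) (y i)
  refine h1.trans ?_
  rw [← Finset.mul_sum]
  gcongr
  have h2 := Real.Lp_add_le_of_nonneg (s := s) (f := fun i => ‖x i‖ ^ 2)
    (g := fun i => C * ‖y i‖ ^ 2) (show 1 ≤ p / 2 by linarith) (fun i _ => by positivity)
    (fun i _ => by positivity)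
  have hx : (∑ i ∈ s, (‖x i‖ ^ 2) ^ (p / 2)) ^ (1 / (p / 2)) ≤ ‖x‖ ^ 2 := by
    rw [← e' _ (norm_nonneg x)]
    refine Real.rpow_le_rpow (Finset.sum_nonneg fun i _ => by positivity) ?_ (by positivity)
    have := lp.sum_rpow_le_norm_rpow hP0 x s
    rw [hP] at this
    simpa [e] using this
  have hy : (∑ i ∈ s, (C * ‖y i‖ ^ 2) ^ (p / 2)) ^ (1 / (p / 2)) ≤ C * ‖y‖ ^ 2 := by
    have := lp.sum_rpow_le_norm_rpow hP0 y s
    rw [hP] at this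
    have h3 : ∑ i ∈ s, (C * ‖y i‖ ^ 2) ^ (p / 2) ≤ C ^ (p / 2) * ‖y‖ ^ p := by
      simp_rw [Real.mul_rpow hC (sq_nonneg _)]
      rw [← Finset.mul_sum]
      gcongr
      simpa [e] using this
    refine (Real.rpow_le_rpow (Finset.sum_nonneg fun i _ => by positivity) h3
      (by positivity)).trans (le_of_eq ?_)
    rw [Real.mul_rpow (by positivity) (by positivity), e' _ (norm_nonneg y), ← Real.rpow_mul hC,
      mul_one_div_cancel (by positivity), Real.rpow_one]
  have h4 : (∑ i ∈ s, (‖x i‖ ^ 2 + C * ‖y i‖ ^ 2) ^ (p / 2)) ^ (1 / (p / 2)) ≤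
      ‖x‖ ^ 2 + C * ‖y‖ ^ 2 := h2.trans (add_le_add hx hy)
  have h5 := Real.rpow_le_rpow (z := p / 2)
    (Real.rpow_nonneg (Finset.sum_nonneg fun i _ => by positivity) _) h4 (by positivity)
  rwa [← Real.rpow_mul (Finset.sum_nonneg fun i _ => by positivity),
    one_div_mul_cancel (by positivity), Real.rpow_one] at h5

/-! ### Disjointly supported families and truncations in `ℓ^p` sums -/

section LpTrunc

variable {ι : Type*} {G : ι → Type*} [∀ i, NormedAddCommGroup (G i)] {P : ℝ≥0∞}

theorem lp_norm_add_rpow_of_disjoint (hP : 0 < P.toReal) {x y : lp G P}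
    (h : ∀ j, x j = 0 ∨ y j = 0) :
    ‖x + y‖ ^ P.toReal = ‖x‖ ^ P.toReal + ‖y‖ ^ P.toReal := by
  refine (lp.hasSum_norm hP (x + y)).unique ?_
  convert (lp.hasSum_norm hP x).add (lp.hasSum_norm hP y) using 2 with j
  rw [lp.coeFn_add, Pi.add_apply]
  rcases h j with h | h <;> simp [h, Real.zero_rpow hP.ne']

theorem lp_norm_sum_rpow_of_disjoint [Fact (1 ≤ P)] {κ : Type*} (hP : 0 < P.toReal)
    {h : κ → lp G P} (hd : ∀ k l, k ≠ l → ∀ j, h k j = 0 ∨ h l j = 0) (s : Finset κ) :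
    ‖∑ k ∈ s, h k‖ ^ P.toReal = ∑ k ∈ s, ‖h k‖ ^ P.toReal := by
  classical
  induction s using Finset.induction_on with
  | empty => simp [Real.zero_rpow hP.ne']
  | insert a s ha ih =>
    rw [Finset.sum_insert ha, Finset.sum_insert ha, ← ih]
    refine lp_norm_add_rpow_of_disjoint hP fun j => ?_
    by_cases hj : h a j = 0
    · exact Or.inl hj
    · right
      rw [lp.coeFn_sum, Finset.sum_apply]
      refine Finset.sum_eq_zero fun k hk => ?_
      have : a ≠ k := fun e => ha (e ▸ hk)
      exact (hd a k this j).resolve_left hj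

end LpTrunc

section LpTruncNat

variable (𝕜 : Type*) [RCLike 𝕜] {G : ℕ → Type*} [∀ i, NormedAddCommGroup (G i)]
  [∀ i, NormedSpace 𝕜 (G i)] {P : ℝ≥0∞} [Fact (1 ≤ P)]

/-- The projection of an `ℓ^p` sum onto the first `n` summands. -/
def lpTrunc (n : ℕ) : lp G P →L[𝕜] lp G P :=
  ∑ j ∈ Finset.range n, (lp.singleContinuousLinearMap 𝕜 G P j).comp (lp.evalCLM 𝕜 G P j)

theorem lpTrunc_eq_sum (n : ℕ) (x : lp G P) :
    lpTrunc 𝕜 n x = ∑ j ∈ Finset.range n, lp.single P j (x j) := by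
  simp only [lpTrunc, _root_.sum_apply]
  rfl

theorem lpTrunc_apply (n : ℕ) (x : lp G P) (j : ℕ) :
    lpTrunc 𝕜 n x j = if j < n then x j else 0 := by
  rw [lpTrunc_eq_sum, lp.coeFn_sum, Finset.sum_apply]
  simp [Finset.sum_pi_single]

theorem lpTrunc_sub_apply {m n : ℕ} (hmn : m ≤ n) (x : lp G P) (j : ℕ) :
    (lpTrunc 𝕜 n x - lpTrunc 𝕜 m x) j = if m ≤ j ∧ j < n then x j else 0 := by
  rw [lp.coeFn_sub, Pi.sub_apply, lpTrunc_apply, lpTrunc_apply]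
  split_ifs <;> first | omega | simp

theorem tendsto_lpTrunc (hP : P ≠ ⊤) (x : lp G P) :
    Tendsto (fun n => lpTrunc 𝕜 n x) atTop (𝓝 x) := by
  simp_rw [lpTrunc_eq_sum]
  exact (lp.hasSum_single hP x).tendsto_sum_nat

theorem norm_lpTrunc_sub_rpow (hP : 0 < P.toReal) {m n : ℕ} (hmn : m ≤ n) (x : lp G P) :
    ‖lpTrunc 𝕜 n x - lpTrunc 𝕜 m x‖ ^ P.toReal = ∑ j ∈ Finset.Ico m n, ‖x j‖ ^ P.toReal := by
  rw [lpTrunc_eq_sum, lpTrunc_eq_sum, ← Finset.sum_Ico_eq_sub _ hmn]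
  exact lp.norm_sum_single hP _ _

theorem norm_lpTrunc_rpow (hP : 0 < P.toReal) (n : ℕ) (x : lp G P) :
    ‖lpTrunc 𝕜 n x‖ ^ P.toReal = ∑ j ∈ Finset.range n, ‖x j‖ ^ P.toReal := by
  rw [lpTrunc_eq_sum]
  exact lp.norm_sum_single hP _ _

theorem norm_lpTrunc_sub_le (hP : 0 < P.toReal) {m n : ℕ} (hmn : m ≤ n) (x : lp G P) :
    ‖lpTrunc 𝕜 n x - lpTrunc 𝕜 m x‖ ≤ ‖x‖ := by
  rw [← Real.rpow_le_rpow_iff (norm_nonneg _) (norm_nonneg _) hP, norm_lpTrunc_sub_rpow 𝕜 hP hmn]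
  exact lp.sum_rpow_le_norm_rpow hP x _

/-- The blocks cut out by successive intervals are disjointly supported, so the `P`-th powers of
their norms add. -/
theorem norm_sum_blocks_le (hP : 0 < P.toReal) {M : ℕ → ℕ} (hM : StrictMono M)
    (y : ℕ → lp G P) {a : ℕ → 𝕜} (ha : ∀ k, ‖a k‖ ≤ 1) {C₀ : ℝ} (hy : ∀ k, ‖y k‖ ≤ C₀) (K : ℕ) :
    ‖∑ k ∈ Finset.range K, a k • (lpTrunc 𝕜 (M (k + 1)) (y k) - lpTrunc 𝕜 (M k) (y k))‖ ≤
      C₀ * (K : ℝ) ^ (1 / P.toReal) := by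
  have hC : 0 ≤ C₀ := (norm_nonneg _).trans (hy 0)
  have h1 := lp_norm_sum_rpow_of_disjoint hP
    (h := fun k => a k • (lpTrunc 𝕜 (M (k + 1)) (y k) - lpTrunc 𝕜 (M k) (y k))) (by
      intro k l hkl j
      rw [lp.coeFn_smul, lp.coeFn_smul, Pi.smul_apply, Pi.smul_apply,
        lpTrunc_sub_apply 𝕜 (hM.monotone (Nat.le_add_right k 1)),
        lpTrunc_sub_apply 𝕜 (hM.monotone (Nat.le_add_right l 1))]
      rcases lt_or_gt_of_ne hkl with h | h
      · have : M (k + 1) ≤ M l := hM.monotone (Nat.succ_le_of_lt h)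
        by_cases hj : j < M (k + 1)
        · right
          rw [if_neg (by omega), smul_zero]
        · left
          rw [if_neg (by omega), smul_zero]
      · have : M (l + 1) ≤ M k := hM.monotone (Nat.succ_le_of_lt h)
        by_cases hj : j < M (l + 1)
        · left
          rw [if_neg (by omega), smul_zero]
        · right
          rw [if_neg (by omega), smul_zero]) (Finset.range K)
  rw [← Real.rpow_le_rpow_iff (norm_nonneg _) (by positivity) hP, h1,
    Real.mul_rpow hC (by positivity), ← Real.rpow_mul (by positivity), one_div_mul_cancel hP.ne',
    Real.rpow_one]
  calc _ ≤ ∑ k ∈ Finset.range K, C₀ ^ P.toReal := by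
        refine Finset.sum_le_sum fun k _ => Real.rpow_le_rpow (norm_nonneg _) ?_ hP.le
        rw [norm_smul]
        calc _ ≤ 1 * ‖y k‖ := by
              gcongr
              · exact ha k
              · exact norm_lpTrunc_sub_le 𝕜 hP (hM.monotone (Nat.le_add_right k 1)) _
          _ ≤ _ := by rw [one_mul]; exact hy k
    _ = _ := by simp [mul_comm]

end LpTruncNat

/-! ### Bounds for all sums with small coefficients -/

/-- All sums of `n` of the `φ i`, with coefficients of modulus at most one, have norm at most
`B n`. -/
def SumBound (𝕜 : Type*) [RCLike 𝕜] {V : Type*} [NormedAddCommGroup V] [NormedSpace 𝕜 V]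
    (φ : ℕ → V) (B : ℕ → ℝ) : Prop :=
  ∀ (F : Finset ℕ) (ε : ℕ → 𝕜), (∀ i, ‖ε i‖ ≤ 1) → ‖∑ i ∈ F, ε i • φ i‖ ≤ B F.card

section SumBound

variable {𝕜 : Type*} [RCLike 𝕜] {V W : Type*} [NormedAddCommGroup V] [NormedSpace 𝕜 V]
  [NormedAddCommGroup W] [NormedSpace 𝕜 W] {φ : ℕ → V} {B : ℕ → ℝ}

theorem SumBound.comp_injective (h : SumBound 𝕜 φ B) {i : ℕ → ℕ} (hi : Function.Injective i)
    {ε : ℕ → 𝕜} (hε : ∀ k, ‖ε k‖ ≤ 1) (K : ℕ) :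
    ‖∑ k ∈ Finset.range K, ε k • φ (i k)‖ ≤ B K := by
  have := h ((Finset.range K).map ⟨i, hi⟩) (fun n => ε (Function.invFun i n)) fun _ => hε _
  simpa [Finset.sum_map, Function.leftInverse_invFun hi _] using this

theorem SumBound.map (h : SumBound 𝕜 φ B) (T : V →L[𝕜] W) :
    SumBound 𝕜 (fun i => T (φ i)) (fun n => ‖T‖ * B n) := by
  intro F ε hε
  have : ∑ i ∈ F, ε i • T (φ i) = T (∑ i ∈ F, ε i • φ i) := by simp
  rw [this]
  exact T.le_opNorm_of_le (h F ε hε)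

theorem SumBound.mono (h : SumBound 𝕜 φ B) {B' : ℕ → ℝ} (hB : ∀ n, B n ≤ B' n) :
    SumBound 𝕜 φ B' := fun F ε hε => (h F ε hε).trans (hB _)

theorem SumBound.norm_le (h : SumBound 𝕜 φ B) (i : ℕ) : ‖φ i‖ ≤ B 1 := by
  simpa using h {i} (fun _ => 1) (by simp)

end SumBound

theorem signAverage_norm_add_le {Y : Type*} [NormedAddCommGroup Y] (h g : ℕ → Y) (K : ℕ)
    (x x' : Y) : signAverage (fun k => h k + g k) (fun z => ‖z‖) K (x + x') ≤
      signAverage h (fun z => ‖z‖) K x + signAverage g (fun z => ‖z‖) K x' := by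
  induction K generalizing x x' with
  | zero => exact norm_add_le x x'
  | succ K ih =>
    simp only [signAverage]
    have e1 : x + x' + (h K + g K) = (x + h K) + (x' + g K) := by abel
    have e2 : x + x' - (h K + g K) = (x - h K) + (x' - g K) := by abel
    rw [e1, e2]
    linarith [ih (x + h K) (x' + g K), ih (x - h K) (x' - g K)]

theorem exists_phase {𝕜 : Type*} [RCLike 𝕜] (z : 𝕜) :
    ∃ θ : 𝕜, ‖θ‖ ≤ 1 ∧ RCLike.re (θ * z) = ‖z‖ := by
  by_cases hz : z = 0
  · exact ⟨1, by simp, by simp [hz]⟩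
  · have h : (‖z‖ : ℝ) ≠ 0 := norm_ne_zero_iff.2 hz
    refine ⟨(‖z‖ : 𝕜)⁻¹ * star z, ?_, ?_⟩
    · rw [norm_mul, norm_inv, norm_star, RCLike.norm_ofReal, abs_norm, inv_mul_cancel₀ h]
    · have : (‖z‖ : 𝕜)⁻¹ * star z * z = ((‖z‖ : ℝ) : 𝕜) := by
        rw [mul_assoc, RCLike.star_def, RCLike.conj_mul]
        have : ((‖z‖ : ℝ) : 𝕜) ≠ 0 := by exact_mod_cast h
        field_simp
      rw [this, RCLike.ofReal_re]

/-! ### Gliding humps -/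

section Glide

variable {𝕜 : Type*} [RCLike 𝕜] {Y : Type*} [NormedAddCommGroup Y] [NormedSpace 𝕜 Y]

/-- After rotating each term to make its value nonnegative, the pairing inequality applies. The main
parts `h k` are bounded for every choice of signs, whereas the errors `g k` are bounded only on
average, through type two and Jensen's inequality. -/
theorem sum_norm_apply_le {C : ℝ} (hC : 0 ≤ C)
    (htype : ∀ (y : ℕ → Y) (K : ℕ), signAverage y (fun z => ‖z‖ ^ 2) K 0 ≤
      C * ∑ k ∈ Finset.range K, ‖y k‖ ^ 2)
    {φ : ℕ → StrongDual 𝕜 Y} {h g : ℕ → Y} {K : ℕ} {A D τ : ℝ}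
    (hA : ∀ ε : ℕ → 𝕜, IsSign ε → ‖∑ k ∈ Finset.range K, ε k • φ k‖ ≤ A)
    (hD : ∀ ε : ℕ → 𝕜, (∀ k, ‖ε k‖ ≤ 1) → ‖∑ k ∈ Finset.range K, ε k • h k‖ ≤ D)
    (hg : ∀ k, ‖g k‖ ≤ τ) :
    ∑ k ∈ Finset.range K, ‖φ k (h k + g k)‖ ≤ A * (D + √(C * K) * τ) := by
  have hA0 : 0 ≤ A := (norm_nonneg _).trans (hA 1 fun _ => Or.inl rfl)
  have hτ : 0 ≤ τ := (norm_nonneg _).trans (hg 0)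
  choose θ hθ hθ' using fun k => exists_phase (φ k (h k + g k))
  have h1 := sum_re_apply_le (fun k => θ k • h k + θ k • g k) hA
  have e : ∀ k, RCLike.re (φ k (θ k • h k + θ k • g k)) = ‖φ k (h k + g k)‖ := by
    intro k
    rw [← smul_add, map_smul, smul_eq_mul, hθ']
  simp only [e] at h1
  refine h1.trans ?_
  gcongr
  have h2 := signAverage_norm_add_le (fun k => θ k • h k) (fun k => θ k • g k) K 0 0
  rw [add_zero] at h2
  refine h2.trans (add_le_add ?_ ?_)
  · refine signAverage_le 𝕜 fun ε hε => ?_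
    have := hD (fun k => ε k * θ k) fun k => by
      rw [norm_mul, hε.norm_eq, one_mul]; exact hθ k
    simpa [mul_smul] using this
  · have h3 := signAverage_rpow_le (fun k => θ k • g k) (fun z => ‖z‖) (fun _ => norm_nonneg _)
      one_le_two K 0
    simp only [Real.rpow_two] at h3
    have h4 := htype (fun k => θ k • g k) K
    have h5 : ∑ k ∈ Finset.range K, ‖θ k • g k‖ ^ 2 ≤ K * τ ^ 2 := by
      calc _ ≤ ∑ k ∈ Finset.range K, τ ^ 2 := by
            refine Finset.sum_le_sum fun k _ => ?_
            rw [norm_smul]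
            have : ‖θ k‖ * ‖g k‖ ≤ 1 * τ := by
              gcongr
              · exact hθ k
              · exact hg k
            rw [one_mul] at this
            gcongr
        _ = _ := by simp
    have h6 : (signAverage (fun k => θ k • g k) (fun z => ‖z‖) K 0) ^ 2 ≤
        (√(C * K) * τ) ^ 2 := by
      rw [mul_pow, Real.sq_sqrt (by positivity)]
      calc _ ≤ _ := h3
        _ ≤ _ := h4
        _ ≤ C * (K * τ ^ 2) := by gcongr
        _ = _ := by ring
    exact le_of_sq_le_sq h6 (by positivity)

/-- Given a cut `M`, almost every `u i` has a head of norm at most `τ`. Once such an `i` is fixed, a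
later cut makes its tail smaller than `τ`, and `u i` is within `2 * τ` of the block between the
cuts. -/
theorem exists_glide (Q : ℕ → Y → Y) (hQ : ∀ y, Tendsto (fun n => Q n y) atTop (𝓝 y))
    {l : Filter ℕ} [l.NeBot] (hl : l ≤ atTop) {u : ℕ → Y} {τ : ℝ} (hτ : 0 < τ)
    (hhead : ∀ M, ∀ᶠ i in l, ‖Q M (u i)‖ ≤ τ) {good : ℕ → Prop} (hgood : ∀ᶠ i in l, good i) :
    ∃ i M : ℕ → ℕ, StrictMono i ∧ StrictMono M ∧
      ∀ k, good (i k) ∧ ‖u (i k) - (Q (M (k + 1)) (u (i k)) - Q (M k) (u (i k)))‖ ≤ 2 * τ := by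
  have step : ∀ s : ℕ × ℕ, ∃ s' : ℕ × ℕ, s.1 < s'.1 ∧ s.2 < s'.2 ∧ good s'.1 ∧
      ‖u s'.1 - (Q s'.2 (u s'.1) - Q s.2 (u s'.1))‖ ≤ 2 * τ := by
    rintro ⟨i, M⟩
    obtain ⟨i', h1, h2, h3⟩ :=
      ((hhead M).and (hgood.and (hl (eventually_gt_atTop i)))).exists
    have h4 : ∀ᶠ n in atTop, ‖u i' - Q n (u i')‖ < τ := by
      have := ((tendsto_const_nhds (x := u i')).sub (hQ (u i'))).norm
      rw [sub_self, norm_zero] at this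
      exact this.eventually (gt_mem_nhds hτ)
    obtain ⟨M', h5, h6⟩ := (h4.and (eventually_gt_atTop M)).exists
    refine ⟨(i', M'), h3, h6, h2, ?_⟩
    have e : u i' - (Q M' (u i') - Q M (u i')) = (u i' - Q M' (u i')) + Q M (u i') := by abel
    simp only [e]
    linarith [norm_add_le (u i' - Q M' (u i')) (Q M (u i'))]
  choose f hf1 hf2 hf3 hf4 using step
  -- The pair `s (k + 1)` is `(i k, M (k + 1))`: the index `i k` is chosen after the cut `M k`,
  -- together with the next cut.
  let s : ℕ → ℕ × ℕ := fun n => Nat.rec (f (0, 0)) (fun _ t => f t) n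
  have hs : ∀ n, s (n + 1) = f (s n) := fun _ => rfl
  refine ⟨fun k => (s (k + 1)).1, fun k => (s k).2, strictMono_nat_of_lt_succ fun k => ?_,
    strictMono_nat_of_lt_succ fun k => ?_, fun k => ⟨?_, ?_⟩⟩
  · rw [hs (k + 1)]; exact hf1 _
  · rw [hs k]; exact hf2 _
  · simp only [hs]; exact hf3 _
  · simp only [hs]; exact hf4 _

/-- This is the inequality to be contradicted. If the block bound `D K` is of smaller order than
`√K`, and `τ` is small compared with `η`, it fails for large `K`. -/
theorem glide_bound {C : ℝ} (hC : 0 ≤ C)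
    (htype : ∀ (y : ℕ → Y) (K : ℕ), signAverage y (fun z => ‖z‖ ^ 2) K 0 ≤
      C * ∑ k ∈ Finset.range K, ‖y k‖ ^ 2)
    (Q : ℕ → Y → Y) (hQ : ∀ y, Tendsto (fun n => Q n y) atTop (𝓝 y))
    {l : Filter ℕ} [l.NeBot] (hl : l ≤ atTop) {u : ℕ → Y} {φ : ℕ → StrongDual 𝕜 Y} {A : ℝ}
    (hφ : SumBound 𝕜 φ fun n => A * √n) {τ η : ℝ} (hτ : 0 < τ)
    (hhead : ∀ M, ∀ᶠ i in l, ‖Q M (u i)‖ ≤ τ) {good : ℕ → Prop} (hgood : ∀ᶠ i in l, good i)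
    (hη : ∀ᶠ i in l, η ≤ ‖φ i (u i)‖) {D : ℕ → ℝ}
    (hD : ∀ i M : ℕ → ℕ, StrictMono M → (∀ k, good (i k)) → ∀ (ε : ℕ → 𝕜) (K : ℕ),
      (∀ k, ‖ε k‖ ≤ 1) →
      ‖∑ k ∈ Finset.range K, ε k • (Q (M (k + 1)) (u (i k)) - Q (M k) (u (i k)))‖ ≤ D K)
    (K : ℕ) : K * η ≤ A * √K * (D K + √(C * K) * (2 * τ)) := by
  obtain ⟨i, M, hi, hM, h⟩ := exists_glide Q hQ hl hτ hhead (hgood.and hη)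
  have h1 := sum_norm_apply_le hC htype (φ := fun k => φ (i k))
    (h := fun k => Q (M (k + 1)) (u (i k)) - Q (M k) (u (i k)))
    (g := fun k => u (i k) - (Q (M (k + 1)) (u (i k)) - Q (M k) (u (i k)))) (K := K)
    (fun ε hε => hφ.comp_injective hi.injective (fun k => (hε.norm_eq k).le) K)
    (fun ε hε => hD i M hM (fun k => (h k).1.1) ε K hε) (fun k => (h k).2)
  refine le_trans ?_ h1
  calc (K : ℝ) * η = ∑ k ∈ Finset.range K, η := by simp
    _ ≤ _ := by
      refine Finset.sum_le_sum fun k _ => ?_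
      rw [add_sub_cancel]
      exact (h k).1.2

end Glide

theorem exists_nat_mul_rpow_lt {s : ℝ} (hs : s < 1) (c : ℝ) {η : ℝ} (hη : 0 < η) :
    ∃ K : ℕ, 0 < K ∧ c * (K : ℝ) ^ s < η * K := by
  have h1 : Tendsto (fun K : ℕ => (K : ℝ) ^ (1 - s)) atTop atTop :=
    (tendsto_rpow_atTop (by linarith)).comp tendsto_natCast_atTop_atTop
  obtain ⟨K, hK, hK0⟩ := ((h1.eventually_gt_atTop (c / η)).and (eventually_gt_atTop 0)).exists
  refine ⟨K, hK0, ?_⟩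
  have hK' : (0 : ℝ) < K := by exact_mod_cast hK0
  rw [div_lt_iff₀ hη] at hK
  have e : (K : ℝ) = (K : ℝ) ^ (1 - s) * (K : ℝ) ^ s := by
    rw [← Real.rpow_add hK']; simp
  calc c * (K : ℝ) ^ s < ((K : ℝ) ^ (1 - s) * η) * (K : ℝ) ^ s := by
        gcongr
    _ = η * ((K : ℝ) ^ (1 - s) * (K : ℝ) ^ s) := by ring
    _ = _ := by rw [← e]

theorem Ultrafilter.exists_tendsto_of_bounded {α : Type*} (l : Ultrafilter α) {f : α → ℝ} {B : ℝ}
    (h0 : ∀ i, 0 ≤ f i) (hf : ∀ i, f i ≤ B) : ∃ c, 0 ≤ c ∧ Tendsto f l (𝓝 c) := by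
  obtain ⟨c, hc, h⟩ := (isCompact_Icc (a := (0 : ℝ)) (b := B)).ultrafilter_le_nhds (l.map f) (by
    rw [le_principal_iff]
    exact Filter.Eventually.of_forall (f := (l : Filter α)) fun i => ⟨h0 i, hf i⟩)
  exact ⟨c, hc.1, h⟩

/-! ### Tails of diagonals through `ℓ^p` sums -/

section LpTail

variable {𝕜 : Type*} [RCLike 𝕜] {G : ℕ → Type*} [∀ i, NormedAddCommGroup (G i)]
  [∀ i, NormedSpace 𝕜 (G i)] {p : ℝ} [Fact (1 ≤ ENNReal.ofReal p)]

/-- Through an `ℓ^p` sum of type two, the diagonal of a pairing is carried by finitely many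
summands, up to a small error. -/
theorem eventually_tail_small (hp : 2 < p) (htype : HasTypeTwo (lp G (ENNReal.ofReal p)))
    {l : Ultrafilter ℕ} (hl : (l : Filter ℕ) ≤ atTop) {u : ℕ → lp G (ENNReal.ofReal p)} {C₀ : ℝ}
    (hu : ∀ i, ‖u i‖ ≤ C₀) {φ : ℕ → StrongDual 𝕜 (lp G (ENNReal.ofReal p))} {A : ℝ}
    (hφ : SumBound 𝕜 φ fun n => A * √n) {η : ℝ} (hη : 0 < η) :
    ∀ᶠ M in atTop, ∀ᶠ i in (l : Filter ℕ), ‖φ i (u i - lpTrunc 𝕜 M (u i))‖ < η := by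
  obtain ⟨C, hC, htype⟩ := htype
  have hp0 : 0 < p := by linarith
  have hP : (ENNReal.ofReal p).toReal = p := ENNReal.toReal_ofReal hp0.le
  have hP0 : 0 < (ENNReal.ofReal p).toReal := by rwa [hP]
  have hPne : ENNReal.ofReal p ≠ 0 := by simpa using hp0
  have hC₀ : 0 ≤ C₀ := (norm_nonneg _).trans (hu 0)
  have hA : 0 ≤ A := by simpa using (norm_nonneg _).trans (hφ.norm_le 0)
  choose c hc0 hc using fun j => l.exists_tendsto_of_bounded (f := fun i => ‖u i j‖) (B := C₀)
    (fun _ => norm_nonneg _) fun i => (lp.norm_apply_le_norm hPne _ _).trans (hu i)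
  have hsum : Summable fun j => c j ^ p := by
    refine summable_of_sum_le (c := C₀ ^ p) (fun j => Real.rpow_nonneg (hc0 j) p) fun s => ?_
    have h1 : Tendsto (fun i => ∑ j ∈ s, ‖u i j‖ ^ p) l (𝓝 (∑ j ∈ s, c j ^ p)) :=
      tendsto_finsetSum _ fun j _ => (hc j).rpow_const (Or.inr hp0.le)
    refine le_of_tendsto h1 (Eventually.of_forall fun i => ?_)
    have h2 := lp.sum_rpow_le_norm_rpow hP0 (u i) s
    rw [hP] at h2
    exact h2.trans (Real.rpow_le_rpow (norm_nonneg _) (hu i) hp0.le)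
  -- The type-two error in the gliding hump is `A * √C * (2 * τ) * K`. It may use up half of `η *
  -- K`.
  obtain ⟨τ, hτ, hτ'⟩ : ∃ τ : ℝ, 0 < τ ∧ A * √C * (2 * τ) ≤ η / 2 := by
    refine ⟨η / (4 * (A * √C + 1)), by positivity, ?_⟩
    have : A * √C * (2 * (η / (4 * (A * √C + 1)))) = η / 2 * (A * √C / (A * √C + 1)) := by
      field_simp; ring
    rw [this]
    have h1 : A * √C / (A * √C + 1) ≤ 1 := by
      rw [div_le_one (by positivity)]; linarith
    nlinarith
  have htail := tendsto_sum_nat_add fun j => c j ^ p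
  -- Beyond `M` the limit profile `c` has `ℓ^p` norm below `τ`, so every head of `u i - lpTrunc 𝕜 M
  -- (u i)` is eventually at most `τ`.
  filter_upwards [htail.eventually (gt_mem_nhds (Real.rpow_pos_of_pos hτ p))] with M hM
  by_contra hcon
  -- Along an ultrafilter, failure to be eventually small means being eventually at least `η`.
  rw [← Ultrafilter.eventually_not] at hcon
  have hu' : ∀ i, ‖u i - lpTrunc 𝕜 M (u i)‖ ≤ C₀ := by
    intro i
    have h1 : Tendsto (fun n => ‖lpTrunc 𝕜 n (u i) - lpTrunc 𝕜 M (u i)‖) atTop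
        (𝓝 ‖u i - lpTrunc 𝕜 M (u i)‖) :=
      ((tendsto_lpTrunc 𝕜 ENNReal.ofReal_ne_top (u i)).sub tendsto_const_nhds).norm
    refine le_of_tendsto h1 ((eventually_ge_atTop M).mono fun n hn => ?_)
    exact (norm_lpTrunc_sub_le 𝕜 hP0 hn _).trans (hu i)
  have hhead : ∀ n, ∀ᶠ i in (l : Filter ℕ),
      ‖lpTrunc 𝕜 n (u i - lpTrunc 𝕜 M (u i))‖ ≤ τ := by
    intro n
    have h1 : Tendsto (fun i => ∑ j ∈ Finset.Ico M n, ‖u i j‖ ^ p) l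
        (𝓝 (∑ j ∈ Finset.Ico M n, c j ^ p)) :=
      tendsto_finsetSum _ fun j _ => (hc j).rpow_const (Or.inr hp0.le)
    have h2 : ∑ j ∈ Finset.Ico M n, c j ^ p < τ ^ p := by
      refine lt_of_le_of_lt ?_ hM
      rw [Finset.sum_Ico_eq_sum_range]
      simp_rw [add_comm M]
      exact ((summable_nat_add_iff M).2 hsum).sum_le_tsum _
        fun k _ => Real.rpow_nonneg (hc0 _) p
    filter_upwards [h1.eventually (gt_mem_nhds h2)] with i hi
    rw [← Real.rpow_le_rpow_iff (norm_nonneg _) hτ.le hp0]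
    refine le_trans ?_ hi.le
    have h3 := norm_lpTrunc_rpow 𝕜 hP0 n (u i - lpTrunc 𝕜 M (u i))
    rw [hP] at h3
    rw [h3]
    have h4 : ∀ j, (u i - lpTrunc 𝕜 M (u i)) j = if j < M then 0 else u i j := by
      intro j
      rw [lp.coeFn_sub, Pi.sub_apply, lpTrunc_apply]
      split_ifs <;> simp
    simp only [h4]
    rw [← Finset.sum_filter_add_sum_filter_not (Finset.range n) (fun j => j < M)]
    have h5 : ∑ j ∈ Finset.range n with j < M, ‖if j < M then 0 else u i j‖ ^ p = 0 := by
      refine Finset.sum_eq_zero fun j hj => ?_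
      rw [if_pos (Finset.mem_filter.1 hj).2, norm_zero, Real.zero_rpow hp0.ne']
    rw [h5, zero_add]
    refine le_of_eq (Finset.sum_congr ?_ fun j hj => ?_)
    · ext j; simp; omega
    · rw [if_neg (by have := Finset.mem_Ico.1 hj; omega)]
  -- The functionals contribute `√K` and the blocks `K ^ (1 / p)`. The total exponent is below one
  -- exactly because `p > 2`.
  obtain ⟨K, hK0, hK⟩ := exists_nat_mul_rpow_lt (s := 1 / 2 + 1 / p) (by
    have : 1 / p < 1 / 2 := one_div_lt_one_div_of_lt (by norm_num) hp
    linarith) (A * C₀) (half_pos hη)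
  have hbd := glide_bound hC htype (fun n => lpTrunc 𝕜 n)
    (fun y => tendsto_lpTrunc 𝕜 ENNReal.ofReal_ne_top y) hl (u := fun i => u i - lpTrunc 𝕜 M (u i))
    hφ hτ hhead (good := fun _ => True) (by simp) (hcon.mono fun i hi => not_lt.1 hi)
    (D := fun K => C₀ * (K : ℝ) ^ (1 / p))
    (fun i m hm _ ε K hε => by
      have := norm_sum_blocks_le 𝕜 hP0 hm (fun k => u (i k) - lpTrunc 𝕜 M (u (i k))) hε
        (fun k => hu' (i k)) K
      rwa [hP] at this) K
  have hK' : (0 : ℝ) < K := by exact_mod_cast hK0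
  have e1 : √(C * K) = √C * √K := Real.sqrt_mul hC _
  have e2 : √(K : ℝ) * √K = K := Real.mul_self_sqrt hK'.le
  have e3 : √(K : ℝ) * (K : ℝ) ^ (1 / p) = (K : ℝ) ^ (1 / 2 + 1 / p) := by
    rw [Real.sqrt_eq_rpow, ← Real.rpow_add hK']
  have e4 : A * √K * (C₀ * (K : ℝ) ^ (1 / p) + √(C * K) * (2 * τ)) =
      A * C₀ * (√K * (K : ℝ) ^ (1 / p)) + (A * √C * (2 * τ)) * (√K * √K) := by rw [e1]; ring
  rw [e4, e3, e2] at hbd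
  nlinarith

end LpTail

theorem hasTypeTwo_lp_of_parallelogram {p : ℝ} (hp : 2 ≤ p) {G : ℕ → Type*}
    [∀ i, NormedAddCommGroup (G i)] [Fact (1 ≤ ENNReal.ofReal p)]
    (h : ∀ i, Parallelogram (G i)) : HasTypeTwo (lp G (ENNReal.ofReal p)) := by
  have hC : 0 ≤ 1 + 8 * (p / 2 / 2 * Real.exp (p / 2 / 2)) := by positivity
  exact (PSmooth.lp hp hC fun i => (h i).pSmooth hp).hasTypeTwo hp hC

theorem Parallelogram.hasTypeTwo {H : Type*} [NormedAddCommGroup H] (h : Parallelogram H) :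
    HasTypeTwo H :=
  ⟨1, zero_le_one, fun y K => by rw [h.signAverage_eq]; simp⟩

/-! ### Coordinates, truncations and diagonals in `X_{p,w}` -/

namespace WeightedSpace

variable {𝕜 : Type u} [RCLike 𝕜] {p : ℝ} {w : ℕ → ℝ} [hp : Fact (1 < p)]

variable (𝕜 p w) in
/-- The `ℓ^p` part of an element of `X_{p,w}`. -/
def pPart : WeightedSpace 𝕜 p w →L[𝕜] lp (fun _ : ℕ => 𝕜) (ENNReal.ofReal p) :=
  ((LinearMap.fst 𝕜 _ _).comp (toProd 𝕜 p w)).mkContinuous 1 fun x => by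
    rw [one_mul]; exact norm_fst_le (toProd 𝕜 p w x)

variable (𝕜 p w) in
/-- The weighted `ℓ^2` part of an element of `X_{p,w}`. -/
def twoPart : WeightedSpace 𝕜 p w →L[𝕜] lp (fun _ : ℕ => 𝕜) 2 :=
  ((LinearMap.snd 𝕜 _ _).comp (toProd 𝕜 p w)).mkContinuous 1 fun x => by
    rw [one_mul]; exact norm_snd_le (toProd 𝕜 p w x)

theorem norm_eq_max (x : WeightedSpace 𝕜 p w) : ‖x‖ = max ‖pPart 𝕜 p w x‖ ‖twoPart 𝕜 p w x‖ := rfl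

theorem norm_le_add (x : WeightedSpace 𝕜 p w) : ‖x‖ ≤ ‖pPart 𝕜 p w x‖ + ‖twoPart 𝕜 p w x‖ := by
  rw [norm_eq_max]
  exact max_le_add_of_nonneg (norm_nonneg _) (norm_nonneg _)

theorem norm_pPart_le (x : WeightedSpace 𝕜 p w) : ‖pPart 𝕜 p w x‖ ≤ ‖x‖ := le_max_left _ _

theorem norm_twoPart_le (x : WeightedSpace 𝕜 p w) : ‖twoPart 𝕜 p w x‖ ≤ ‖x‖ := le_max_right _ _

theorem pPart_apply (x : WeightedSpace 𝕜 p w) (n : ℕ) : pPart 𝕜 p w x n = x.1 n := rfl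

theorem twoPart_apply (x : WeightedSpace 𝕜 p w) (n : ℕ) :
    twoPart 𝕜 p w x n = (w n : 𝕜) * x.1 n := rfl

variable (𝕜 p w) in
/-- The `n`-th unit vector of `X_{p,w}`. -/
def basisVec (n : ℕ) : WeightedSpace 𝕜 p w :=
  ⟨Pi.single n 1, (lp.single (E := fun _ => 𝕜) (ENNReal.ofReal p) n (1 : 𝕜)).2, by
    have h : (fun k => (w k : 𝕜) * (Pi.single n 1 : ℕ → 𝕜) k) = Pi.single n (w n : 𝕜) := by
      funext k
      by_cases h : k = n
      · subst h; simp
      · simp [h]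
    rw [h]
    exact (lp.single (E := fun _ => 𝕜) 2 n (w n : 𝕜)).2⟩

theorem pPart_basisVec (n : ℕ) : pPart 𝕜 p w (basisVec 𝕜 p w n) =
    lp.single (E := fun _ => 𝕜) (ENNReal.ofReal p) n (1 : 𝕜) := rfl

theorem twoPart_basisVec (n : ℕ) : twoPart 𝕜 p w (basisVec 𝕜 p w n) =
    lp.single (E := fun _ => 𝕜) 2 n (w n : 𝕜) := by
  ext k
  rw [twoPart_apply]
  by_cases h : k = n
  · subst h; simp [basisVec]
  · simp [h, basisVec]

variable (𝕜 p w) in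
/-- The `n`-th coordinate functional on `X_{p,w}`. -/
def coord (n : ℕ) : StrongDual 𝕜 (WeightedSpace 𝕜 p w) :=
  (lp.evalCLM 𝕜 (fun _ => 𝕜) (ENNReal.ofReal p) n).comp (pPart 𝕜 p w)

theorem coord_apply (n : ℕ) (x : WeightedSpace 𝕜 p w) : coord 𝕜 p w n x = pPart 𝕜 p w x n := rfl

variable (𝕜 p w) in
/-- The projection of `X_{p,w}` onto the first `n` coordinates. -/
def trunc (n : ℕ) : WeightedSpace 𝕜 p w →L[𝕜] WeightedSpace 𝕜 p w :=
  ∑ j ∈ Finset.range n, (coord 𝕜 p w j).smulRight (basisVec 𝕜 p w j)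

theorem pPart_trunc (n : ℕ) (x : WeightedSpace 𝕜 p w) :
    pPart 𝕜 p w (trunc 𝕜 p w n x) = lpTrunc 𝕜 n (pPart 𝕜 p w x) := by
  rw [trunc, lpTrunc_eq_sum, _root_.sum_apply, map_sum]
  refine Finset.sum_congr rfl fun j _ => ?_
  rw [ContinuousLinearMap.smulRight_apply, map_smul, pPart_basisVec, ← lp.single_smul, smul_eq_mul,
    mul_one, coord_apply]

theorem twoPart_trunc (n : ℕ) (x : WeightedSpace 𝕜 p w) :
    twoPart 𝕜 p w (trunc 𝕜 p w n x) = lpTrunc 𝕜 n (twoPart 𝕜 p w x) := by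
  rw [trunc, lpTrunc_eq_sum, _root_.sum_apply, map_sum]
  refine Finset.sum_congr rfl fun j _ => ?_
  rw [ContinuousLinearMap.smulRight_apply, map_smul, twoPart_basisVec, ← lp.single_smul,
    smul_eq_mul, mul_comm, coord_apply]
  rfl

theorem tendsto_trunc (x : WeightedSpace 𝕜 p w) :
    Tendsto (fun n => trunc 𝕜 p w n x) atTop (𝓝 x) := by
  rw [tendsto_iff_norm_sub_tendsto_zero]
  have h1 := (tendsto_iff_norm_sub_tendsto_zero.1
    (tendsto_lpTrunc 𝕜 (P := ENNReal.ofReal p) ENNReal.ofReal_ne_top (pPart 𝕜 p w x)))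
  have h2 := (tendsto_iff_norm_sub_tendsto_zero.1
    (tendsto_lpTrunc 𝕜 (P := 2) (by simp) (twoPart 𝕜 p w x)))
  have h3 := h1.add h2
  rw [add_zero] at h3
  refine squeeze_zero (fun _ => norm_nonneg _) (fun n => ?_) h3
  refine (norm_le_add _).trans (le_of_eq ?_)
  rw [map_sub, map_sub, pPart_trunc, twoPart_trunc]

theorem norm_trunc_le_sum (n : ℕ) (x : WeightedSpace 𝕜 p w) :
    ‖trunc 𝕜 p w n x‖ ≤ ∑ j ∈ Finset.range n, ‖coord 𝕜 p w j x‖ * ‖basisVec 𝕜 p w j‖ := by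
  rw [trunc, _root_.sum_apply]
  refine (norm_sum_le _ _).trans (Finset.sum_le_sum fun j _ => ?_)
  rw [ContinuousLinearMap.smulRight_apply, norm_smul]

theorem hasTypeTwo (h2 : 2 ≤ p) : HasTypeTwo (WeightedSpace 𝕜 p w) := by
  refine ((hasTypeTwo_lp_of_parallelogram (G := fun _ => 𝕜) h2
    fun _ => parallelogram_of_inner 𝕜 𝕜).prod
      (parallelogram_of_inner 𝕜 (lp (fun _ : ℕ => 𝕜) 2)).hasTypeTwo).comap
      (toProd 𝕜 p w).toAddMonoidHom (c := 1) (c' := 1) (fun y => ?_) fun y => ?_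
  · rw [one_mul]; exact le_refl ‖toProd 𝕜 p w y‖
  · rw [one_mul]; exact le_refl ‖toProd 𝕜 p w y‖

/-- Through `X_{p,w}`, the diagonal of a pairing is controlled by the weighted `ℓ^2` parts. -/
theorem eventually_norm_apply_lt (h2 : 2 < p) {l : Ultrafilter ℕ} (hl : (l : Filter ℕ) ≤ atTop)
    {u : ℕ → WeightedSpace 𝕜 p w} {C₀ : ℝ} (hu : ∀ i, ‖u i‖ ≤ C₀)
    (hu0 : ∀ n, Tendsto (fun i => coord 𝕜 p w n (u i)) l (𝓝 0)) {β : ℝ}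
    (hub : ∀ᶠ i in (l : Filter ℕ), ‖twoPart 𝕜 p w (u i)‖ ≤ β)
    {φ : ℕ → StrongDual 𝕜 (WeightedSpace 𝕜 p w)} {A : ℝ} (hφ : SumBound 𝕜 φ fun n => A * √n)
    {η : ℝ} (hη : A * β < η) : ∀ᶠ i in (l : Filter ℕ), ‖φ i (u i)‖ < η := by
  obtain ⟨C, hC, htype⟩ := hasTypeTwo (𝕜 := 𝕜) (w := w) h2.le
  have hp0 : 0 < p := by linarith
  have hP : (ENNReal.ofReal p).toReal = p := ENNReal.toReal_ofReal hp0.le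
  have hP0 : 0 < (ENNReal.ofReal p).toReal := by rwa [hP]
  have hA : 0 ≤ A := by simpa using (norm_nonneg _).trans (hφ.norm_le 0)
  by_contra hcon
  rw [← Ultrafilter.eventually_not] at hcon
  obtain ⟨τ, hτ, hτ'⟩ : ∃ τ : ℝ, 0 < τ ∧ A * √C * (2 * τ) ≤ (η - A * β) / 2 := by
    have hη' : 0 < η - A * β := sub_pos.2 hη
    refine ⟨(η - A * β) / (4 * (A * √C + 1)), by positivity, ?_⟩
    have : A * √C * (2 * ((η - A * β) / (4 * (A * √C + 1)))) =
        (η - A * β) / 2 * (A * √C / (A * √C + 1)) := by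
      field_simp; ring
    rw [this]
    have h1 : A * √C / (A * √C + 1) ≤ 1 := by
      rw [div_le_one (by positivity)]; linarith
    nlinarith
  have hhead : ∀ M, ∀ᶠ i in (l : Filter ℕ), ‖trunc 𝕜 p w M (u i)‖ ≤ τ := by
    intro M
    have h1 : Tendsto (fun i => ∑ j ∈ Finset.range M, ‖coord 𝕜 p w j (u i)‖ * ‖basisVec 𝕜 p w j‖) l
        (𝓝 (∑ j ∈ Finset.range M, ‖(0 : 𝕜)‖ * ‖basisVec 𝕜 p w j‖)) :=
      tendsto_finsetSum _ fun j _ => (hu0 j).norm.mul_const _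
    simp only [norm_zero, zero_mul, Finset.sum_const_zero] at h1
    filter_upwards [h1.eventually (gt_mem_nhds hτ)] with i hi
    exact (norm_trunc_le_sum _ _).trans hi.le
  obtain ⟨K, hK0, hK⟩ := exists_nat_mul_rpow_lt (s := 1 / 2 + 1 / p) (by
    have : 1 / p < 1 / 2 := one_div_lt_one_div_of_lt (by norm_num) h2
    linarith) (A * C₀) (half_pos (sub_pos.2 hη))
  have hbd := glide_bound hC htype (fun n => trunc 𝕜 p w n) tendsto_trunc hl (u := u)
    hφ hτ hhead (good := fun i => ‖twoPart 𝕜 p w (u i)‖ ≤ β) hub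
    (hcon.mono fun i hi => not_lt.1 hi)
    -- The two terms come from the `ℓ^p` parts and from the weighted `ℓ²` parts. The second yields
    -- `A * β * K` in the final estimate, which is why only thresholds `η > A * β` are reached.
    (D := fun K => C₀ * (K : ℝ) ^ (1 / p) + β * √K)
    (fun i m hm hg ε K hε => by
      refine (norm_le_add _).trans (add_le_add ?_ ?_)
      · have := norm_sum_blocks_le 𝕜 hP0 hm (fun k => pPart 𝕜 p w (u (i k))) hε
          (fun k => (norm_pPart_le _).trans (hu (i k))) K
        rw [hP] at this
        simpa [pPart_trunc] using this
      · have := norm_sum_blocks_le 𝕜 (P := 2) (by norm_num) hm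
          (fun k => twoPart 𝕜 p w (u (i k))) hε hg K
        rw [ENNReal.toReal_ofNat, ← Real.sqrt_eq_rpow] at this
        simpa [twoPart_trunc] using this) K
  have hK' : (0 : ℝ) < K := by exact_mod_cast hK0
  have e1 : √(C * K) = √C * √K := Real.sqrt_mul hC _
  have e2 : √(K : ℝ) * √K = K := Real.mul_self_sqrt hK'.le
  have e3 : √(K : ℝ) * (K : ℝ) ^ (1 / p) = (K : ℝ) ^ (1 / 2 + 1 / p) := by
    rw [Real.sqrt_eq_rpow, ← Real.rpow_add hK']
  have e4 : A * √K * (C₀ * (K : ℝ) ^ (1 / p) + β * √K + √(C * K) * (2 * τ)) =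
      A * C₀ * (√K * (K : ℝ) ^ (1 / p)) + (A * β + A * √C * (2 * τ)) * (√K * √K) := by
    rw [e1]; ring
  rw [e4, e3, e2] at hbd
  nlinarith

end WeightedSpace

/-- A sequence whose sums grow sublinearly is weakly null. -/
theorem SumBound.tendsto_apply {𝕜 : Type*} [RCLike 𝕜] {V : Type*} [NormedAddCommGroup V]
    [NormedSpace 𝕜 V] {u : ℕ → V} {C : ℝ} (h : SumBound 𝕜 u fun n => C * √n) (f : StrongDual 𝕜 V) :
    Tendsto (fun i => f (u i)) atTop (𝓝 0) := by
  rw [tendsto_zero_iff_norm_tendsto_zero, ← Nat.cofinite_eq_atTop]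
  refine (tendsto_order.2 ⟨fun a ha => Eventually.of_forall fun i => ha.trans_le (norm_nonneg _),
    fun η hη => ?_⟩)
  by_contra hcon
  have hinf : {i | η ≤ ‖f (u i)‖}.Infinite := by
    intro hfin
    exact hcon (hfin.subset fun i (hi : ¬ ‖f (u i)‖ < η) => not_lt.1 hi)
  obtain ⟨K, hK0, hK⟩ := exists_nat_mul_rpow_lt (s := 1 / 2) (by norm_num) (‖f‖ * C) hη
  obtain ⟨F, hF, hFK⟩ := hinf.exists_subset_card_eq K
  choose θ hθ hθ' using fun i => exists_phase (f (u i))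
  have h1 : ∑ i ∈ F, ‖f (u i)‖ ≤ ‖f‖ * (C * √K) := by
    calc _ = RCLike.re (f (∑ i ∈ F, θ i • u i)) := by
          simp [hθ']
      _ ≤ ‖f (∑ i ∈ F, θ i • u i)‖ := RCLike.re_le_norm _
      _ ≤ ‖f‖ * (C * √K) := by
          refine f.le_opNorm_of_le ?_
          have := h F θ hθ
          rwa [hFK] at this
  have h2 : η * K ≤ ∑ i ∈ F, ‖f (u i)‖ := by
    calc η * K = ∑ i ∈ F, η := by simp [hFK, mul_comm]
      _ ≤ _ := Finset.sum_le_sum fun i hi => hF hi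
  rw [← Real.sqrt_eq_rpow] at hK
  linarith

/-! ### Cotype two and lower estimates -/

/-- A space of cotype two. -/
def HasCotypeTwo (G : Type*) [NormedAddCommGroup G] : Prop :=
  ∃ C : ℝ, 0 ≤ C ∧ ∀ (y : ℕ → G) (K : ℕ), ∑ k ∈ Finset.range K, ‖y k‖ ^ 2 ≤
    C * signAverage y (fun z => ‖z‖ ^ 2) K 0

theorem Parallelogram.hasCotypeTwo {H : Type*} [NormedAddCommGroup H] (h : Parallelogram H) :
    HasCotypeTwo H :=
  ⟨1, zero_le_one, fun y K => by rw [h.signAverage_eq]; simp⟩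

theorem HasCotypeTwo.comap {Y Z : Type*} [NormedAddCommGroup Y] [NormedAddCommGroup Z]
    (hZ : HasCotypeTwo Z) (j : Y →+ Z) {c c' : ℝ} (hj : ∀ y, ‖y‖ ≤ c * ‖j y‖)
    (hj' : ∀ y, ‖j y‖ ≤ c' * ‖y‖) : HasCotypeTwo Y := by
  obtain ⟨C, hC, h⟩ := hZ
  refine ⟨c ^ 2 * C * c' ^ 2, by positivity, fun y K => ?_⟩
  have h1 : signAverage y (fun z => ‖j z‖ ^ 2) K 0 ≤
      signAverage y (fun z => c' ^ 2 * ‖z‖ ^ 2) K 0 := by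
    have key : ∀ z : Y, ‖j z‖ ^ 2 ≤ c' ^ 2 * ‖z‖ ^ 2 := by
      intro z
      rw [← mul_pow]
      gcongr
      exact hj' z
    clear h
    generalize (0 : Y) = x
    induction K generalizing x with
    | zero => exact key x
    | succ K ih =>
      simp only [signAverage]
      linarith [ih (x + y K), ih (x - y K)]
  rw [signAverage_const_mul, signAverage_comp j y (fun z => ‖z‖ ^ 2), map_zero] at h1
  calc ∑ k ∈ Finset.range K, ‖y k‖ ^ 2 ≤ ∑ k ∈ Finset.range K, c ^ 2 * ‖j (y k)‖ ^ 2 := by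
        refine Finset.sum_le_sum fun k _ => ?_
        rw [← mul_pow]
        gcongr
        exact hj _
    _ ≤ c ^ 2 * (C * signAverage (fun k => j (y k)) (fun z => ‖z‖ ^ 2) K 0) := by
        rw [← Finset.mul_sum]
        gcongr
        exact h _ K
    _ ≤ c ^ 2 * (C * (c' ^ 2 * signAverage y (fun z => ‖z‖ ^ 2) K 0)) := by gcongr
    _ = _ := by ring

/-- All sums of `K` of the `u i`, with coefficients of modulus at most one, have norm at most
`B`. -/
def CardSumBound (𝕜 : Type*) [RCLike 𝕜] {V : Type*} [NormedAddCommGroup V] [NormedSpace 𝕜 V]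
    (u : ℕ → V) (K : ℕ) (B : ℝ) : Prop :=
  ∀ (F : Finset ℕ) (ε : ℕ → 𝕜), F.card = K → (∀ i, ‖ε i‖ ≤ 1) → ‖∑ i ∈ F, ε i • u i‖ ≤ B

section CardSumBound

variable {𝕜 : Type*} [RCLike 𝕜] {V W : Type*} [NormedAddCommGroup V] [NormedSpace 𝕜 V]
  [NormedAddCommGroup W] [NormedSpace 𝕜 W]

theorem CardSumBound.map {u : ℕ → V} {K : ℕ} {B : ℝ} (h : CardSumBound 𝕜 u K B) (T : V →L[𝕜] W)
    {c : ℝ} (hc : 0 ≤ c) (hT : ∀ x, ‖T x‖ ≤ c * ‖x‖) :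
    CardSumBound 𝕜 (fun i => T (u i)) K (c * B) := by
  intro F ε hF hε
  have : ∑ i ∈ F, ε i • T (u i) = T (∑ i ∈ F, ε i • u i) := by simp
  rw [this]
  refine (hT _).trans ?_
  gcongr
  exact h F ε hF hε

theorem CardSumBound.comp_injective {u : ℕ → V} {K : ℕ} {B : ℝ} (h : CardSumBound 𝕜 u K B)
    {i : ℕ → ℕ} (hi : Function.Injective i) {ε : ℕ → 𝕜} (hε : ∀ k, ‖ε k‖ ≤ 1) :
    ‖∑ k ∈ Finset.range K, ε k • u (i k)‖ ≤ B := by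
  have := h ((Finset.range K).map ⟨i, hi⟩) (fun n => ε (Function.invFun i n)) (by simp)
    fun _ => hε _
  simpa [Finset.sum_map, Function.leftInverse_invFun hi _] using this

/-- Otherwise infinitely many `u i` would violate the bound, and the cotype inequality for `K` of
them would contradict the bound on their signed sums. -/
theorem eventually_card_mul_sq_le {C : ℝ} (hC : 0 ≤ C)
    (hcot : ∀ (y : ℕ → V) (K : ℕ), ∑ k ∈ Finset.range K, ‖y k‖ ^ 2 ≤
      C * signAverage y (fun z => ‖z‖ ^ 2) K 0)
    {l : Ultrafilter ℕ} (hl : (l : Filter ℕ) ≤ atTop) {u : ℕ → V} {K : ℕ} (hK : 0 < K) {B : ℝ}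
    (h : CardSumBound 𝕜 u K B) : ∀ᶠ i in (l : Filter ℕ), K * ‖u i‖ ^ 2 ≤ C * B ^ 2 := by
  by_contra hcon
  rw [← Ultrafilter.eventually_not] at hcon
  obtain ⟨i, hi, hi'⟩ := extraction_of_frequently_atTop (hcon.frequently.filter_mono hl)
  have h1 := hcot (fun k => u (i k)) K
  have h2 : signAverage (fun k => u (i k)) (fun z => ‖z‖ ^ 2) K 0 ≤ B ^ 2 :=
    signAverage_le 𝕜 fun ε hε => by
      have := h.comp_injective hi.injective (fun k => (hε.norm_eq k).le)
      gcongr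
  have h3 : ∑ k ∈ Finset.range K, C * B ^ 2 < ∑ k ∈ Finset.range K, K * ‖u (i k)‖ ^ 2 :=
    Finset.sum_lt_sum_of_nonempty (by simpa using hK.ne') fun k _ => not_le.1 (hi' k)
  rw [Finset.sum_const, Finset.card_range, nsmul_eq_mul, ← Finset.mul_sum] at h3
  have hK' : (0 : ℝ) < K := by exact_mod_cast hK
  have h4 := lt_of_mul_lt_mul_left h3 hK'.le
  have h5 : C * signAverage (fun k => u (i k)) (fun z => ‖z‖ ^ 2) K 0 ≤ C * B ^ 2 := by gcongr
  linarith

/-- A form of the sign average with the signs chosen greedily: at each step one of `1`, `-1` does at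
least as well as the mean of the two. -/
theorem exists_re_apply_add_sum_ge {ι : Type*} (s : Finset ι) (φ : ι → StrongDual 𝕜 V)
    (y : ι → V) (ψ : StrongDual 𝕜 V) (x : V) : ∃ ε : ι → 𝕜, (∀ i, ‖ε i‖ ≤ 1) ∧
      RCLike.re (ψ x) + ∑ i ∈ s, RCLike.re (φ i (y i)) ≤
        RCLike.re ((ψ + ∑ i ∈ s, ε i • φ i) (x + ∑ i ∈ s, ε i • y i)) := by
  classical
  induction s using Finset.induction_on generalizing ψ x with
  | empty => exact ⟨fun _ => 0, by simp, by simp⟩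
  | insert a s ha ih =>
    have key : ∀ c : 𝕜, ‖c‖ ≤ 1 →
        RCLike.re (ψ x) + RCLike.re (φ a (y a)) ≤ RCLike.re ((ψ + c • φ a) (x + c • y a)) →
        ∃ ε : ι → 𝕜, (∀ i, ‖ε i‖ ≤ 1) ∧
        RCLike.re (ψ x) + ∑ i ∈ insert a s, RCLike.re (φ i (y i)) ≤
          RCLike.re ((ψ + ∑ i ∈ insert a s, ε i • φ i) (x + ∑ i ∈ insert a s, ε i • y i)) := by
      intro c hc h
      obtain ⟨ε, hε, h'⟩ := ih (ψ + c • φ a) (x + c • y a)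
      have hne : ∀ i ∈ s, i ≠ a := fun i hi e => ha (e ▸ hi)
      refine ⟨Function.update ε a c, fun i => ?_, ?_⟩
      · by_cases hi : i = a
        · subst hi; simpa using hc
        · simpa [hi] using hε i
      · have e2 : ∑ i ∈ s, Function.update ε a c i • y i = ∑ i ∈ s, ε i • y i :=
          Finset.sum_congr rfl fun i hi => by
            rw [Function.update_of_ne (hne i hi)]
        have e3 : ∑ i ∈ s, Function.update ε a c i • φ i = ∑ i ∈ s, ε i • φ i :=
          Finset.sum_congr rfl fun i hi => by
            rw [Function.update_of_ne (hne i hi)]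
        rw [Finset.sum_insert ha, Finset.sum_insert ha, Finset.sum_insert ha, e2, e3,
          Function.update_self, ← add_assoc, ← add_assoc, ← add_assoc]
        linarith
    by_cases h : RCLike.re (ψ x) + RCLike.re (φ a (y a)) ≤
        RCLike.re ((ψ + (1 : 𝕜) • φ a) (x + (1 : 𝕜) • y a))
    · exact key 1 (by simp) h
    · refine key (-1) (by simp) ?_
      simp at h ⊢
      linarith

theorem sum_norm_apply_le_mul {ι : Type*} (s : Finset ι) {φ : ι → StrongDual 𝕜 V}
    {y : ι → V} {A D : ℝ} (hA : ∀ ε : ι → 𝕜, (∀ i, ‖ε i‖ ≤ 1) → ‖∑ i ∈ s, ε i • φ i‖ ≤ A)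
    (hD : ∀ ε : ι → 𝕜, (∀ i, ‖ε i‖ ≤ 1) → ‖∑ i ∈ s, ε i • y i‖ ≤ D) :
    ∑ i ∈ s, ‖φ i (y i)‖ ≤ A * D := by
  choose θ hθ hθ' using fun i => exists_phase (φ i (y i))
  obtain ⟨ε, hε, h⟩ := exists_re_apply_add_sum_ge s φ (fun i => θ i • y i) 0 0
  simp only [map_smul, smul_eq_mul, hθ', zero_add] at h
  simp only [map_zero, zero_add] at h
  refine h.trans ((RCLike.re_le_norm _).trans (ContinuousLinearMap.le_of_opNorm_le_of_le _ ?_ ?_))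
  · exact hA ε hε
  · have := hD (fun i => ε i * θ i) fun i => by
      rw [norm_mul]
      exact mul_le_one₀ (hε i) (norm_nonneg _) (hθ i)
    simpa [mul_smul] using this

end CardSumBound

/-- A bounded operator from an `ℓ^p` sum, `p > 2`, to a Hilbert space is small on late summands. -/
theorem eventually_single_small {𝕜 : Type*} [RCLike 𝕜] {G : ℕ → Type*}
    [∀ i, NormedAddCommGroup (G i)] [∀ i, NormedSpace 𝕜 (G i)] {p : ℝ}
    [Fact (1 ≤ ENNReal.ofReal p)] (hp : 2 < p) {H : Type*} [NormedAddCommGroup H]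
    [NormedSpace 𝕜 H] (hH : Parallelogram H) (T : lp G (ENNReal.ofReal p) →L[𝕜] H) {δ : ℝ}
    (hδ : 0 < δ) : ∀ᶠ m in atTop, ∀ z : G m, ‖T (lp.single _ m z)‖ ≤ δ * ‖z‖ := by
  have hp0 : 0 < p := by linarith
  have hP : (ENNReal.ofReal p).toReal = p := ENNReal.toReal_ofReal hp0.le
  have hP0 : 0 < (ENNReal.ofReal p).toReal := by rwa [hP]
  by_contra hcon
  obtain ⟨m, hm, hm'⟩ := extraction_of_frequently_atTop (not_eventually.1 hcon)
  have : ∀ k, ∃ z : G (m k), ‖z‖ ≤ 1 ∧ δ ≤ ‖T (lp.single (ENNReal.ofReal p) (m k) z)‖ := by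
    intro k
    obtain ⟨z, hz⟩ := not_forall.1 (hm' k)
    have hz0 : z ≠ 0 := by
      rintro rfl
      simp at hz
    have hz1 : 0 < ‖z‖ := norm_pos_iff.2 hz0
    refine ⟨((‖z‖⁻¹ : ℝ) : 𝕜) • z, ?_, ?_⟩
    · rw [norm_smul, RCLike.norm_ofReal, abs_of_pos (by positivity), inv_mul_cancel₀ hz1.ne']
    · rw [lp.single_smul, map_smul, norm_smul, RCLike.norm_ofReal, abs_of_pos (by positivity),
        inv_mul_eq_div, le_div_iff₀ hz1]
      exact (not_le.1 hz).le
  choose z hz hz' using this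
  -- In the Hilbertian space the mean square of the signed sums of `K` images is at least `δ² K`,
  -- while disjointness in the domain bounds it by `‖T‖² K ^ (2 / p)`.
  obtain ⟨K, hK0, hK⟩ := exists_nat_mul_rpow_lt (s := 2 / p)
    (by rw [div_lt_one hp0]; exact hp) (‖T‖ ^ 2) (show 0 < δ ^ 2 by positivity)
  have h1 := hH.signAverage_eq (fun k => T (lp.single (ENNReal.ofReal p) (m k) (z k))) K 0
  have h2 : signAverage (fun k => T (lp.single (ENNReal.ofReal p) (m k) (z k)))
      (fun z => ‖z‖ ^ 2) K 0 ≤ ‖T‖ ^ 2 * (K : ℝ) ^ (2 / p) := by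
    refine signAverage_le 𝕜 fun ε hε => ?_
    have e : ∑ k ∈ Finset.range K, ε k • T (lp.single (ENNReal.ofReal p) (m k) (z k)) =
        T (∑ k ∈ Finset.range K, ε k • lp.single (ENNReal.ofReal p) (m k) (z k)) := by simp
    have h3 := lp_norm_sum_rpow_of_disjoint hP0
      (h := fun k => ε k • lp.single (ENNReal.ofReal p) (m k) (z k)) (by
        intro k l hkl j
        simp only [lp.coeFn_smul, Pi.smul_apply, lp.single_apply]
        by_cases hj : j = m k
        · right
          have : j ≠ m l := fun e => hkl (hm.injective (hj.symm.trans e))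
          simp [this]
        · left
          simp [hj]) (Finset.range K)
    rw [hP] at h3
    have h4 : ‖∑ k ∈ Finset.range K, ε k • lp.single (ENNReal.ofReal p) (m k) (z k)‖ ^ p ≤ K := by
      rw [h3]
      calc _ ≤ ∑ k ∈ Finset.range K, (1 : ℝ) := by
            refine Finset.sum_le_sum fun k _ => ?_
            rw [norm_smul, hε.norm_eq, one_mul, lp.norm_single (by simpa using hp0)]
            exact Real.rpow_le_one (norm_nonneg _) (hz k) hp0.le
        _ = K := by simp
    have h5 : ‖∑ k ∈ Finset.range K, ε k • lp.single (ENNReal.ofReal p) (m k) (z k)‖ ^ 2 ≤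
        (K : ℝ) ^ (2 / p) := by
      have := Real.rpow_le_rpow (by positivity) h4 (show 0 ≤ 2 / p by positivity)
      rw [← Real.rpow_mul (norm_nonneg _), mul_div_cancel₀ _ hp0.ne', Real.rpow_two] at this
      exact this
    rw [e]
    calc _ ≤ (‖T‖ * ‖∑ k ∈ Finset.range K, ε k • lp.single (ENNReal.ofReal p) (m k) (z k)‖) ^ 2 := by
          gcongr
          exact T.le_opNorm _
      _ ≤ _ := by
          rw [mul_pow]
          gcongr
  have h3 : δ ^ 2 * K ≤ ∑ k ∈ Finset.range K,
      ‖T (lp.single (ENNReal.ofReal p) (m k) (z k))‖ ^ 2 := by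
    calc δ ^ 2 * K = ∑ k ∈ Finset.range K, δ ^ 2 := by simp [mul_comm]
      _ ≤ _ := Finset.sum_le_sum fun k _ => by gcongr; exact hz' k
  simp at h1
  linarith

/-! ### Diagonal systems -/

/-- A sequence of vectors `e i` with functionals `f i`, `f i (e i) = 1`, which behave like the unit
vector basis of `X_{p,v}` for the constant weight `v = (N + 1) ^ (1 / p - 1 / 2)`. -/
structure DiagSystem {𝕜 : Type*} [RCLike 𝕜] {Z : Type*} [NormedAddCommGroup Z] [NormedSpace 𝕜 Z]
    (p : ℝ) (N : ℕ) (e : ℕ → Z) (f : ℕ → StrongDual 𝕜 Z) : Prop where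
  sumBound : SumBound 𝕜 e fun n => 2 * √n
  -- For the weight `(N + 1) ^ (1 / p - 1 / 2)`, the `ℓ^p` norm and the weighted `ℓ²` norm of a sum
  -- of `n` unit vectors agree at `n = N + 1`.
  cardSumBound : CardSumBound 𝕜 e (N + 1) (2 * ((N : ℝ) + 1) ^ (1 / p))
  dualBound : SumBound 𝕜 f fun n => ((N : ℝ) + 1) ^ (1 / 2 - 1 / p) * √n
  norm_le : ∀ i, ‖f i‖ ≤ 1
  apply_self : ∀ i, f i (e i) = 1

section DiagSystem

variable {𝕜 : Type u} [RCLike 𝕜] {Z : Type*} [NormedAddCommGroup Z] [NormedSpace 𝕜 Z]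
  {p : ℝ} {N : ℕ} {e : ℕ → Z} {f : ℕ → StrongDual 𝕜 Z}

theorem DiagSystem.norm_vec_le (h : DiagSystem p N e f) (i : ℕ) : ‖e i‖ ≤ 2 := by
  simpa using h.sumBound.norm_le i

theorem DiagSystem.dualBound_comp (h : DiagSystem p N e f) {Y : Type*} [NormedAddCommGroup Y]
    [NormedSpace 𝕜 Y] (P : Y →L[𝕜] Z) :
    SumBound 𝕜 (fun i => (f i).comp P) fun n => ‖P‖ * ((N : ℝ) + 1) ^ (1 / 2 - 1 / p) * √n := by
  have h1 := h.dualBound.map ((ContinuousLinearMap.compL 𝕜 Y Z 𝕜).flip P)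
  refine SumBound.mono h1 fun n => ?_
  have h2 : ‖(ContinuousLinearMap.compL 𝕜 Y Z 𝕜).flip P‖ ≤ ‖P‖ := by
    refine ContinuousLinearMap.opNorm_le_bound _ (norm_nonneg _) fun g => ?_
    rw [mul_comm]
    exact ContinuousLinearMap.opNorm_comp_le g P
  rw [mul_assoc]
  gcongr

theorem DiagSystem.norm_comp_le (h : DiagSystem p N e f) {Y : Type*} [NormedAddCommGroup Y]
    [NormedSpace 𝕜 Y] (P : Y →L[𝕜] Z) (i : ℕ) (y : Y) : ‖f i (P y)‖ ≤ ‖P‖ * ‖y‖ := by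
  calc _ ≤ 1 * ‖P y‖ := (f i).le_of_opNorm_le (h.norm_le i) _
    _ ≤ _ := by rw [one_mul]; exact P.le_opNorm y

theorem DiagSystem.eventually_lt_of_weighted [Fact (1 < p)] (h : DiagSystem p N e f) (hp : 2 < p)
    {w : ℕ → ℝ} (T : Z →L[𝕜] WeightedSpace 𝕜 p w) (P : WeightedSpace 𝕜 p w →L[𝕜] Z) {δ : ℝ}
    (hδ : 0 ≤ δ) (hT : ∀ z, ‖WeightedSpace.twoPart 𝕜 p w (T z)‖ ≤ δ * ‖z‖)
    {l : Ultrafilter ℕ} (hl : (l : Filter ℕ) ≤ atTop) {η : ℝ} (hη : 2 * ‖P‖ * δ < η) :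
    ∀ᶠ i in (l : Filter ℕ), ‖f i (P (T (e i)))‖ < η := by
  have hN : (0 : ℝ) < (N : ℝ) + 1 := by positivity
  -- The value of `β` comes from cotype two of `ℓ²`, applied to `N + 1` vectors. Its power of `N +
  -- 1` is inverse to the one in the bound for the functionals, so the product `2 * ‖P‖ * δ` does
  -- not depend on `N`.
  refine WeightedSpace.eventually_norm_apply_lt hp hl (u := fun i => T (e i))
    (φ := fun i => (f i).comp P) (C₀ := ‖T‖ * 2)
    (β := 2 * δ * ((N : ℝ) + 1) ^ (1 / p - 1 / 2))
    (fun i => T.le_opNorm_of_le (h.norm_vec_le i)) (fun n => ?_) ?_ (h.dualBound_comp P) ?_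
  · exact (h.sumBound.tendsto_apply ((WeightedSpace.coord 𝕜 p w n).comp T)).mono_left hl
  · have h1 := (h.cardSumBound.map ((WeightedSpace.twoPart 𝕜 p w).comp T) hδ hT)
    have h2 := parallelogram_of_inner 𝕜 (lp (fun _ : ℕ => 𝕜) 2)
    filter_upwards [eventually_card_mul_sq_le zero_le_one
      (fun y K => by rw [h2.signAverage_eq]; simp) hl (Nat.succ_pos N) h1] with i hi
    refine le_of_sq_le_sq ?_ (by positivity)
    have e1 : ((N : ℝ) + 1) ^ (1 / p) = ((N : ℝ) + 1) ^ (1 / p - 1 / 2) * √((N : ℝ) + 1) := by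
      rw [Real.sqrt_eq_rpow, ← Real.rpow_add hN]; congr 1; ring
    have e2 : 1 * (δ * (2 * ((N : ℝ) + 1) ^ (1 / p))) ^ 2 =
        ((N : ℝ) + 1) * (2 * δ * ((N : ℝ) + 1) ^ (1 / p - 1 / 2)) ^ 2 := by
      rw [e1]
      calc _ = (2 * δ * ((N : ℝ) + 1) ^ (1 / p - 1 / 2)) ^ 2 * (√((N : ℝ) + 1)) ^ 2 := by ring
        _ = _ := by rw [Real.sq_sqrt hN.le]; ring
    rw [e2] at hi
    push_cast at hi
    exact le_of_mul_le_mul_left hi hN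
  · have e1 : ((N : ℝ) + 1) ^ (1 / 2 - 1 / p) * ((N : ℝ) + 1) ^ (1 / p - 1 / 2) = 1 := by
      rw [← Real.rpow_add hN]; simp
    calc _ = 2 * ‖P‖ * δ * (((N : ℝ) + 1) ^ (1 / 2 - 1 / p) * ((N : ℝ) + 1) ^ (1 / p - 1 / 2)) := by
          ring
      _ < η := by rw [e1, mul_one]; exact hη

end DiagSystem

/-! ### Diagonals through `ℓ^p` sums of Hilbertian spaces -/

section LpSumLimits

variable {𝕜 : Type u} [RCLike 𝕜] {G : ℕ → Type*} [∀ i, NormedAddCommGroup (G i)]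
  [∀ i, NormedSpace 𝕜 (G i)] {p : ℝ} [Fact (1 ≤ ENNReal.ofReal p)]

/-- For `K` indices far along `l`, the mean square of the signed sums in the `j`-th summand is about
`K (c j)²`. Jensen's inequality with exponent `p / 2`, summed over `j`, compares this with the
`p`-th power of the norm. -/
theorem sum_limit_rpow_le (hp : 2 < p) (hG : ∀ j, Parallelogram (G j)) {l : Ultrafilter ℕ}
    (hl : (l : Filter ℕ) ≤ atTop) {u : ℕ → lp G (ENNReal.ofReal p)} {K : ℕ} {B : ℝ}
    (h : CardSumBound 𝕜 u K B) {c : ℕ → ℝ} (hc0 : ∀ j, 0 ≤ c j)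
    (hc : ∀ j, Tendsto (fun i => ‖u i j‖) l (𝓝 (c j))) (s : Finset ℕ) :
    (K : ℝ) ^ (p / 2) * ∑ j ∈ s, c j ^ p ≤ B ^ p := by
  have hp0 : 0 < p := by linarith
  have hP : (ENNReal.ofReal p).toReal = p := ENNReal.toReal_ofReal hp0.le
  have hP0 : 0 < (ENNReal.ofReal p).toReal := by rwa [hP]
  -- The norms only converge to `c j`, so they are bounded below by `t * c j` with `t < 1`, and `t`
  -- tends to one at the end.
  have key : ∀ t : ℝ, 0 ≤ t → t < 1 →
      t ^ p * ((K : ℝ) ^ (p / 2) * ∑ j ∈ s, c j ^ p) ≤ B ^ p := by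
    intro t ht0 ht1
    have h1 : ∀ j, ∀ᶠ i in (l : Filter ℕ), t * c j ≤ ‖u i j‖ := by
      intro j
      rcases (hc0 j).eq_or_lt with h0 | h0
      · exact Eventually.of_forall fun i => by rw [← h0, mul_zero]; exact norm_nonneg _
      · exact ((hc j).eventually (lt_mem_nhds (show t * c j < c j by nlinarith))).mono
          fun i hi => hi.le
    have h2 : ∀ᶠ i in (l : Filter ℕ), ∀ j ∈ s, t * c j ≤ ‖u i j‖ :=
      (eventually_all_finset s).2 fun j _ => h1 j
    obtain ⟨i, hi, hi'⟩ := extraction_of_frequently_atTop (h2.frequently.filter_mono hl)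
    have h3 : signAverage (fun k => u (i k)) (fun z => ∑ j ∈ s, (‖z j‖ ^ 2) ^ (p / 2)) K 0 ≤
        B ^ p := by
      refine signAverage_le 𝕜 fun ε hε => ?_
      have h4 := h.comp_injective hi.injective (fun k => (hε.norm_eq k).le)
      have h5 := lp.sum_rpow_le_norm_rpow hP0 (∑ k ∈ Finset.range K, ε k • u (i k)) s
      rw [hP] at h5
      refine le_trans (le_of_eq ?_) (h5.trans (Real.rpow_le_rpow (norm_nonneg _) h4 hp0.le))
      refine Finset.sum_congr rfl fun j _ => ?_
      rw [← Real.rpow_natCast, ← Real.rpow_mul (norm_nonneg _)]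
      congr 1
      push_cast
      ring
    rw [signAverage_sum] at h3
    refine le_trans ?_ h3
    rw [Finset.mul_sum, Finset.mul_sum]
    refine Finset.sum_le_sum fun j hj => ?_
    have h4 := signAverage_comp (lp.evalCLM 𝕜 G (ENNReal.ofReal p) j) (fun k => u (i k))
      (fun z => ‖z‖ ^ 2) K 0
    have h5 := signAverage_rpow_le (fun k => u (i k)) (fun z => ‖z j‖ ^ 2)
      (fun _ => sq_nonneg _) (show 1 ≤ p / 2 by linarith) K 0
    refine le_trans ?_ h5
    have h6 : signAverage (fun k => u (i k)) (fun z => ‖z j‖ ^ 2) K 0 =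
        ∑ k ∈ Finset.range K, ‖u (i k) j‖ ^ 2 := by
      refine h4.trans ?_
      rw [(hG j).signAverage_eq]
      simp
      rfl
    rw [h6]
    have h7 : (K : ℝ) * (t * c j) ^ 2 ≤ ∑ k ∈ Finset.range K, ‖u (i k) j‖ ^ 2 := by
      calc (K : ℝ) * (t * c j) ^ 2 = ∑ k ∈ Finset.range K, (t * c j) ^ 2 := by simp
        _ ≤ _ := by
          refine Finset.sum_le_sum fun k _ => ?_
          have := hi' k j hj
          have h0 : 0 ≤ t * c j := mul_nonneg ht0 (hc0 j)
          gcongr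
    have h0 : 0 ≤ t * c j := mul_nonneg ht0 (hc0 j)
    refine le_trans (le_of_eq ?_) (Real.rpow_le_rpow (by positivity) h7 (by linarith))
    have e : ((t * c j) ^ 2) ^ (p / 2) = (t * c j) ^ p := by
      rw [← Real.rpow_natCast, ← Real.rpow_mul h0]
      congr 1
      push_cast
      ring
    rw [Real.mul_rpow (by positivity) (by positivity), e, Real.mul_rpow ht0 (hc0 j)]
    ring
  have hlim : Tendsto (fun t : ℝ => t ^ p * ((K : ℝ) ^ (p / 2) * ∑ j ∈ s, c j ^ p)) (𝓝[<] 1)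
      (𝓝 (1 ^ p * ((K : ℝ) ^ (p / 2) * ∑ j ∈ s, c j ^ p))) := by
    refine Tendsto.mul_const _ (Tendsto.rpow_const ?_ (Or.inr hp0.le))
    exact tendsto_id.mono_left nhdsWithin_le_nhds
  rw [Real.one_rpow, one_mul] at hlim
  refine le_of_tendsto hlim ?_
  filter_upwards [Ioo_mem_nhdsLT (show (0 : ℝ) < 1 by norm_num)] with t ht
  exact key t ht.1.le ht.2

variable {Z : Type*} [NormedAddCommGroup Z] [NormedSpace 𝕜 Z]

/-- Through an `ℓ^p` sum of Hilbert spaces, the diagonal of a pairing is small. -/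
theorem DiagSystem.eventually_lt_of_lp {N : ℕ} {e : ℕ → Z} {f : ℕ → StrongDual 𝕜 Z}
    (h : DiagSystem p N e f) (hp : 2 < p) (hG : ∀ j, Parallelogram (G j))
    (T : Z →L[𝕜] lp G (ENNReal.ofReal p)) (P : lp G (ENNReal.ofReal p) →L[𝕜] Z)
    {l : Ultrafilter ℕ} (hl : (l : Filter ℕ) ≤ atTop) {η : ℝ}
    (hη : ‖P‖ * (‖T‖ * 2 * ((N : ℝ) + 1) ^ (1 / p - 1 / 2)) < η) :
    ∀ᶠ i in (l : Filter ℕ), ‖f i (P (T (e i)))‖ < η := by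
  have hp0 : 0 < p := by linarith
  have hP : (ENNReal.ofReal p).toReal = p := ENNReal.toReal_ofReal hp0.le
  have hP0 : 0 < (ENNReal.ofReal p).toReal := by rwa [hP]
  have hPne : ENNReal.ofReal p ≠ 0 := by simpa using hp0
  have hN : (0 : ℝ) < (N : ℝ) + 1 := by positivity
  set b := ‖T‖ * 2 * ((N : ℝ) + 1) ^ (1 / p - 1 / 2) with hb
  have hb0 : 0 ≤ b := by positivity
  -- Here `b` bounds the limiting `ℓ^p` norm of the heads. Half of the slack goes to the tail and
  -- half to the excess `ρ` of the heads over `b`.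
  set η' := (η - ‖P‖ * b) / 2 with hη'
  have hη'0 : 0 < η' := half_pos (sub_pos.2 hη)
  set ρ := η' / (‖P‖ + 1) with hρ
  have hρ0 : 0 < ρ := by positivity
  have hρ1 : ‖P‖ * ρ ≤ η' := by
    rw [hρ, mul_div_assoc', div_le_iff₀ (by positivity)]
    nlinarith [norm_nonneg P]
  have hu : ∀ i, ‖T (e i)‖ ≤ ‖T‖ * 2 := fun i => T.le_opNorm_of_le (h.norm_vec_le i)
  obtain ⟨M, hM⟩ := (eventually_tail_small hp (hasTypeTwo_lp_of_parallelogram hp.le hG) hl hu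
    (h.dualBound_comp P) hη'0).exists
  choose c hc0 hc using fun j => l.exists_tendsto_of_bounded (f := fun i => ‖T (e i) j‖)
    (B := ‖T‖ * 2) (fun _ => norm_nonneg _)
    fun i => (lp.norm_apply_le_norm hPne _ _).trans (hu i)
  have h1 := sum_limit_rpow_le hp hG hl (h.cardSumBound.map T (norm_nonneg T) T.le_opNorm) hc0 hc
    (Finset.range M)
  have h2 : ∑ j ∈ Finset.range M, c j ^ p ≤ b ^ p := by
    have e1 : ‖T‖ * (2 * ((N : ℝ) + 1) ^ (1 / p)) = b * ((N : ℝ) + 1) ^ (1 / 2 : ℝ) := by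
      rw [hb, mul_assoc (‖T‖ * 2), ← Real.rpow_add hN, ← mul_assoc]
      congr 2
      ring
    rw [e1, Real.mul_rpow hb0 (by positivity), ← Real.rpow_mul hN.le, mul_comm (b ^ p)] at h1
    push_cast at h1
    have e2 : 1 / 2 * p = p / 2 := by ring
    rw [e2] at h1
    exact le_of_mul_le_mul_left h1 (by positivity)
  have h3 : Tendsto (fun i => ∑ j ∈ Finset.range M, ‖T (e i) j‖ ^ p) l
      (𝓝 (∑ j ∈ Finset.range M, c j ^ p)) :=
    tendsto_finsetSum _ fun j _ => (hc j).rpow_const (Or.inr hp0.le)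
  have h4 : b ^ p < (b + ρ) ^ p := Real.rpow_lt_rpow hb0 (by linarith) hp0
  filter_upwards [hM, h3.eventually (gt_mem_nhds (h2.trans_lt h4))] with i hi1 hi2
  have h5 : ‖lpTrunc 𝕜 M (T (e i))‖ ≤ b + ρ := by
    rw [← Real.rpow_le_rpow_iff (norm_nonneg _) (by positivity) hp0]
    have := norm_lpTrunc_rpow 𝕜 hP0 M (T (e i))
    rw [hP] at this
    rw [this]
    exact hi2.le
  have h6 : ‖f i (P (lpTrunc 𝕜 M (T (e i))))‖ ≤ ‖P‖ * (b + ρ) :=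
    (h.norm_comp_le P i _).trans (by gcongr)
  have e3 : f i (P (T (e i))) = f i (P (T (e i) - lpTrunc 𝕜 M (T (e i)))) +
      f i (P (lpTrunc 𝕜 M (T (e i)))) := by
    rw [← map_add, ← map_add, sub_add_cancel]
  rw [e3]
  refine (norm_add_le _ _).trans_lt ?_
  have hi1' : ‖f i (P (T (e i) - lpTrunc 𝕜 M (T (e i))))‖ < η' := hi1
  nlinarith

/-- A family of diagonal systems as in Rosenthal's space does not factor, even only on the
diagonal, through an `ℓ^p` sum of spaces isomorphic to Hilbert spaces. -/
theorem false_of_diag_through_lp (hp : 2 < p) (htype : HasTypeTwo (lp G (ENNReal.ofReal p)))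
    (hcot : ∀ j, HasCotypeTwo (G j)) {e : ℕ → ℕ → Z} {f : ℕ → ℕ → StrongDual 𝕜 Z}
    (h : ∀ N, DiagSystem p N (e N) (f N))
    (hf : ∀ N : ℕ → ℕ, Function.Injective N → ∀ (s : Finset (Σ _ : ℕ, ℕ)) (a : (Σ _ : ℕ, ℕ) → 𝕜),
      ‖∑ x ∈ s, a x • f (N x.1) x.2‖ ≤
        √(∑ x ∈ s, ‖a x‖ ^ 2 * ((N x.1 : ℝ) + 1) ^ (1 - 2 / p)))
    (T : Z →L[𝕜] lp G (ENNReal.ofReal p)) (P : lp G (ENNReal.ofReal p) →L[𝕜] Z)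
    {l : Ultrafilter ℕ} (hl : (l : Filter ℕ) ≤ atTop)
    (hdiag : ∀ N, ∀ᶠ i in (l : Filter ℕ), 1 / 2 ≤ ‖f N i (P (T (e N i)))‖) : False := by
  have hp0 : 0 < p := by linarith
  have hP : (ENNReal.ofReal p).toReal = p := ENNReal.toReal_ofReal hp0.le
  have hP0 : 0 < (ENNReal.ofReal p).toReal := by rwa [hP]
  have hPne : ENNReal.ofReal p ≠ 0 := by simpa using hp0
  have hθ : 0 < 1 - 2 / p := by rw [sub_pos, div_lt_one hp0]; exact hp
  have hN : ∀ N : ℕ, (0 : ℝ) < (N : ℝ) + 1 := fun N => by positivity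
  have hu : ∀ N i, ‖T (e N i)‖ ≤ ‖T‖ * 2 := fun N i => T.le_opNorm_of_le ((h N).norm_vec_le i)
  -- each coordinate is small when `N` is large
  have hcoord : ∀ j, ∀ δ : ℝ, 0 < δ → ∀ᶠ N : ℕ in atTop, ∀ᶠ i in (l : Filter ℕ),
      ‖T (e N i) j‖ ≤ δ := by
    intro j δ hδ
    obtain ⟨C, hC, hcot⟩ := hcot j
    have h1 : Tendsto (fun N : ℕ => ((N : ℝ) + 1) ^ (1 - 2 / p)) atTop atTop :=
      (tendsto_rpow_atTop hθ).comp
        (tendsto_atTop_add_const_right _ _ tendsto_natCast_atTop_atTop)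
    filter_upwards [h1.eventually_ge_atTop (C * (‖T‖ * 2) ^ 2 / δ ^ 2)] with N hNδ
    have h2 := (h N).cardSumBound.map ((lp.evalCLM 𝕜 G (ENNReal.ofReal p) j).comp T)
      (norm_nonneg T) (fun x => (lp.norm_apply_le_norm hPne _ _).trans (T.le_opNorm x))
    filter_upwards [eventually_card_mul_sq_le hC hcot hl (Nat.succ_pos N) h2] with i hi
    have hi' : ((N : ℝ) + 1) * ‖T (e N i) j‖ ^ 2 ≤ C * (‖T‖ * (2 * ((N : ℝ) + 1) ^ (1 / p))) ^ 2 := by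
      exact_mod_cast hi
    rw [div_le_iff₀ (by positivity)] at hNδ
    refine le_of_sq_le_sq (le_of_mul_le_mul_left (hi'.trans ?_) (hN N)) hδ.le
    have e1 : (((N : ℝ) + 1) ^ (1 / p)) ^ 2 = ((N : ℝ) + 1) ^ (2 / p) := by
      rw [← Real.rpow_natCast, ← Real.rpow_mul (hN N).le]
      congr 1
      push_cast
      ring
    have e2 : (N : ℝ) + 1 = ((N : ℝ) + 1) ^ (1 - 2 / p) * ((N : ℝ) + 1) ^ (2 / p) := by
      rw [← Real.rpow_add (hN N)]; simp
    calc C * (‖T‖ * (2 * ((N : ℝ) + 1) ^ (1 / p))) ^ 2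
        = C * (‖T‖ * 2) ^ 2 * (((N : ℝ) + 1) ^ (1 / p)) ^ 2 := by ring
      _ ≤ ((N : ℝ) + 1) ^ (1 - 2 / p) * δ ^ 2 * (((N : ℝ) + 1) ^ (1 / p)) ^ 2 := by gcongr
      _ = (((N : ℝ) + 1) ^ (1 - 2 / p) * ((N : ℝ) + 1) ^ (2 / p)) * δ ^ 2 := by rw [e1]; ring
      _ = _ := by rw [← e2]
  -- The cotype constant depends on the summand, so `N` has to be taken large after the first `M`
  -- summands are fixed.
  have hhead : ∀ M, ∀ᶠ N in atTop, ∀ᶠ i in (l : Filter ℕ),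
      ‖f N i (P (lpTrunc 𝕜 M (T (e N i))))‖ ≤ 1 / 8 := by
    intro M
    set δ : ℝ := 1 / (8 * (‖P‖ + 1) * (M + 1)) with hδ
    have hδ0 : 0 < δ := by positivity
    filter_upwards [(eventually_all_finset (Finset.range M)).2 fun j _ => hcoord j δ hδ0] with N hNj
    filter_upwards [(eventually_all_finset (Finset.range M)).2 hNj] with i hi
    refine ((h N).norm_comp_le P i _).trans ?_
    have h1 : ‖lpTrunc 𝕜 M (T (e N i))‖ ≤ M * δ := by
      rw [lpTrunc_eq_sum]
      refine (norm_sum_le _ _).trans ?_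
      calc _ ≤ ∑ j ∈ Finset.range M, δ := by
            refine Finset.sum_le_sum fun j hj => ?_
            rw [lp.norm_single (by simpa using hp0)]
            exact hi j hj
        _ = _ := by simp
    have h2 : (M : ℝ) * δ ≤ 1 / (8 * (‖P‖ + 1)) := by
      rw [hδ, mul_one_div, div_le_div_iff₀ (by positivity) (by positivity)]
      nlinarith [norm_nonneg P]
    calc ‖P‖ * ‖lpTrunc 𝕜 M (T (e N i))‖ ≤ ‖P‖ * (1 / (8 * (‖P‖ + 1))) := by
          gcongr; exact h1.trans h2
      _ ≤ 1 / 8 := by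
          rw [mul_one_div, div_le_div_iff₀ (by positivity) (by positivity)]
          nlinarith [norm_nonneg P]
  -- The hump now glides in the number `N` of the system. Of the diagonal `1 / 2`, the head takes at
  -- most `1 / 8` and the tail at most `1 / 8`.
  have step : ∀ s : ℕ × ℕ, ∃ s' : ℕ × ℕ, s.1 < s'.1 ∧ s.2 < s'.2 ∧ ∀ᶠ i in (l : Filter ℕ),
      1 / 4 ≤ ‖f s'.1 i (P (lpTrunc 𝕜 s'.2 (T (e s'.1 i)) - lpTrunc 𝕜 s.2 (T (e s'.1 i))))‖ := by
    rintro ⟨N, M⟩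
    obtain ⟨N', hN', hNN'⟩ := ((hhead M).and (eventually_gt_atTop N)).exists
    obtain ⟨M', hM', hMM'⟩ := ((eventually_tail_small hp htype hl (hu N') ((h N').dualBound_comp P)
      (show (0 : ℝ) < 1 / 8 by norm_num)).and (eventually_gt_atTop M)).exists
    refine ⟨(N', M'), hNN', hMM', ?_⟩
    filter_upwards [hN', hM', hdiag N'] with i h1 h2 h3
    have h2' : ‖f N' i (P (T (e N' i) - lpTrunc 𝕜 M' (T (e N' i))))‖ < 1 / 8 := h2
    have e1 : f N' i (P (T (e N' i))) = f N' i (P (T (e N' i) - lpTrunc 𝕜 M' (T (e N' i)))) +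
        f N' i (P (lpTrunc 𝕜 M (T (e N' i)))) +
        f N' i (P (lpTrunc 𝕜 M' (T (e N' i)) - lpTrunc 𝕜 M (T (e N' i)))) := by
      rw [← map_add, ← map_add, ← map_add, ← map_add]
      congr 2
      abel
    rw [e1] at h3
    have h4 := norm_add₃_le (a := f N' i (P (T (e N' i) - lpTrunc 𝕜 M' (T (e N' i)))))
      (b := f N' i (P (lpTrunc 𝕜 M (T (e N' i)))))
      (c := f N' i (P (lpTrunc 𝕜 M' (T (e N' i)) - lpTrunc 𝕜 M (T (e N' i)))))
    linarith
  choose g hg1 hg2 hg3 using step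
  let s : ℕ → ℕ × ℕ := fun n => Nat.rec (0, 0) (fun _ t => g t) n
  have hs : ∀ n, s (n + 1) = g (s n) := fun _ => rfl
  set N : ℕ → ℕ := fun k => (s (k + 1)).1 with hNdef
  set M : ℕ → ℕ := fun k => (s k).2 with hMdef
  have hNm : StrictMono N := strictMono_nat_of_lt_succ fun k => by
    simp only [hNdef]; rw [hs (k + 1)]; exact hg1 _
  have hMm : StrictMono M := strictMono_nat_of_lt_succ fun k => by
    simp only [hMdef]; rw [hs k]; exact hg2 _
  have hNM : ∀ k, ∀ᶠ i in (l : Filter ℕ), 1 / 4 ≤ ‖f (N k) i (P (lpTrunc 𝕜 (M (k + 1))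
      (T (e (N k) i)) - lpTrunc 𝕜 (M k) (T (e (N k) i))))‖ := fun k => hg3 (s k)
  have hF : ∀ k, ∃ F : Finset ℕ, F.card = N k + 1 ∧ ∀ i ∈ F, 1 / 4 ≤ ‖f (N k) i (P (lpTrunc 𝕜
      (M (k + 1)) (T (e (N k) i)) - lpTrunc 𝕜 (M k) (T (e (N k) i))))‖ := by
    intro k
    obtain ⟨i, hi, hi'⟩ := extraction_of_frequently_atTop ((hNM k).frequently.filter_mono hl)
    refine ⟨(Finset.range (N k + 1)).map ⟨i, hi.injective⟩, by simp, fun n hn => ?_⟩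
    obtain ⟨m, -, rfl⟩ := Finset.mem_map.1 hn
    exact hi' m
  choose F hF1 hF2 using hF
  obtain ⟨L, hL0, hL⟩ := exists_nat_mul_rpow_lt (s := 1 / 2 + 1 / p) (by
    have : 1 / p < 1 / 2 := one_div_lt_one_div_of_lt (by norm_num) hp
    linarith) (‖P‖ * (‖T‖ * 2)) (show (0 : ℝ) < 1 / 4 by norm_num)
  have hL' : (0 : ℝ) < L := by exact_mod_cast hL0
  -- normalizing factors
  set r : ℕ → ℝ := fun k => (((N k : ℕ) : ℝ) + 1) ^ (-(1 / p)) with hr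
  set r' : ℕ → ℝ := fun k => (((N k : ℕ) : ℝ) + 1) ^ (1 / p - 1) with hr'
  have hr0 : ∀ k, 0 ≤ r k := fun k => Real.rpow_nonneg (hN _).le _
  have hr'0 : ∀ k, 0 ≤ r' k := fun k => Real.rpow_nonneg (hN _).le _
  -- The set `F k` has `N k + 1` elements, so the weights in each group add up to one and each `k`
  -- contributes at least `1 / 4` to the pairing.
  have hrr : ∀ k, r' k * r k = (((N k : ℕ) : ℝ) + 1)⁻¹ := fun k => by
    simp only [hr, hr']
    rw [← Real.rpow_add (hN _), ← Real.rpow_neg_one]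
    congr 1
    ring
  have hcardinv : ∀ k, ((F k).card : ℝ) * (((N k : ℕ) : ℝ) + 1)⁻¹ = 1 := fun k => by
    rw [hF1]
    push_cast
    exact mul_inv_cancel₀ (hN _).ne'
  have htr := sum_norm_apply_le_mul ((Finset.range L).sigma F)
    (φ := fun x => (r' x.1 : 𝕜) • (f (N x.1) x.2).comp P)
    (y := fun x => (r x.1 : 𝕜) • (lpTrunc 𝕜 (M (x.1 + 1)) (T (e (N x.1) x.2)) -
      lpTrunc 𝕜 (M x.1) (T (e (N x.1) x.2))))
    (A := ‖P‖ * √L) (D := ‖T‖ * 2 * (L : ℝ) ^ (1 / p)) ?_ ?_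
  · have hlow : (1 / 4 : ℝ) * L ≤ ∑ x ∈ (Finset.range L).sigma F,
        ‖((r' x.1 : 𝕜) • (f (N x.1) x.2).comp P) ((r x.1 : 𝕜) • (lpTrunc 𝕜 (M (x.1 + 1))
          (T (e (N x.1) x.2)) - lpTrunc 𝕜 (M x.1) (T (e (N x.1) x.2))))‖ := by
      rw [Finset.sum_sigma]
      calc (1 / 4 : ℝ) * L = ∑ k ∈ Finset.range L, (1 / 4 : ℝ) := by simp; ring
        _ ≤ _ := by
          refine Finset.sum_le_sum fun k _ => ?_
          calc (1 / 4 : ℝ) = ∑ i ∈ F k, r' k * r k * (1 / 4) := by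
                rw [Finset.sum_const, nsmul_eq_mul, hrr, ← mul_assoc, hcardinv, one_mul]
            _ ≤ _ := by
              refine Finset.sum_le_sum fun i hi => ?_
              simp only [_root_.smul_apply, ContinuousLinearMap.comp_apply, map_smul,
                norm_smul, RCLike.norm_ofReal, abs_of_nonneg (hr0 k), abs_of_nonneg (hr'0 k)]
              rw [mul_comm (r' k) (r k), mul_assoc]
              have := hF2 k i hi
              have h0 := hr0 k
              have h0' := hr'0 k
              gcongr
    have e1 : ‖P‖ * √L * (‖T‖ * 2 * (L : ℝ) ^ (1 / p)) =
        ‖P‖ * (‖T‖ * 2) * (L : ℝ) ^ (1 / 2 + 1 / p) := by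
      rw [Real.rpow_add hL', ← Real.sqrt_eq_rpow]; ring
    linarith
  · intro ε hε
    have e1 : ∑ x ∈ (Finset.range L).sigma F, ε x • ((r' x.1 : 𝕜) • (f (N x.1) x.2).comp P) =
        (∑ x ∈ (Finset.range L).sigma F, (ε x * (r' x.1 : 𝕜)) • f (N x.1) x.2).comp P := by
      ext y
      simp [mul_assoc]
    rw [e1]
    refine (ContinuousLinearMap.opNorm_comp_le _ _).trans ?_
    rw [mul_comm]
    gcongr
    refine (hf N hNm.injective _ _).trans (Real.sqrt_le_sqrt ?_)
    rw [Finset.sum_sigma]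
    calc _ ≤ ∑ k ∈ Finset.range L, ∑ i ∈ F k, (((N k : ℕ) : ℝ) + 1)⁻¹ := by
          refine Finset.sum_le_sum fun k _ => Finset.sum_le_sum fun i _ => ?_
          have h1 : ‖ε ⟨k, i⟩ * (r' k : 𝕜)‖ ≤ r' k := by
            rw [norm_mul, RCLike.norm_ofReal, abs_of_nonneg (hr'0 k)]
            exact mul_le_of_le_one_left (hr'0 k) (hε _)
          -- Each group of functionals thus contributes at most one under the square root, whence
          -- the bound `√L`.
          have h2 : r' k ^ 2 * (((N k : ℕ) : ℝ) + 1) ^ (1 - 2 / p) = (((N k : ℕ) : ℝ) + 1)⁻¹ := by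
            simp only [hr']
            rw [← Real.rpow_natCast, ← Real.rpow_mul (hN _).le, ← Real.rpow_add (hN _),
              ← Real.rpow_neg_one]
            congr 1
            push_cast
            ring
          have h3 := hN (N k)
          calc _ ≤ r' k ^ 2 * (((N k : ℕ) : ℝ) + 1) ^ (1 - 2 / p) := by
                simp only
                gcongr
            _ = _ := h2
      _ = ∑ k ∈ Finset.range L, (1 : ℝ) := by
          refine Finset.sum_congr rfl fun k _ => ?_
          rw [Finset.sum_const, nsmul_eq_mul, hcardinv]
      _ = L := by simp
  · intro ε hε
    -- All vectors of group `k` use the same range of summands, so they are first collected into the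
    -- image of one vector of norm at most `2`. Disjointness is used only between the `L` groups.
    have e1 : ∑ x ∈ (Finset.range L).sigma F, ε x • ((r x.1 : 𝕜) • (lpTrunc 𝕜 (M (x.1 + 1))
        (T (e (N x.1) x.2)) - lpTrunc 𝕜 (M x.1) (T (e (N x.1) x.2)))) =
        ∑ k ∈ Finset.range L, (1 : 𝕜) • (lpTrunc 𝕜 (M (k + 1))
          (T ((r k : 𝕜) • ∑ i ∈ F k, ε ⟨k, i⟩ • e (N k) i)) -
          lpTrunc 𝕜 (M k) (T ((r k : 𝕜) • ∑ i ∈ F k, ε ⟨k, i⟩ • e (N k) i))) := by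
      rw [Finset.sum_sigma]
      refine Finset.sum_congr rfl fun k _ => ?_
      rw [one_smul]
      simp only [map_smul, map_sum]
      rw [← smul_sub, ← Finset.sum_sub_distrib, Finset.smul_sum]
      refine Finset.sum_congr rfl fun i _ => ?_
      rw [← smul_sub, smul_comm]
    rw [e1]
    have := norm_sum_blocks_le 𝕜 hP0 hMm
      (fun k => T ((r k : 𝕜) • ∑ i ∈ F k, ε ⟨k, i⟩ • e (N k) i)) (a := fun _ => (1 : 𝕜))
      (by simp) (C₀ := ‖T‖ * 2) (fun k => T.le_opNorm_of_le ?_) L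
    · rwa [hP] at this
    · rw [norm_smul, RCLike.norm_ofReal, abs_of_nonneg (hr0 k)]
      have h1 := (h (N k)).cardSumBound (F k) (fun i => ε ⟨k, i⟩) (hF1 k) fun i => hε _
      calc _ ≤ r k * (2 * (((N k : ℕ) : ℝ) + 1) ^ (1 / p)) := by
            have h0 := hr0 k
            gcongr
        _ = 2 := by
            simp only [hr]
            rw [mul_left_comm, ← Real.rpow_add (hN _)]
            simp

end LpSumLimits

/-! ### Blocks in `X_{p,w}` -/

namespace WeightedSpace

/-- The sum of `w n ^ (2p / (p - 2))` over a finite set. -/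
def mass (p : ℝ) (w : ℕ → ℝ) (F : Finset ℕ) : ℝ := ∑ n ∈ F, w n ^ (2 * p / (p - 2))

/-- The coefficients of blocks. -/
def blockCoeff (p : ℝ) (w : ℕ → ℝ) (n : ℕ) : ℝ := w n ^ (2 / (p - 2))

section Coefficients

variable {p : ℝ} {w : ℕ → ℝ}

/-- The exponent `2 / (p - 2)` is the one for which the coefficient `c n` makes `c n ^ p`, `(w n * c
n) ^ 2` and `(w n ^ 2 * c n) ^ (p / (p - 1))` equal. All norms of a block and of its functional are
then controlled by powers of the mass. -/
theorem blockCoeff_rpow (hw : ∀ n, 0 < w n) (n : ℕ) :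
    blockCoeff p w n ^ p = w n ^ (2 * p / (p - 2)) := by
  rw [blockCoeff, ← Real.rpow_mul (hw n).le]
  congr 1
  ring

theorem sq_mul_blockCoeff_sq (h2 : 2 < p) (hw : ∀ n, 0 < w n) (n : ℕ) :
    (w n * blockCoeff p w n) ^ 2 = w n ^ (2 * p / (p - 2)) := by
  have : p - 2 ≠ 0 := by linarith
  have h : w n * blockCoeff p w n = w n ^ (1 + 2 / (p - 2)) := by
    rw [Real.rpow_add (hw n), Real.rpow_one, blockCoeff]
  rw [h, ← Real.rpow_natCast, ← Real.rpow_mul (hw n).le]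
  congr 1
  push_cast
  field_simp
  ring

theorem sq_mul_blockCoeff_rpow (h2 : 2 < p) (hw : ∀ n, 0 < w n) (n : ℕ) :
    (w n ^ 2 * blockCoeff p w n) ^ (p / (p - 1)) = w n ^ (2 * p / (p - 2)) := by
  have h1 : p - 2 ≠ 0 := by linarith
  have h1' : p - 1 ≠ 0 := by linarith
  have h : w n ^ 2 * blockCoeff p w n = w n ^ (2 + 2 / (p - 2)) := by
    rw [Real.rpow_add (hw n), Real.rpow_two, blockCoeff]
  rw [h, ← Real.rpow_mul (hw n).le]
  congr 1
  field_simp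
  ring

theorem blockCoeff_nonneg (hw : ∀ n, 0 < w n) (n : ℕ) : 0 ≤ blockCoeff p w n :=
  Real.rpow_nonneg (hw n).le _

end Coefficients

variable {𝕜 : Type u} [RCLike 𝕜] {p : ℝ} {w : ℕ → ℝ} [hp : Fact (1 < p)]

variable (𝕜 p w) in
/-- The normalized block supported by `F`. -/
def blockVec (F : Finset ℕ) : WeightedSpace 𝕜 p w :=
  ((mass p w F ^ (-(1 / p)) : ℝ) : 𝕜) •
    ∑ n ∈ F, ((blockCoeff p w n : ℝ) : 𝕜) • basisVec 𝕜 p w n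

variable (𝕜 p w) in
/-- The functional biorthogonal to the normalized block supported by `F`. -/
def blockFun (F : Finset ℕ) : StrongDual 𝕜 (WeightedSpace 𝕜 p w) :=
  ((mass p w F ^ (1 / p - 1) : ℝ) : 𝕜) •
    ∑ n ∈ F, ((w n ^ 2 * blockCoeff p w n : ℝ) : 𝕜) • coord 𝕜 p w n

theorem pPart_blockVec (F : Finset ℕ) : pPart 𝕜 p w (blockVec 𝕜 p w F) =
    ((mass p w F ^ (-(1 / p)) : ℝ) : 𝕜) •
      ∑ n ∈ F, lp.single (E := fun _ => 𝕜) (ENNReal.ofReal p) n ((blockCoeff p w n : ℝ) : 𝕜) := by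
  rw [blockVec, map_smul, map_sum]
  congr 1
  refine Finset.sum_congr rfl fun n _ => ?_
  rw [map_smul, pPart_basisVec, ← lp.single_smul, smul_eq_mul, mul_one]

theorem twoPart_blockVec (F : Finset ℕ) : twoPart 𝕜 p w (blockVec 𝕜 p w F) =
    ((mass p w F ^ (-(1 / p)) : ℝ) : 𝕜) •
      ∑ n ∈ F, lp.single (E := fun _ => 𝕜) 2 n ((w n * blockCoeff p w n : ℝ) : 𝕜) := by
  simp [blockVec, twoPart_basisVec, ← lp.single_smul, mul_comm]

theorem norm_pPart_blockVec (hw : ∀ n, 0 < w n) {F : Finset ℕ} (hF : 0 < mass p w F) :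
    ‖pPart 𝕜 p w (blockVec 𝕜 p w F)‖ = 1 := by
  have hp0 : 0 < p := zero_lt_one.trans hp.out
  have hP : (ENNReal.ofReal p).toReal = p := ENNReal.toReal_ofReal hp0.le
  have h1 := lp.norm_sum_single (E := fun _ : ℕ => 𝕜) (p := ENNReal.ofReal p) (by rwa [hP])
    (fun n => ((blockCoeff p w n : ℝ) : 𝕜)) F
  have h2 : ∑ n ∈ F, ‖((blockCoeff p w n : ℝ) : 𝕜)‖ ^ p = mass p w F := by
    refine Finset.sum_congr rfl fun n _ => ?_
    rw [RCLike.norm_ofReal, abs_of_nonneg (blockCoeff_nonneg hw n), blockCoeff_rpow hw]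
  rw [hP, h2] at h1
  have h3 : ‖∑ n ∈ F, lp.single (E := fun _ => 𝕜) (ENNReal.ofReal p) n
      ((blockCoeff p w n : ℝ) : 𝕜)‖ = mass p w F ^ (1 / p) := by
    rw [← h1, ← Real.rpow_mul (norm_nonneg _), mul_one_div_cancel hp0.ne', Real.rpow_one]
  rw [pPart_blockVec, norm_smul, RCLike.norm_ofReal, abs_of_nonneg (by positivity), h3,
    ← Real.rpow_add hF]
  simp

theorem norm_twoPart_blockVec_sq (h2 : 2 < p) (hw : ∀ n, 0 < w n) {F : Finset ℕ}
    (hF : 0 < mass p w F) :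
    ‖twoPart 𝕜 p w (blockVec 𝕜 p w F)‖ ^ 2 = mass p w F ^ (1 - 2 / p) := by
  have h1 := lp.norm_sum_single (E := fun _ : ℕ => 𝕜) (p := 2) (by norm_num)
    (fun n => ((w n * blockCoeff p w n : ℝ) : 𝕜)) F
  simp only [ENNReal.toReal_ofNat, Real.rpow_two] at h1
  have h3 : ∑ n ∈ F, ‖((w n * blockCoeff p w n : ℝ) : 𝕜)‖ ^ 2 = mass p w F := by
    refine Finset.sum_congr rfl fun n _ => ?_
    rw [RCLike.norm_ofReal, sq_abs, sq_mul_blockCoeff_sq h2 hw]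
  rw [twoPart_blockVec, norm_smul, RCLike.norm_ofReal, abs_of_nonneg (by positivity), mul_pow, h1,
    h3, ← Real.rpow_natCast, ← Real.rpow_mul hF.le]
  nth_rewrite 2 [← Real.rpow_one (mass p w F)]
  rw [← Real.rpow_add hF]
  congr 1
  push_cast
  ring

theorem blockFun_apply (F : Finset ℕ) (x : WeightedSpace 𝕜 p w) : blockFun 𝕜 p w F x =
    ((mass p w F ^ (1 / p - 1) : ℝ) : 𝕜) *
      ∑ n ∈ F, ((w n ^ 2 * blockCoeff p w n : ℝ) : 𝕜) * pPart 𝕜 p w x n := by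
  simp [blockFun, coord_apply]

theorem blockFun_blockVec (h2 : 2 < p) (hw : ∀ n, 0 < w n) {F : Finset ℕ}
    (hF : 0 < mass p w F) : blockFun 𝕜 p w F (blockVec 𝕜 p w F) = 1 := by
  have h1 : ∀ n ∈ F, pPart 𝕜 p w (blockVec 𝕜 p w F) n =
      ((mass p w F ^ (-(1 / p)) * blockCoeff p w n : ℝ) : 𝕜) := by
    intro n hn
    rw [pPart_blockVec, lp.coeFn_smul, Pi.smul_apply, lp.coeFn_sum, Finset.sum_apply]
    simp [hn, Finset.sum_pi_single]
  rw [blockFun_apply]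
  have h3 : ∑ n ∈ F, ((w n ^ 2 * blockCoeff p w n : ℝ) : 𝕜) *
      pPart 𝕜 p w (blockVec 𝕜 p w F) n =
      ((mass p w F ^ (-(1 / p)) * mass p w F : ℝ) : 𝕜) := by
    have e : ∀ n ∈ F, ((w n ^ 2 * blockCoeff p w n : ℝ) : 𝕜) *
        pPart 𝕜 p w (blockVec 𝕜 p w F) n =
        ((mass p w F ^ (-(1 / p)) * w n ^ (2 * p / (p - 2)) : ℝ) : 𝕜) := by
      intro n hn
      rw [h1 n hn, ← RCLike.ofReal_mul, ← sq_mul_blockCoeff_sq h2 hw]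
      congr 1
      ring
    rw [Finset.sum_congr rfl e, ← RCLike.ofReal_sum, ← Finset.mul_sum, mass]
  rw [h3, ← RCLike.ofReal_mul]
  have : mass p w F ^ (1 / p - 1) * (mass p w F ^ (-(1 / p)) * mass p w F) = 1 := by
    nth_rewrite 3 [← Real.rpow_one (mass p w F)]
    rw [← Real.rpow_add hF, ← Real.rpow_add hF]
    simp
  rw [this, RCLike.ofReal_one]

theorem norm_blockFun_le (h2 : 2 < p) (hw : ∀ n, 0 < w n) {F : Finset ℕ}
    (hF : 0 < mass p w F) : ‖blockFun 𝕜 p w F‖ ≤ 1 := by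
  have hp0 : 0 < p := zero_lt_one.trans hp.out
  have hP : (ENNReal.ofReal p).toReal = p := ENNReal.toReal_ofReal hp0.le
  have hpos : ∀ n, 0 ≤ w n ^ 2 * blockCoeff p w n := fun n =>
    mul_nonneg (sq_nonneg _) (blockCoeff_nonneg hw n)
  refine ContinuousLinearMap.opNorm_le_bound _ zero_le_one fun x => ?_
  rw [blockFun_apply, norm_mul, RCLike.norm_ofReal, abs_of_nonneg (by positivity), one_mul]
  have h1 : ‖∑ n ∈ F, ((w n ^ 2 * blockCoeff p w n : ℝ) : 𝕜) * pPart 𝕜 p w x n‖ ≤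
      ∑ n ∈ F, (w n ^ 2 * blockCoeff p w n) * ‖pPart 𝕜 p w x n‖ := by
    refine (norm_sum_le _ _).trans (le_of_eq (Finset.sum_congr rfl fun n _ => ?_))
    rw [norm_mul, RCLike.norm_ofReal, abs_of_nonneg (hpos n)]
  have hq : (p / (p - 1)).HolderConjugate p :=
    (Real.HolderConjugate.conjExponent hp.out).symm
  have h3 := Real.inner_le_Lp_mul_Lq_of_nonneg F hq (f := fun n => w n ^ 2 * blockCoeff p w n)
    (g := fun n => ‖pPart 𝕜 p w x n‖) (fun n _ => hpos n) (fun n _ => norm_nonneg _)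
  have h4 : ∑ n ∈ F, (w n ^ 2 * blockCoeff p w n) ^ (p / (p - 1)) = mass p w F :=
    Finset.sum_congr rfl fun n _ => sq_mul_blockCoeff_rpow h2 hw n
  have h5 : (∑ n ∈ F, ‖pPart 𝕜 p w x n‖ ^ p) ^ (1 / p) ≤ ‖x‖ := by
    have h6 := lp.sum_rpow_le_norm_rpow (by rwa [hP]) (pPart 𝕜 p w x) F
    rw [hP] at h6
    have h7 := Real.rpow_le_rpow (Finset.sum_nonneg fun n _ => by positivity) h6
      (show 0 ≤ 1 / p by positivity)
    rw [← Real.rpow_mul (norm_nonneg _), mul_one_div_cancel hp0.ne', Real.rpow_one] at h7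
    exact h7.trans (norm_pPart_le x)
  rw [h4] at h3
  have e1 : 1 / (p / (p - 1)) = 1 - 1 / p := by
    have : p - 1 ≠ 0 := by linarith [hp.out]
    field_simp
  rw [e1] at h3
  calc _ ≤ mass p w F ^ (1 / p - 1) * (mass p w F ^ (1 - 1 / p) * ‖x‖) := by
        gcongr
        refine h1.trans (h3.trans ?_)
        gcongr
    _ = ‖x‖ := by
        rw [← mul_assoc, ← Real.rpow_add hF]
        simp

/-- The functional is a multiple of the weighted `ℓ²` pairing with its block, so Cauchy–Schwarz
bounds it by the part of `twoPart` supported on `F`. -/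
theorem norm_blockFun_apply_le (h2 : 2 < p) (hw : ∀ n, 0 < w n) {F : Finset ℕ}
    (hF : 0 < mass p w F) (x : WeightedSpace 𝕜 p w) : ‖blockFun 𝕜 p w F x‖ ≤
      mass p w F ^ (1 / p - 1 / 2) * √(∑ n ∈ F, ‖twoPart 𝕜 p w x n‖ ^ 2) := by
  rw [blockFun_apply, norm_mul, RCLike.norm_ofReal, abs_of_nonneg (by positivity)]
  have hpos : ∀ n, 0 ≤ w n * blockCoeff p w n := fun n =>
    mul_nonneg (hw n).le (blockCoeff_nonneg hw n)
  have h1 : ‖∑ n ∈ F, ((w n ^ 2 * blockCoeff p w n : ℝ) : 𝕜) * pPart 𝕜 p w x n‖ ≤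
      ∑ n ∈ F, (w n * blockCoeff p w n) * ‖twoPart 𝕜 p w x n‖ := by
    refine (norm_sum_le _ _).trans (le_of_eq (Finset.sum_congr rfl fun n _ => ?_))
    rw [twoPart_apply, pPart_apply, norm_mul, norm_mul, RCLike.norm_ofReal, RCLike.norm_ofReal,
      abs_of_nonneg (mul_nonneg (sq_nonneg _) (blockCoeff_nonneg hw n)),
      abs_of_pos (hw n)]
    ring
  have h3 := Real.sum_mul_le_sqrt_mul_sqrt F (fun n => w n * blockCoeff p w n)
    (fun n => ‖twoPart 𝕜 p w x n‖)
  have h4 : ∑ n ∈ F, (w n * blockCoeff p w n) ^ 2 = mass p w F :=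
    Finset.sum_congr rfl fun n _ => sq_mul_blockCoeff_sq h2 hw n
  rw [h4] at h3
  calc _ ≤ mass p w F ^ (1 / p - 1) * (√(mass p w F) * √(∑ n ∈ F, ‖twoPart 𝕜 p w x n‖ ^ 2)) := by
        gcongr
        exact h1.trans h3
    _ = _ := by
        rw [← mul_assoc, Real.sqrt_eq_rpow, ← Real.rpow_add hF]
        congr 2
        ring

/-- Disjoint blocks see orthogonal pieces of the weighted `ℓ²` part, and Cauchy–Schwarz applies once
more. The bound `c` for the inverse masses may vary, so that systems with different `N` can be
combined. -/
theorem norm_sum_blockFun_le {ι : Type*} (h2 : 2 < p) (hw : ∀ n, 0 < w n) {F : ι → Finset ℕ}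
    (hF : ∀ x, 0 < mass p w (F x)) (s : Finset ι)
    (hd : ∀ x ∈ s, ∀ y ∈ s, x ≠ y → Disjoint (F x) (F y)) (a : ι → 𝕜) {c : ι → ℝ}
    (hc : ∀ x, 0 < c x) (hcF : ∀ x, (c x)⁻¹ ≤ mass p w (F x)) :
    ‖∑ x ∈ s, a x • blockFun 𝕜 p w (F x)‖ ≤ √(∑ x ∈ s, ‖a x‖ ^ 2 * c x ^ (1 - 2 / p)) := by
  have hp0 : 0 < p := zero_lt_one.trans hp.out
  refine ContinuousLinearMap.opNorm_le_bound _ (Real.sqrt_nonneg _) fun z => ?_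
  have hθ : 0 ≤ 1 / 2 - 1 / p := by
    have : 1 / p < 1 / 2 := one_div_lt_one_div_of_lt (by norm_num) h2
    linarith
  have h1 : ∀ x, ‖blockFun 𝕜 p w (F x) z‖ ≤
      c x ^ (1 / 2 - 1 / p) * √(∑ n ∈ F x, ‖twoPart 𝕜 p w z n‖ ^ 2) := by
    intro x
    refine (norm_blockFun_apply_le h2 hw (hF x) z).trans ?_
    gcongr
    have h3 : (c x)⁻¹ ^ (1 / 2 - 1 / p) ≤ mass p w (F x) ^ (1 / 2 - 1 / p) :=
      Real.rpow_le_rpow (inv_nonneg.2 (hc x).le) (hcF x) hθ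
    rw [Real.inv_rpow (hc x).le] at h3
    have e : 1 / p - 1 / 2 = -(1 / 2 - 1 / p) := by ring
    rw [e, Real.rpow_neg (hF x).le]
    exact inv_le_of_inv_le₀ (Real.rpow_pos_of_pos (hc x) _) h3
  calc ‖(∑ x ∈ s, a x • blockFun 𝕜 p w (F x)) z‖
      ≤ ∑ x ∈ s, (‖a x‖ * c x ^ (1 / 2 - 1 / p)) * √(∑ n ∈ F x, ‖twoPart 𝕜 p w z n‖ ^ 2) := by
        rw [_root_.sum_apply]
        refine (norm_sum_le _ _).trans (Finset.sum_le_sum fun x _ => ?_)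
        rw [_root_.smul_apply, norm_smul, mul_assoc]
        gcongr
        exact h1 x
    _ ≤ √(∑ x ∈ s, (‖a x‖ * c x ^ (1 / 2 - 1 / p)) ^ 2) *
        √(∑ x ∈ s, √(∑ n ∈ F x, ‖twoPart 𝕜 p w z n‖ ^ 2) ^ 2) :=
        Real.sum_mul_le_sqrt_mul_sqrt _ _ _
    _ ≤ _ := by
        gcongr with x hx
        · rw [mul_pow]
          gcongr
          refine le_of_eq ?_
          rw [← Real.rpow_natCast, ← Real.rpow_mul (hc x).le]
          congr 1
          push_cast
          ring
        · refine Real.sqrt_le_iff.2 ⟨norm_nonneg _, ?_⟩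
          have e : ∀ x, √(∑ n ∈ F x, ‖twoPart 𝕜 p w z n‖ ^ 2) ^ 2 =
              ∑ n ∈ F x, ‖twoPart 𝕜 p w z n‖ ^ 2 := fun x =>
            Real.sq_sqrt (Finset.sum_nonneg fun n _ => sq_nonneg _)
          simp only [e]
          rw [← Finset.sum_biUnion fun x hx y hy hxy => hd x hx y hy hxy]
          have h3 := lp.sum_rpow_le_norm_rpow (by norm_num) (twoPart 𝕜 p w z) (s.biUnion F)
          simp only [ENNReal.toReal_ofNat, Real.rpow_two] at h3
          have := norm_twoPart_le z
          exact h3.trans (by gcongr)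

theorem pPart_blockVec_apply_of_notMem {F : Finset ℕ} {n : ℕ} (h : n ∉ F) :
    pPart 𝕜 p w (blockVec 𝕜 p w F) n = 0 := by
  rw [pPart_blockVec, lp.coeFn_smul, Pi.smul_apply, lp.coeFn_sum, Finset.sum_apply]
  simp [h, Finset.sum_pi_single]

theorem twoPart_blockVec_apply_of_notMem {F : Finset ℕ} {n : ℕ} (h : n ∉ F) :
    twoPart 𝕜 p w (blockVec 𝕜 p w F) n = 0 := by
  have := pPart_blockVec_apply_of_notMem (𝕜 := 𝕜) (p := p) (w := w) h
  rw [pPart_apply] at this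
  rw [twoPart_apply, this, mul_zero]

theorem norm_sum_blockVec_le (h2 : 2 < p) (hw : ∀ n, 0 < w n) {F : ℕ → Finset ℕ}
    (hF : ∀ x, 0 < mass p w (F x)) (hd : ∀ x y, x ≠ y → Disjoint (F x) (F y)) {N : ℕ}
    (hFN : ∀ x, mass p w (F x) ≤ 2 * ((N : ℝ) + 1)⁻¹) (I : Finset ℕ) {ε : ℕ → 𝕜}
    (hε : ∀ i, ‖ε i‖ ≤ 1) : ‖∑ i ∈ I, ε i • blockVec 𝕜 p w (F i)‖ ≤
      max ((I.card : ℝ) ^ (1 / p)) (2 * ((N : ℝ) + 1) ^ (1 / p - 1 / 2) * √I.card) := by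
  have hp0 : 0 < p := zero_lt_one.trans hp.out
  have hP : (ENNReal.ofReal p).toReal = p := ENNReal.toReal_ofReal hp0.le
  have hN : (0 : ℝ) < (N : ℝ) + 1 := by positivity
  rw [norm_eq_max]
  refine max_le_max ?_ ?_
  · have h1 := lp_norm_sum_rpow_of_disjoint (P := ENNReal.ofReal p) (by rwa [hP])
      (h := fun i => ε i • pPart 𝕜 p w (blockVec 𝕜 p w (F i))) (by
        intro k l hkl j
        rw [lp.coeFn_smul, lp.coeFn_smul, Pi.smul_apply, Pi.smul_apply]
        by_cases hj : j ∈ F k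
        · right
          rw [pPart_blockVec_apply_of_notMem (Finset.disjoint_left.1 (hd k l hkl) hj), smul_zero]
        · left
          rw [pPart_blockVec_apply_of_notMem hj, smul_zero]) I
    rw [hP] at h1
    rw [← Real.rpow_le_rpow_iff (norm_nonneg _) (by positivity) hp0, map_sum]
    simp only [map_smul]
    rw [h1, ← Real.rpow_mul (by positivity), one_div_mul_cancel hp0.ne', Real.rpow_one]
    calc _ ≤ ∑ i ∈ I, (1 : ℝ) := by
          refine Finset.sum_le_sum fun i _ => ?_
          rw [norm_smul, norm_pPart_blockVec hw (hF i), mul_one]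
          exact Real.rpow_le_one (norm_nonneg _) (hε i) hp0.le
      _ = _ := by simp
  · have h1 := lp_norm_sum_rpow_of_disjoint (P := 2) (by norm_num)
      (h := fun i => ε i • twoPart 𝕜 p w (blockVec 𝕜 p w (F i))) (by
        intro k l hkl j
        rw [lp.coeFn_smul, lp.coeFn_smul, Pi.smul_apply, Pi.smul_apply]
        by_cases hj : j ∈ F k
        · right
          rw [twoPart_blockVec_apply_of_notMem (Finset.disjoint_left.1 (hd k l hkl) hj), smul_zero]
        · left
          rw [twoPart_blockVec_apply_of_notMem hj, smul_zero]) I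
    simp only [ENNReal.toReal_ofNat, Real.rpow_two] at h1
    refine le_of_sq_le_sq ?_ (by positivity)
    rw [map_sum]
    simp only [map_smul]
    rw [h1, mul_pow, Real.sq_sqrt (by positivity)]
    have hθ : 0 ≤ 1 - 2 / p := by rw [sub_nonneg, div_le_one hp0]; exact h2.le
    calc _ ≤ ∑ i ∈ I, (2 * ((N : ℝ) + 1) ^ (1 / p - 1 / 2)) ^ 2 := by
          refine Finset.sum_le_sum fun i _ => ?_
          rw [norm_smul, mul_pow, norm_twoPart_blockVec_sq h2 hw (hF i)]
          have h3 : mass p w (F i) ^ (1 - 2 / p) ≤ (2 * ((N : ℝ) + 1)⁻¹) ^ (1 - 2 / p) :=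
            Real.rpow_le_rpow (hF i).le (hFN i) hθ
          have h4 : (2 * ((N : ℝ) + 1)⁻¹) ^ (1 - 2 / p) ≤
              (2 * ((N : ℝ) + 1) ^ (1 / p - 1 / 2)) ^ 2 := by
            rw [Real.mul_rpow (by norm_num) (by positivity), mul_pow,
              ← Real.rpow_natCast (((N : ℝ) + 1) ^ (1 / p - 1 / 2)), ← Real.rpow_mul hN.le,
              Real.inv_rpow hN.le, ← Real.rpow_neg hN.le]
            have e : -(1 - 2 / p) = (1 / p - 1 / 2) * (2 : ℕ) := by push_cast; ring
            rw [e]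
            gcongr
            calc (2 : ℝ) ^ (1 - 2 / p) ≤ 2 ^ (1 : ℝ) := by
                  apply Real.rpow_le_rpow_of_exponent_le (by norm_num)
                  have : 0 ≤ 2 / p := by positivity
                  linarith
              _ ≤ 2 ^ 2 := by norm_num
          calc _ ≤ 1 ^ 2 * mass p w (F i) ^ (1 - 2 / p) := by
                have := hε i
                have := (hF i).le
                gcongr
            _ ≤ _ := by rw [one_pow, one_mul]; exact h3.trans h4
      _ = _ := by simp [mul_comm]

/-- Disjoint blocks of mass about `1 / (N + 1)` form a diagonal system. -/
theorem diagSystem_blocks (h2 : 2 < p) (hw : ∀ n, 0 < w n) {F : ℕ → Finset ℕ} {N : ℕ}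
    (hd : ∀ x y, x ≠ y → Disjoint (F x) (F y)) (hF1 : ∀ x, ((N : ℝ) + 1)⁻¹ ≤ mass p w (F x))
    (hF2 : ∀ x, mass p w (F x) ≤ 2 * ((N : ℝ) + 1)⁻¹) :
    DiagSystem p N (fun i => blockVec 𝕜 p w (F i)) (fun i => blockFun 𝕜 p w (F i)) := by
  have hp0 : 0 < p := zero_lt_one.trans hp.out
  have hN : (0 : ℝ) < (N : ℝ) + 1 := by positivity
  have hF : ∀ x, 0 < mass p w (F x) := fun x => (inv_pos.2 hN).trans_le (hF1 x)
  have hpp : 1 / p < 1 / 2 := one_div_lt_one_div_of_lt (by norm_num) h2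
  refine ⟨fun I ε hε => ?_, fun I ε hI hε => ?_, fun I ε hε => ?_,
    fun i => norm_blockFun_le h2 hw (hF i), fun i => blockFun_blockVec h2 hw (hF i)⟩
  · refine (norm_sum_blockVec_le h2 hw hF hd hF2 I hε).trans (max_le ?_ ?_)
    · rcases I.card.eq_zero_or_pos with h0 | h0
      · rw [h0]
        simp [Real.zero_rpow (inv_ne_zero hp0.ne')]
      · have h1 : (1 : ℝ) ≤ I.card := by exact_mod_cast h0
        change (I.card : ℝ) ^ (1 / p) ≤ 2 * √(I.card : ℝ)
        rw [Real.sqrt_eq_rpow]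
        have := Real.rpow_le_rpow_of_exponent_le h1 hpp.le
        have h3 : (0 : ℝ) ≤ (I.card : ℝ) ^ (1 / 2 : ℝ) := by positivity
        linarith
    · have h1 : ((N : ℝ) + 1) ^ (1 / p - 1 / 2) ≤ 1 :=
        Real.rpow_le_one_of_one_le_of_nonpos (by linarith [N.cast_nonneg (α := ℝ)]) (by linarith)
      calc _ ≤ 2 * 1 * √(I.card : ℝ) := by gcongr
        _ = _ := by ring
  · refine (norm_sum_blockVec_le h2 hw hF hd hF2 I hε).trans (max_le ?_ ?_)
    · rw [hI]
      push_cast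
      have : (0 : ℝ) ≤ ((N : ℝ) + 1) ^ (1 / p) := by positivity
      linarith
    · rw [hI]
      push_cast
      rw [mul_assoc, Real.sqrt_eq_rpow, ← Real.rpow_add hN]
      refine le_of_eq ?_
      congr 2
      ring
  · refine (norm_sum_blockFun_le h2 hw hF I (fun x _ y _ h => hd x y h) ε
      (c := fun _ => (N : ℝ) + 1) (fun _ => hN) hF1).trans ?_
    have h1 : ∑ x ∈ I, ‖ε x‖ ^ 2 * ((N : ℝ) + 1) ^ (1 - 2 / p) ≤
        (((N : ℝ) + 1) ^ (1 / 2 - 1 / p) * √I.card) ^ 2 := by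
      rw [mul_pow, Real.sq_sqrt (by positivity), ← Real.rpow_natCast, ← Real.rpow_mul hN.le]
      have e : (1 / 2 - 1 / p) * (2 : ℕ) = 1 - 2 / p := by push_cast; ring
      rw [e]
      calc _ ≤ ∑ x ∈ I, 1 ^ 2 * ((N : ℝ) + 1) ^ (1 - 2 / p) := by
            gcongr with x _
            exact hε x
        _ = _ := by simp [mul_comm]
    exact Real.sqrt_le_iff.2 ⟨by positivity, h1⟩

end WeightedSpace

/-! ### Choice of blocks -/

/-- Elements are discarded as long as the sum stays at least `c`. When the next removal would drop
it below `c`, it exceeds `c` by at most one term. -/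
theorem exists_subset_sum_between {g : ℕ → ℝ} {c : ℝ} (F : Finset ℕ) (hg : ∀ n ∈ F, g n ≤ c)
    (hF : c ≤ ∑ n ∈ F, g n) (hc : 0 < c) :
    ∃ F' ⊆ F, c ≤ ∑ n ∈ F', g n ∧ ∑ n ∈ F', g n ≤ 2 * c := by
  induction F using Finset.induction_on with
  | empty => simp at hF; linarith
  | insert a s ha ih =>
    by_cases h : c ≤ ∑ n ∈ s, g n
    · obtain ⟨F', h1, h2⟩ := ih (fun n hn => hg n (Finset.mem_insert_of_mem hn)) h
      exact ⟨F', h1.trans (Finset.subset_insert a s), h2⟩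
    · refine ⟨insert a s, subset_rfl, hF, ?_⟩
      rw [Finset.sum_insert ha]
      linarith [hg a (Finset.mem_insert_self a s), not_le.1 h]

/-- If every finite set of small weights outside `U` had mass below `c`, the sum over small weights
would be bounded by the mass of `U` plus `c`, against the divergence condition. -/
theorem ConditionStar.exists_block {p : ℝ} (hp : 2 < p) {w : ℕ → ℝ} (hw : ConditionStar p w)
    (U : Finset ℕ) {c : ℝ} (hc : 0 < c) : ∃ F : Finset ℕ, Disjoint U F ∧
      c ≤ WeightedSpace.mass p w F ∧ WeightedSpace.mass p w F ≤ 2 * c := by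
  obtain ⟨hpos, hns⟩ := hw
  set a := 2 * p / (p - 2) with ha
  have ha0 : 0 < a := div_pos (by linarith) (by linarith)
  -- Weights below this `ε` have terms at most `c`, as trimming to mass at most `2 * c` requires.
  set ε := c ^ (1 / a) with hε
  have hε0 : 0 < ε := Real.rpow_pos_of_pos hc _
  set g : ℕ → ℝ := fun n => w n ^ a with hg
  have hg0 : ∀ n, 0 ≤ g n := fun n => Real.rpow_nonneg (hpos n).le _
  have hlt : ∀ n, w n < ε → g n ≤ c := by
    intro n hn
    have := Real.rpow_le_rpow (hpos n).le hn.le ha0.le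
    rwa [hε, ← Real.rpow_mul hc.le, one_div_mul_cancel ha0.ne', Real.rpow_one] at this
  obtain ⟨F, hFA, hFU, hF⟩ : ∃ F : Finset ℕ, (∀ n ∈ F, w n < ε) ∧ Disjoint U F ∧
      c ≤ ∑ n ∈ F, g n := by
    by_contra hcon
    push Not at hcon
    refine hns ε hε0 ?_
    have h1 : Summable (Set.indicator {n | w n < ε} g) := by
      have h0 : ∀ n, 0 ≤ Set.indicator {n | w n < ε} g n := fun n =>
        Set.indicator_nonneg (fun n _ => hg0 n) n
      refine summable_of_sum_le (c := ∑ n ∈ U, g n + c) h0 fun s => ?_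
      rw [← Finset.sum_filter_add_sum_filter_not s (fun n => n ∈ U)]
      refine add_le_add ?_ ?_
      · calc _ ≤ ∑ n ∈ s with n ∈ U, g n := Finset.sum_le_sum fun n _ =>
              Set.indicator_le_self' (fun _ _ => hg0 n) n
          _ ≤ _ := Finset.sum_le_sum_of_subset_of_nonneg
              (fun n hn => (Finset.mem_filter.1 hn).2) fun n _ _ => hg0 n
      · have h2 := hcon ((s.filter fun n => n ∉ U).filter fun n => w n < ε)
          (fun n hn => (Finset.mem_filter.1 hn).2)
          (Finset.disjoint_right.2 fun n hn => (Finset.mem_filter.1 (Finset.mem_filter.1 hn).1).2)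
        rw [Finset.sum_filter] at h2
        exact (le_of_eq (Finset.sum_congr rfl fun n _ => by
          simp [Set.indicator_apply])).trans h2.le
    exact summable_subtype_iff_indicator.2 h1
  obtain ⟨F', h1, h2⟩ := exists_subset_sum_between F (fun n hn => hlt n (hFA n hn)) hF hc
  exact ⟨F', Finset.disjoint_of_subset_right h1 hFU, h2⟩

/-- At each stage the set to be avoided is the union `H n` of all the sets chosen so far. -/
theorem exists_disjoint_seq {P : ℕ → Finset ℕ → Prop}
    (h : ∀ n (U : Finset ℕ), ∃ F, Disjoint U F ∧ P n F) :
    ∃ F : ℕ → Finset ℕ, (∀ n, P n (F n)) ∧ ∀ m n, m ≠ n → Disjoint (F m) (F n) := by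
  choose G hG1 hG2 using h
  let H : ℕ → Finset ℕ := fun n => Nat.rec ∅ (fun n U => U ∪ G n U) n
  have hH : ∀ n, H (n + 1) = H n ∪ G n (H n) := fun _ => rfl
  have hmono : Monotone H := monotone_nat_of_le_succ fun n => by
    rw [hH]; exact Finset.subset_union_left
  have hlt : ∀ m n, m < n → Disjoint (G m (H m)) (G n (H n)) := by
    intro m n hmn
    refine Finset.disjoint_of_subset_left ?_ (hG1 n (H n))
    refine subset_trans ?_ (hmono (Nat.succ_le_of_lt hmn))
    rw [Nat.succ_eq_add_one, hH]
    exact Finset.subset_union_right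
  refine ⟨fun n => G n (H n), fun n => hG2 n _, fun m n hmn => ?_⟩
  rcases lt_or_gt_of_ne hmn with h | h
  · exact hlt m n h
  · exact (hlt n m h).symm

theorem ConditionStar.exists_blocks {p : ℝ} (hp : 2 < p) {w : ℕ → ℝ} (hw : ConditionStar p w) :
    ∃ F : ℕ → ℕ → Finset ℕ,
      (∀ N i : ℕ, ((N : ℝ) + 1)⁻¹ ≤ WeightedSpace.mass p w (F N i) ∧
        WeightedSpace.mass p w (F N i) ≤ 2 * ((N : ℝ) + 1)⁻¹) ∧
      ∀ N i N' i', (N, i) ≠ (N', i') → Disjoint (F N i) (F N' i') := by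
  obtain ⟨F, h1, h2⟩ := exists_disjoint_seq
    (P := fun n F => ((n.unpair.1 : ℝ) + 1)⁻¹ ≤ WeightedSpace.mass p w F ∧
        WeightedSpace.mass p w F ≤ 2 * ((n.unpair.1 : ℝ) + 1)⁻¹)
    fun n U => hw.exists_block hp U (by positivity)
  refine ⟨fun N i => F (Nat.pair N i), fun N i => ?_, fun N i N' i' h => h2 _ _ fun e => h ?_⟩
  · have := h1 (Nat.pair N i)
    rwa [Nat.unpair_pair] at this
  · have := congrArg Nat.unpair e
    rwa [Nat.unpair_pair, Nat.unpair_pair] at this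

/-! ### Spaces with constant weight and their `ℓ^p` sum -/

/-- The constant weight used in the definition of `B_p`. -/
abbrev constWeight (p : ℝ) (N : ℕ) : ℕ → ℝ := fun _ => (1 / ((N : ℝ) + 1)) ^ ((p - 2) / (2 * p))

theorem constWeight_pos {p : ℝ} (N n : ℕ) : 0 < constWeight p N n := by
  unfold constWeight; positivity

section ConstWeight

variable {𝕜 : Type u} [RCLike 𝕜] {p : ℝ} [hp : Fact (1 < p)]

variable (𝕜) in
-- For this weight every singleton has mass exactly `1 / (N + 1)`, so the blocks may be single
-- points.
theorem diagSystem_constWeight (h2 : 2 < p) (N : ℕ) :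
    DiagSystem p N (fun i => WeightedSpace.blockVec 𝕜 p (constWeight p N) {i})
      (fun i => WeightedSpace.blockFun 𝕜 p (constWeight p N) {i}) := by
  have hm : ∀ i, WeightedSpace.mass p (constWeight p N) {i} = ((N : ℝ) + 1)⁻¹ := by
    intro i
    have h1 : p - 2 ≠ 0 := by linarith
    have h3 : p ≠ 0 := by linarith
    rw [WeightedSpace.mass, Finset.sum_singleton, constWeight, ← Real.rpow_mul (by positivity)]
    have : (p - 2) / (2 * p) * (2 * p / (p - 2)) = 1 := by field_simp
    rw [this, Real.rpow_one, one_div]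
  refine WeightedSpace.diagSystem_blocks h2 (constWeight_pos N)
    (fun x y h => Finset.disjoint_singleton.2 h) (fun x => (hm x).ge) fun x => ?_
  rw [hm]
  have : (0 : ℝ) ≤ ((N : ℝ) + 1)⁻¹ := by positivity
  linarith

variable (𝕜) in
-- For a constant weight `v` the `ℓ^p` norm is at most `v⁻¹` times the weighted `ℓ²` norm, so the
-- space is a renormed Hilbert space. The constant depends on `N`.
theorem hasCotypeTwo_constWeight (h2 : 2 < p) (N : ℕ) :
    HasCotypeTwo (WeightedSpace 𝕜 p (constWeight p N)) := by
  have hp0 : 0 < p := by linarith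
  have hP : (ENNReal.ofReal p).toReal = p := ENNReal.toReal_ofReal hp0.le
  set v : ℝ := (1 / ((N : ℝ) + 1)) ^ ((p - 2) / (2 * p)) with hv
  have hv0 : 0 < v := by positivity
  refine (parallelogram_of_inner 𝕜 (lp (fun _ : ℕ => 𝕜) 2)).hasCotypeTwo.comap
    (WeightedSpace.twoPart 𝕜 p (constWeight p N)).toLinearMap.toAddMonoidHom (c := v⁻¹ + 1)
    (c' := 1) (fun x => ?_) fun x => by
      rw [one_mul]; exact WeightedSpace.norm_twoPart_le x
  change ‖x‖ ≤ (v⁻¹ + 1) * ‖WeightedSpace.twoPart 𝕜 p (constWeight p N) x‖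
  set y := WeightedSpace.twoPart 𝕜 p (constWeight p N) x with hy
  have h1 : ‖WeightedSpace.pPart 𝕜 p (constWeight p N) x‖ ≤ v⁻¹ * ‖y‖ := by
    refine lp.norm_le_of_forall_sum_le (by rwa [hP]) (by positivity) fun s => ?_
    rw [hP]
    have h3 : ∀ n, ‖WeightedSpace.pPart 𝕜 p (constWeight p N) x n‖ = v⁻¹ * ‖y n‖ := by
      intro n
      rw [hy, WeightedSpace.twoPart_apply, WeightedSpace.pPart_apply, norm_mul,
        RCLike.norm_ofReal, abs_of_pos (constWeight_pos N n), ← mul_assoc,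
        inv_mul_cancel₀ hv0.ne', one_mul]
    have h4 := lp.sum_rpow_le_norm_rpow (by norm_num) y s
    simp only [ENNReal.toReal_ofNat, Real.rpow_two] at h4
    have e : ∀ t : ℝ, 0 ≤ t → t ^ (p - 2) * t ^ 2 = t ^ p := by
      intro t ht
      rw [← Real.rpow_two, ← Real.rpow_add_of_nonneg ht (by linarith) (by norm_num)]
      congr 1
      ring
    calc _ = ∑ n ∈ s, v⁻¹ ^ p * (‖y n‖ ^ (p - 2) * ‖y n‖ ^ 2) := by
          refine Finset.sum_congr rfl fun n _ => ?_
          rw [h3, Real.mul_rpow (by positivity) (norm_nonneg _), e _ (norm_nonneg _)]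
      _ ≤ ∑ n ∈ s, v⁻¹ ^ p * (‖y‖ ^ (p - 2) * ‖y n‖ ^ 2) := by
          refine Finset.sum_le_sum fun n _ => ?_
          have h5 := Real.rpow_le_rpow (norm_nonneg _) (lp.norm_apply_le_norm (by norm_num) y n)
            (show 0 ≤ p - 2 by linarith)
          gcongr
      _ = v⁻¹ ^ p * (‖y‖ ^ (p - 2) * ∑ n ∈ s, ‖y n‖ ^ 2) := by
          rw [Finset.mul_sum, Finset.mul_sum]
      _ ≤ v⁻¹ ^ p * (‖y‖ ^ (p - 2) * ‖y‖ ^ 2) := by gcongr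
      _ = _ := by rw [e _ (norm_nonneg _), Real.mul_rpow (by positivity) (norm_nonneg _)]
  refine (WeightedSpace.norm_le_add x).trans ?_
  rw [add_mul, one_mul]
  gcongr

variable (𝕜 p) in
-- The `ℓ^p` and weighted `ℓ²` parts embed the space in `ℓ^p(ℓ^p) × ℓ^p(ℓ²)`, and both factors are
-- iterated `ℓ^p` sums of Hilbert spaces.
theorem hasTypeTwo_weightedSum (h2 : 2 < p) : HasTypeTwo (WeightedSum 𝕜 p) := by
  have hp0 : 0 < p := by linarith
  have hPne : ENNReal.ofReal p ≠ 0 := by simpa using hp0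
  have hC : 0 ≤ 1 + 8 * (p / 2 / 2 * Real.exp (p / 2 / 2)) := by positivity
  have t1 : HasTypeTwo (lp (fun _ : ℕ => lp (fun _ : ℕ => 𝕜) (ENNReal.ofReal p))
      (ENNReal.ofReal p)) :=
    (PSmooth.lp h2.le hC fun _ => PSmooth.lp h2.le hC
      fun _ => (parallelogram_of_inner 𝕜 𝕜).pSmooth h2.le).hasTypeTwo h2.le hC
  have t2 : HasTypeTwo (lp (fun _ : ℕ => lp (fun _ : ℕ => 𝕜) 2) (ENNReal.ofReal p)) :=
    hasTypeTwo_lp_of_parallelogram h2.le fun _ => parallelogram_of_inner 𝕜 _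
  have k1 : ∀ N : ℕ, ‖WeightedSpace.pPart 𝕜 p (constWeight p N)‖ ≤ 1 := fun N =>
    ContinuousLinearMap.opNorm_le_bound _ zero_le_one fun x => by
      rw [one_mul]; exact WeightedSpace.norm_pPart_le x
  have k2 : ∀ N : ℕ, ‖WeightedSpace.twoPart 𝕜 p (constWeight p N)‖ ≤ 1 := fun N =>
    ContinuousLinearMap.opNorm_le_bound _ zero_le_one fun x => by
      rw [one_mul]; exact WeightedSpace.norm_twoPart_le x
  set j1 := lp.mapCLM (ENNReal.ofReal p) (fun N => WeightedSpace.pPart 𝕜 p (constWeight p N))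
    zero_le_one k1 with hj1
  set j2 := lp.mapCLM (ENNReal.ofReal p) (fun N => WeightedSpace.twoPart 𝕜 p (constWeight p N))
    zero_le_one k2 with hj2
  refine (t1.prod t2).comap (j1.prod j2).toLinearMap.toAddMonoidHom (c := 2)
    (c' := ‖j1.prod j2‖) (fun x => ?_) fun x => (j1.prod j2).le_opNorm x
  change ‖x‖ ≤ 2 * ‖(j1 x, j2 x)‖
  have h1 : ‖x‖ ≤ ‖lp.toNorm (j1 x) + lp.toNorm (j2 x)‖ := by
    refine lp.norm_mono hPne fun N => ?_
    refine le_trans ?_ (le_abs_self _)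
    exact WeightedSpace.norm_le_add (x N)
  refine h1.trans ((norm_add_le _ _).trans ?_)
  rw [lp.norm_toNorm, lp.norm_toNorm, two_mul]
  exact add_le_add (norm_fst_le (j1 x, j2 x)) (norm_snd_le (j1 x, j2 x))

end ConstWeight

/-! ### Factorizations of the identity -/

/-- The identity of `X` factors through `Y`. -/
def Factors (𝕜 : Type*) [RCLike 𝕜] (X Y : Type*) [NormedAddCommGroup X] [NormedSpace 𝕜 X]
    [NormedAddCommGroup Y] [NormedSpace 𝕜 Y] : Prop :=
  ∃ (T : X →L[𝕜] Y) (P : Y →L[𝕜] X), ∀ x, P (T x) = x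

section Factors

variable {𝕜 : Type*} [RCLike 𝕜] {X Y Z : Type*} [NormedAddCommGroup X] [NormedSpace 𝕜 X]
  [NormedAddCommGroup Y] [NormedSpace 𝕜 Y] [NormedAddCommGroup Z] [NormedSpace 𝕜 Z]

/-- Factorizations compose, restrict and dualize without reference to subspaces, and this direction
is enough for refuting embeddings. -/
theorem ComplementablyEmbeds.factors (h : ComplementablyEmbeds 𝕜 X Y) : Factors 𝕜 X Y := by
  obtain ⟨Y', ⟨f, hf⟩, ⟨e⟩⟩ := h
  exact ⟨Y'.subtypeL.comp e.toContinuousLinearMap, e.symm.toContinuousLinearMap.comp f,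
    fun x => by simp [hf]⟩

theorem Factors.refl : Factors 𝕜 X X :=
  ⟨ContinuousLinearMap.id 𝕜 X, ContinuousLinearMap.id 𝕜 X, fun _ => rfl⟩

theorem Factors.trans (h : Factors 𝕜 X Y) (h' : Factors 𝕜 Y Z) : Factors 𝕜 X Z := by
  obtain ⟨T, P, h⟩ := h
  obtain ⟨T', P', h'⟩ := h'
  exact ⟨T'.comp T, P.comp P', fun x => by simp [h, h']⟩

theorem Factors.fst : Factors 𝕜 X (X × Y) :=
  ⟨ContinuousLinearMap.inl 𝕜 X Y, ContinuousLinearMap.fst 𝕜 X Y, fun _ => rfl⟩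

theorem Factors.snd : Factors 𝕜 Y (X × Y) :=
  ⟨ContinuousLinearMap.inr 𝕜 X Y, ContinuousLinearMap.snd 𝕜 X Y, fun _ => rfl⟩

theorem Factors.prodMap {X' Y' : Type*} [NormedAddCommGroup X'] [NormedSpace 𝕜 X']
    [NormedAddCommGroup Y'] [NormedSpace 𝕜 Y'] (h : Factors 𝕜 X Y) (h' : Factors 𝕜 X' Y') :
    Factors 𝕜 (X × X') (Y × Y') := by
  obtain ⟨T, P, h⟩ := h
  obtain ⟨T', P', h'⟩ := h'
  exact ⟨T.prodMap T', P.prodMap P', fun x => Prod.ext (h x.1) (h' x.2)⟩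

theorem ContinuousLinearEquiv.factors (e : X ≃L[𝕜] Y) : Factors 𝕜 X Y :=
  ⟨e.toContinuousLinearMap, e.symm.toContinuousLinearMap, fun x => by simp⟩

theorem Factors.dual (h : Factors 𝕜 X Y) : Factors 𝕜 (StrongDual 𝕜 X) (StrongDual 𝕜 Y) := by
  obtain ⟨T, P, h⟩ := h
  refine ⟨(ContinuousLinearMap.compL 𝕜 Y X 𝕜).flip P, (ContinuousLinearMap.compL 𝕜 X Y 𝕜).flip T,
    fun x => ?_⟩
  ext z
  simp [h]

end Factors

/-! ### The case `p > 2` -/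

section TwoLt

variable {𝕜 : Type u} [RCLike 𝕜] {p : ℝ} [hp : Fact (1 < p)]

/-- Only diagonals at least `1 / 2` are demanded, not `P T = 1`. This leaves room for a second
factor of the target that carries less than half of the diagonal. -/
theorem ConditionStar.false_of_diag {w : ℕ → ℝ} (h2 : 2 < p) (hw : ConditionStar p w)
    {G : ℕ → Type*} [∀ i, NormedAddCommGroup (G i)] [∀ i, NormedSpace 𝕜 (G i)]
    (htype : HasTypeTwo (lp G (ENNReal.ofReal p))) (hcot : ∀ j, HasCotypeTwo (G j))
    (T : WeightedSpace 𝕜 p w →L[𝕜] lp G (ENNReal.ofReal p))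
    (P : lp G (ENNReal.ofReal p) →L[𝕜] WeightedSpace 𝕜 p w)
    (h : ∀ (N : ℕ) (e : ℕ → WeightedSpace 𝕜 p w) (f : ℕ → StrongDual 𝕜 (WeightedSpace 𝕜 p w)),
      DiagSystem p N e f →
        ∀ᶠ i in (hyperfilter ℕ : Filter ℕ), 1 / 2 ≤ ‖f i (P (T (e i)))‖) : False := by
  obtain ⟨F, hF1, hF2⟩ := hw.exists_blocks h2
  have hsys : ∀ N, DiagSystem p N (fun i => WeightedSpace.blockVec 𝕜 p w (F N i))
      (fun i => WeightedSpace.blockFun 𝕜 p w (F N i)) := fun N =>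
    WeightedSpace.diagSystem_blocks h2 hw.1 (fun x y hxy => hF2 _ _ _ _ (by simpa using hxy))
      (fun i => (hF1 N i).1) fun i => (hF1 N i).2
  refine false_of_diag_through_lp h2 htype hcot hsys (fun N hN s a => ?_) T P
    Nat.hyperfilter_le_atTop fun N => h N _ _ (hsys N)
  refine WeightedSpace.norm_sum_blockFun_le h2 hw.1 (F := fun x => F (N x.1) x.2)
    (fun x => lt_of_lt_of_le (by positivity) (hF1 _ _).1) s (fun x _ y _ hxy => hF2 _ _ _ _ ?_) a
    (c := fun x => (N x.1 : ℝ) + 1) (fun x => by positivity) fun x => (hF1 _ _).1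
  intro e
  rw [Prod.mk.injEq] at e
  exact hxy (Sigma.ext (hN e.1) (heq_of_eq e.2))

theorem ConditionStar.not_factors_lp {w : ℕ → ℝ} (h2 : 2 < p) (hw : ConditionStar p w)
    {G : ℕ → Type*} [∀ i, NormedAddCommGroup (G i)] [∀ i, NormedSpace 𝕜 (G i)]
    (htype : HasTypeTwo (lp G (ENNReal.ofReal p))) (hcot : ∀ j, HasCotypeTwo (G j)) :
    ¬ Factors 𝕜 (WeightedSpace 𝕜 p w) (lp G (ENNReal.ofReal p)) := by
  rintro ⟨T, P, h⟩
  refine hw.false_of_diag h2 htype hcot T P fun N e f hsys => Eventually.of_forall fun i => ?_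
  rw [h, hsys.apply_self]
  norm_num

theorem ConditionStar.not_factors_weightedSum {w : ℕ → ℝ} (h2 : 2 < p) (hw : ConditionStar p w) :
    ¬ Factors 𝕜 (WeightedSpace 𝕜 p w) (WeightedSum 𝕜 p) :=
  hw.not_factors_lp h2 (hasTypeTwo_weightedSum 𝕜 p h2) fun N => hasCotypeTwo_constWeight 𝕜 h2 N

theorem ConditionStar.not_factors_lpSum {w : ℕ → ℝ} (h2 : 2 < p) (hw : ConditionStar p w)
    {H : Type*} [NormedAddCommGroup H] [NormedSpace 𝕜 H] (hH : Parallelogram H) :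
    ¬ Factors 𝕜 (WeightedSpace 𝕜 p w) (LpSum p H) :=
  hw.not_factors_lp h2 (hasTypeTwo_lp_of_parallelogram h2.le fun _ => hH) fun _ => hH.hasCotypeTwo

theorem half_le_norm_of_add_eq_one {𝕜 : Type*} [RCLike 𝕜] {a b : 𝕜} (h : a + b = 1)
    (hb : ‖b‖ < 1 / 2) : 1 / 2 ≤ ‖a‖ := by
  have h1 := norm_add_le a b
  rw [h, norm_one] at h1
  linarith

/-- The compressions to the two factors of a factorization through a product. -/
theorem exists_split_of_prod {𝕜 : Type*} [RCLike 𝕜] {X Y Z : Type*} [NormedAddCommGroup X]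
    [NormedSpace 𝕜 X] [NormedAddCommGroup Y] [NormedSpace 𝕜 Y] [NormedAddCommGroup Z]
    [NormedSpace 𝕜 Z] (T : X →L[𝕜] Y × Z) (P : Y × Z →L[𝕜] X) (h : ∀ x, P (T x) = x) :
    ∃ (T₁ : X →L[𝕜] Y) (P₁ : Y →L[𝕜] X) (P₂ : Z →L[𝕜] X), ‖T₁‖ ≤ ‖T‖ ∧ ‖P₁‖ ≤ ‖P‖ ∧
      ‖P₂‖ ≤ ‖P‖ ∧ ∀ x, P₁ (T₁ x) + P₂ (((ContinuousLinearMap.snd 𝕜 Y Z).comp T) x) = x := by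
  refine ⟨(ContinuousLinearMap.fst 𝕜 Y Z).comp T, P.comp (ContinuousLinearMap.inl 𝕜 Y Z),
    P.comp (ContinuousLinearMap.inr 𝕜 Y Z), ?_, ?_, ?_, fun x => ?_⟩
  · exact ContinuousLinearMap.opNorm_le_bound _ (norm_nonneg _) fun z =>
      (norm_fst_le _).trans (T.le_opNorm _)
  · exact ContinuousLinearMap.opNorm_le_bound _ (norm_nonneg _) fun y =>
      (P.le_opNorm _).trans_eq (by simp [Prod.norm_def])
  · exact ContinuousLinearMap.opNorm_le_bound _ (norm_nonneg _) fun y =>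
      (P.le_opNorm _).trans_eq (by simp [Prod.norm_def])
  · calc _ = P ((T x).1, 0) + P (0, (T x).2) := rfl
      _ = x := by rw [← map_add, Prod.mk_add_mk, add_zero, zero_add, Prod.mk.eta, h]

/-- On a late summand the weighted `ℓ²` part of `T` is small, hence so is the diagonal through
`X_{p,w}`. The diagonal through the sum of Hilbert spaces is small for large `N` as well, but the
two add up to one. -/
theorem not_factors_lp_prod (h2 : 2 < p) {G : ℕ → Type*} [∀ N, NormedAddCommGroup (G N)]
    [∀ N, NormedSpace 𝕜 (G N)] {e : ∀ N, ℕ → G N} {f : ∀ N, ℕ → StrongDual 𝕜 (G N)}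
    (hsys : ∀ N, DiagSystem p N (e N) (f N)) {H : Type*} [NormedAddCommGroup H]
    [NormedSpace 𝕜 H] (hH : Parallelogram H) (w : ℕ → ℝ) :
    ¬ Factors 𝕜 (lp G (ENNReal.ofReal p)) (LpSum p H × WeightedSpace 𝕜 p w) := by
  rintro ⟨T, P, h⟩
  have hp0 : 0 < p := by linarith
  have hPne : ENNReal.ofReal p ≠ 0 := by simpa using hp0
  have hpp : 1 / p < 1 / 2 := one_div_lt_one_div_of_lt (by norm_num) h2
  set δ : ℝ := 1 / (8 * (‖P‖ + 1)) with hδ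
  have hδ0 : 0 < δ := by positivity
  have hsmall := eventually_single_small (G := G) h2
    (parallelogram_of_inner 𝕜 (lp (fun _ : ℕ => 𝕜) 2))
    ((WeightedSpace.twoPart 𝕜 p w).comp ((ContinuousLinearMap.snd 𝕜 _ _).comp T)) hδ0
  have hlim : Tendsto (fun N : ℕ => ‖P‖ * (‖T‖ * 2 * ((N : ℝ) + 1) ^ (1 / p - 1 / 2))) atTop
      (𝓝 (‖P‖ * (‖T‖ * 2 * 0))) := by
    refine Tendsto.const_mul _ (Tendsto.const_mul _ ?_)
    have h1 : Tendsto (fun N : ℕ => ((N : ℝ) + 1) ^ (-(1 / 2 - 1 / p))) atTop (𝓝 0) :=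
      (tendsto_rpow_neg_atTop (sub_pos.2 hpp)).comp
        (tendsto_atTop_add_const_right _ _ tendsto_natCast_atTop_atTop)
    simpa using h1
  rw [mul_zero, mul_zero] at hlim
  obtain ⟨N, hN1, hN2⟩ := (hsmall.and (hlim.eventually
    (gt_mem_nhds (show (0 : ℝ) < 1 / 2 by norm_num)))).exists
  obtain ⟨ι, hι⟩ : ∃ ι : G N →L[𝕜] lp G (ENNReal.ofReal p),
      ∀ z, ι z = lp.single (ENNReal.ofReal p) N z :=
    ⟨lp.singleContinuousLinearMap 𝕜 G (ENNReal.ofReal p) N, fun _ => rfl⟩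
  obtain ⟨π, hπ⟩ : ∃ π : lp G (ENNReal.ofReal p) →L[𝕜] G N, ∀ z, π z = z N :=
    ⟨lp.evalCLM 𝕜 G (ENNReal.ofReal p) N, fun _ => rfl⟩
  have hTι : ‖T.comp ι‖ ≤ ‖T‖ := ContinuousLinearMap.opNorm_le_bound _ (norm_nonneg _) fun z =>
    (T.le_opNorm _).trans_eq (by
      rw [ContinuousLinearMap.coe_coe, hι, lp.norm_single (by simpa using hp0)])
  have hπP : ‖π.comp P‖ ≤ ‖P‖ := ContinuousLinearMap.opNorm_le_bound _ (norm_nonneg _) fun y => by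
    rw [ContinuousLinearMap.comp_apply, hπ]
    exact (lp.norm_apply_le_norm hPne _ N).trans (P.le_opNorm _)
  obtain ⟨T₁, P₁, P₂, hT₁, hP₁, hP₂, hsum⟩ := exists_split_of_prod (T.comp ι) (π.comp P)
    fun z => by
      rw [ContinuousLinearMap.comp_apply, ContinuousLinearMap.comp_apply, h, hπ, hι,
        lp.single_apply_self]
  replace hT₁ := hT₁.trans hTι
  replace hP₁ := hP₁.trans hπP
  replace hP₂ := hP₂.trans hπP
  set T₂ := (ContinuousLinearMap.snd 𝕜 (LpSum p H) (WeightedSpace 𝕜 p w)).comp (T.comp ι)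
  have hT₂' : ∀ z, ‖WeightedSpace.twoPart 𝕜 p w (T₂ z)‖ ≤ δ * ‖z‖ := by
    intro z
    have h1 := hN1 z
    rw [← hι] at h1
    exact h1
  have hδ' : 2 * ‖P₂‖ * δ < 1 / 2 := by
    calc 2 * ‖P₂‖ * δ ≤ 2 * ‖P‖ * δ := by gcongr
      _ < 1 / 2 := by
        rw [hδ, mul_one_div, div_lt_div_iff₀ (by positivity) (by norm_num)]
        nlinarith [norm_nonneg P]
  clear_value T₂
  have e1 := (hsys N).eventually_lt_of_weighted h2 T₂ P₂ hδ0.le hT₂' Nat.hyperfilter_le_atTop hδ'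
  have e2 := (hsys N).eventually_lt_of_lp h2 (fun _ => hH) T₁ P₁ Nat.hyperfilter_le_atTop (η := 1 / 2)
    (lt_of_le_of_lt (by gcongr) hN2)
  obtain ⟨i, hi1, hi2⟩ := (e1.and e2).exists
  refine absurd hi2 (not_lt.2 (half_le_norm_of_add_eq_one ?_ hi1))
  rw [← map_add, hsum, (hsys N).apply_self i]

theorem not_factors_weightedSum_prod (h2 : 2 < p) {H : Type*} [NormedAddCommGroup H]
    [NormedSpace 𝕜 H] (hH : Parallelogram H) (w : ℕ → ℝ) :
    ¬ Factors 𝕜 (WeightedSum 𝕜 p) (LpSum p H × WeightedSpace 𝕜 p w) :=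
  not_factors_lp_prod h2 (fun N => diagSystem_constWeight 𝕜 h2 N) hH w

/-- On one late copy of `X'` the weighted `ℓ²` part of `T` is so small that the diagonal through
`X_{p,w}` is below `1 / 2` for every `N`; the other half must pass through `B_p`. The space `X'` is
`X_{p,w}` itself for `p > 2` and its bidual in the dual case. -/
theorem ConditionStar.not_factors_lpSum_prod {w : ℕ → ℝ} (h2 : 2 < p) (hw : ConditionStar p w)
    {X' : Type*} [NormedAddCommGroup X'] [NormedSpace 𝕜 X']
    (hX' : Factors 𝕜 (WeightedSpace 𝕜 p w) X') :
    ¬ Factors 𝕜 (LpSum p X') (WeightedSum 𝕜 p × WeightedSpace 𝕜 p w) := by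
  rintro ⟨T, P, h⟩
  obtain ⟨j, r, hjr⟩ := hX'
  have hp0 : 0 < p := by linarith
  have hPne : ENNReal.ofReal p ≠ 0 := by simpa using hp0
  set δ : ℝ := 1 / (8 * (‖r‖ * ‖P‖ * ‖j‖ + 1)) with hδ
  have hδ0 : 0 < δ := by positivity
  obtain ⟨m, hm⟩ := (eventually_single_small (G := fun _ : ℕ => X') h2
    (parallelogram_of_inner 𝕜 (lp (fun _ : ℕ => 𝕜) 2))
    ((WeightedSpace.twoPart 𝕜 p w).comp ((ContinuousLinearMap.snd 𝕜 _ _).comp T)) hδ0).exists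
  let ι := (lp.singleContinuousLinearMap 𝕜 (fun _ : ℕ => X') (ENNReal.ofReal p) m).comp j
  let π := r.comp (lp.evalCLM 𝕜 (fun _ : ℕ => X') (ENNReal.ofReal p) m)
  have hπ : ∀ z, ‖π z‖ ≤ ‖r‖ * ‖z‖ := fun z =>
    r.le_opNorm_of_le (lp.norm_apply_le_norm hPne z m)
  have hπι : ∀ z, π (ι z) = z := fun z => by
    have : π (ι z) = r (lp.single (E := fun _ : ℕ => X') (ENNReal.ofReal p) m (j z) m) := rfl
    rw [this, lp.single_apply_self, hjr]
  let T₁ := (ContinuousLinearMap.fst 𝕜 (WeightedSum 𝕜 p) (WeightedSpace 𝕜 p w)).comp (T.comp ι)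
  let T₂ := (ContinuousLinearMap.snd 𝕜 (WeightedSum 𝕜 p) (WeightedSpace 𝕜 p w)).comp (T.comp ι)
  let P₁ := (π.comp P).comp (ContinuousLinearMap.inl 𝕜 (WeightedSum 𝕜 p) (WeightedSpace 𝕜 p w))
  let P₂ := (π.comp P).comp (ContinuousLinearMap.inr 𝕜 (WeightedSum 𝕜 p) (WeightedSpace 𝕜 p w))
  have hP₂ : ‖P₂‖ ≤ ‖r‖ * ‖P‖ := ContinuousLinearMap.opNorm_le_bound _ (by positivity) fun y => by
    have h1 : ‖P (0, y)‖ ≤ ‖P‖ * ‖y‖ := (P.le_opNorm _).trans_eq (by simp [Prod.norm_def])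
    calc ‖P₂ y‖ ≤ ‖r‖ * ‖P (0, y)‖ := hπ _
      _ ≤ ‖r‖ * (‖P‖ * ‖y‖) := by gcongr
      _ = _ := by ring
  refine hw.false_of_diag h2 (hasTypeTwo_weightedSum 𝕜 p h2)
    (fun N => hasCotypeTwo_constWeight 𝕜 h2 N) T₁ P₁ fun N e f hsys => ?_
  have e1 := hsys.eventually_lt_of_weighted h2 T₂ P₂ (δ := δ * ‖j‖) (by positivity) (fun z => by
      refine (hm (j z)).trans ?_
      rw [mul_assoc]
      gcongr
      exact j.le_opNorm z)
    Nat.hyperfilter_le_atTop (η := 1 / 2) (by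
      calc 2 * ‖P₂‖ * (δ * ‖j‖) ≤ 2 * (‖r‖ * ‖P‖) * (δ * ‖j‖) := by gcongr
        _ = 2 * (‖r‖ * ‖P‖ * ‖j‖) * δ := by ring
        _ < 1 / 2 := by
          have : 0 ≤ ‖r‖ * ‖P‖ * ‖j‖ := by positivity
          rw [hδ, mul_one_div, div_lt_div_iff₀ (by positivity) (by norm_num)]
          nlinarith)
  filter_upwards [e1] with i hi
  refine half_le_norm_of_add_eq_one ?_ hi
  rw [← map_add, ← hsys.apply_self i]
  congr 1
  have e3 : ∀ z, P₁ (T₁ z) + P₂ (T₂ z) = z := by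
    intro z
    have : P₁ (T₁ z) + P₂ (T₂ z) = π (P ((T (ι z)).1, 0) + P (0, (T (ι z)).2)) := by
      rw [map_add]; rfl
    rw [this, ← map_add, Prod.mk_add_mk, add_zero, zero_add, Prod.mk.eta, h, hπι]
  exact e3 _

end TwoLt

/-! ### The dual of an `ℓ^p` sum -/

section LpDual

variable {𝕜 : Type*} [RCLike 𝕜] {p q : ℝ≥0∞} [Fact (1 ≤ p)]
  {G : ℕ → Type*} [∀ i, NormedAddCommGroup (G i)] [∀ i, NormedSpace 𝕜 (G i)]

/-- The `i`-th component of a functional on an `ℓ^p` sum. -/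
abbrev lpDualCoord (φ : StrongDual 𝕜 (lp G p)) (i : ℕ) : StrongDual 𝕜 (G i) :=
  φ.comp (lp.singleContinuousLinearMap 𝕜 G p i)

theorem exists_half_norm_le {X : Type*} [NormedAddCommGroup X] [NormedSpace 𝕜 X]
    (φ : StrongDual 𝕜 X) : ∃ x : X, ‖x‖ ≤ 1 ∧ ‖φ‖ / 2 ≤ RCLike.re (φ x) := by
  rcases eq_or_ne φ 0 with rfl | hφ
  · exact ⟨0, by simp, by simp⟩
  obtain ⟨x, hx, hx'⟩ := φ.exists_lt_apply_of_lt_opNorm (half_lt_self (norm_pos_iff.2 hφ))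
  obtain ⟨θ, hθ, hθ'⟩ := exists_phase (φ x)
  refine ⟨θ • x, ?_, ?_⟩
  · rw [norm_smul]
    exact mul_le_one₀ hθ (norm_nonneg _) hx.le
  · rw [map_smul, smul_eq_mul, hθ']
    exact hx'.le

/-- The functional is tested on the extremal vector of Hölder's inequality, assembled from vectors
that norm the components up to a factor two. The resulting factor is harmless, since only an
isomorphism of the duals is needed. -/
theorem sum_norm_lpDualCoord_rpow_le (hpq : p.toReal.HolderConjugate q.toReal)
    (φ : StrongDual 𝕜 (lp G p)) (s : Finset ℕ) :
    ∑ i ∈ s, ‖lpDualCoord φ i‖ ^ q.toReal ≤ (2 * ‖φ‖) ^ q.toReal := by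
  choose x hx hx' using fun i => exists_half_norm_le (lpDualCoord φ i)
  set c : ℕ → ℝ := fun i => ‖lpDualCoord φ i‖ with hc
  have hc0 : ∀ i, 0 ≤ c i := fun i => norm_nonneg _
  set S := ∑ i ∈ s, c i ^ q.toReal with hS
  have hS0 : 0 ≤ S := Finset.sum_nonneg fun i _ => Real.rpow_nonneg (hc0 i) _
  rcases hS0.eq_or_lt with h0 | hpos
  · rw [← h0]; positivity
  set y : lp G p := ∑ i ∈ s, lp.single p i (((c i ^ (q.toReal - 1) : ℝ) : 𝕜) • x i) with hy
  have hyn : ‖y‖ ^ p.toReal ≤ S := by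
    rw [hy, lp.norm_sum_single hpq.pos]
    refine Finset.sum_le_sum fun i _ => ?_
    rw [norm_smul, RCLike.norm_ofReal, abs_of_nonneg (Real.rpow_nonneg (hc0 i) _)]
    calc (c i ^ (q.toReal - 1) * ‖x i‖) ^ p.toReal ≤ (c i ^ (q.toReal - 1)) ^ p.toReal := by
          refine Real.rpow_le_rpow (mul_nonneg (Real.rpow_nonneg (hc0 i) _) (norm_nonneg _)) ?_
            hpq.nonneg
          exact mul_le_of_le_one_right (Real.rpow_nonneg (hc0 i) _) (hx i)
      _ = c i ^ q.toReal := by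
          rw [← Real.rpow_mul (hc0 i), hpq.symm.sub_one_mul_conj]
  have hyn' : ‖y‖ ≤ S ^ (1 / p.toReal) := by
    rw [one_div]
    exact (Real.le_rpow_inv_iff_of_pos (norm_nonneg _) hS0 hpq.pos).2 hyn
  have hφy : S / 2 ≤ RCLike.re (φ y) := by
    rw [hy, map_sum, map_sum, hS, Finset.sum_div]
    refine Finset.sum_le_sum fun i _ => ?_
    have e1 : φ (lp.single p i (((c i ^ (q.toReal - 1) : ℝ) : 𝕜) • x i)) =
        ((c i ^ (q.toReal - 1) : ℝ) : 𝕜) * lpDualCoord φ i (x i) := by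
      rw [← smul_eq_mul, ← map_smul]; rfl
    rw [e1, RCLike.re_ofReal_mul]
    have e2 : c i ^ q.toReal = c i ^ (q.toReal - 1) * c i := by
      rcases (hc0 i).eq_or_lt with h | h
      · rw [← h, mul_zero, Real.zero_rpow hpq.symm.ne_zero]
      · rw [Real.rpow_sub_one h.ne']; field_simp
    rw [e2, mul_div_assoc]
    exact mul_le_mul_of_nonneg_left (hx' i) (Real.rpow_nonneg (hc0 i) _)
  have h1 : S / 2 ≤ ‖φ‖ * S ^ (1 / p.toReal) :=
    hφy.trans ((RCLike.re_le_norm _).trans ((φ.le_opNorm _).trans (by gcongr)))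
  have h2 : S ^ (1 / q.toReal) * S ^ (1 / p.toReal) = S := by
    rw [← Real.rpow_add hpos]
    have := hpq.symm.inv_add_inv_eq_one
    rw [one_div, one_div, this, Real.rpow_one]
  have h3 : S ^ (1 / q.toReal) ≤ 2 * ‖φ‖ := by
    have h4 : 0 < S ^ (1 / p.toReal) := Real.rpow_pos_of_pos hpos _
    refine le_of_mul_le_mul_right ?_ h4
    rw [h2]
    linarith
  rw [one_div] at h3
  exact (Real.rpow_inv_le_iff_of_pos hS0 (by positivity) hpq.symm.pos).1 h3

/-- The sequence of components of a functional on an `ℓ^p` sum, as an element of the `ℓ^q` sum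
of the duals. -/
def lpDualSeq (hpq : p.toReal.HolderConjugate q.toReal) (φ : StrongDual 𝕜 (lp G p)) :
    lp (fun i => StrongDual 𝕜 (G i)) q :=
  ⟨lpDualCoord φ, memℓp_gen' (C := (2 * ‖φ‖) ^ q.toReal) (sum_norm_lpDualCoord_rpow_le hpq φ)⟩

variable [Fact (1 ≤ q)]

/-- The duality between an `ℓ^p` sum and the `ℓ^q` sum of the duals. -/
def lpDualEquiv (hpq : p.toReal.HolderConjugate q.toReal) :
    StrongDual 𝕜 (lp G p) ≃L[𝕜] lp (fun i => StrongDual 𝕜 (G i)) q :=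
  haveI : q.HolderConjugate p := ENNReal.HolderConjugate.of_toReal hpq.symm
  have hpt : p ≠ ∞ := fun h => by simpa [h] using hpq.pos
  have hqt : q ≠ ∞ := fun h => by simpa [h] using hpq.symm.pos
  let A : lp (fun i => StrongDual 𝕜 (G i)) q →L[𝕜] StrongDual 𝕜 (lp G p) :=
    lp.dualPairing q p (K := 1) (fun i => ContinuousLinearMap.id 𝕜 (StrongDual 𝕜 (G i)))
      fun _ => ContinuousLinearMap.norm_id_le
  let T : StrongDual 𝕜 (lp G p) →L[𝕜] lp (fun i => StrongDual 𝕜 (G i)) q :=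
    LinearMap.mkContinuous
      { toFun := lpDualSeq hpq
        map_add' := fun _ _ => rfl
        map_smul' := fun _ _ => rfl } 2 fun φ =>
      lp.norm_le_of_forall_sum_le hpq.symm.pos (by positivity) (sum_norm_lpDualCoord_rpow_le hpq φ)
  have hA : ∀ ψ i z, A ψ (lp.single p i z) = ψ i z := fun ψ i z => by
    refine (tsum_eq_single i fun j hj => ?_).trans ?_
    · exact (congrArg (ψ j) (lp.single_apply_ne p i z hj)).trans (map_zero _)
    · exact congrArg (ψ i) (lp.single_apply_self p i z)
  ContinuousLinearEquiv.equivOfInverse T A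
    (fun φ => lp.ext_continuousLinearMap hpt fun i => ContinuousLinearMap.ext fun z => hA _ i z)
    fun ψ => lp.ext (funext fun i => ContinuousLinearMap.ext fun z => hA ψ i z)

theorem lpDualEquiv_symm_single (hpq : p.toReal.HolderConjugate q.toReal) (i : ℕ)
    (ψ : StrongDual 𝕜 (G i)) (x : lp G p) :
    (lpDualEquiv hpq).symm (lp.single (E := fun i => StrongDual 𝕜 (G i)) q i ψ) x = ψ (x i) := by
  refine (tsum_eq_single i fun j hj => ?_).trans ?_
  · exact congrArg (fun f : StrongDual 𝕜 (G j) => f (x j))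
      (lp.single_apply_ne (E := fun i => StrongDual 𝕜 (G i)) q i ψ hj)
  · exact congrArg (fun f : StrongDual 𝕜 (G i) => f (x i))
      (lp.single_apply_self (E := fun i => StrongDual 𝕜 (G i)) q i ψ)

end LpDual

/-! ### Reflexivity -/

/-- The canonical embedding of `X` into its bidual is onto. -/
def ReflexiveSpace (𝕜 : Type*) [RCLike 𝕜] (X : Type*) [NormedAddCommGroup X] [NormedSpace 𝕜 X] : Prop :=
  ∀ Φ : StrongDual 𝕜 (StrongDual 𝕜 X), ∃ x : X, ∀ φ, Φ φ = φ x

section Reflexive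

variable {𝕜 : Type*} [RCLike 𝕜] {X Y : Type*} [NormedAddCommGroup X] [NormedSpace 𝕜 X]
  [NormedAddCommGroup Y] [NormedSpace 𝕜 Y]

theorem reflexive_self : ReflexiveSpace 𝕜 𝕜 := fun Φ => by
  refine ⟨Φ (ContinuousLinearMap.id 𝕜 𝕜), fun φ => ?_⟩
  have h : φ = φ 1 • ContinuousLinearMap.id 𝕜 𝕜 := by ext; simp
  rw [h, map_smul]
  simp

theorem ReflexiveSpace.prod (hX : ReflexiveSpace 𝕜 X) (hY : ReflexiveSpace 𝕜 Y) : ReflexiveSpace 𝕜 (X × Y) := fun Φ => by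
  obtain ⟨x, hx⟩ := hX (Φ.comp ((ContinuousLinearMap.compL 𝕜 (X × Y) X 𝕜).flip
    (ContinuousLinearMap.fst 𝕜 X Y)))
  obtain ⟨y, hy⟩ := hY (Φ.comp ((ContinuousLinearMap.compL 𝕜 (X × Y) Y 𝕜).flip
    (ContinuousLinearMap.snd 𝕜 X Y)))
  refine ⟨(x, y), fun φ => ?_⟩
  have h : φ = (φ.comp (ContinuousLinearMap.inl 𝕜 X Y)).comp (ContinuousLinearMap.fst 𝕜 X Y) +
      (φ.comp (ContinuousLinearMap.inr 𝕜 X Y)).comp (ContinuousLinearMap.snd 𝕜 X Y) := by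
    ext z <;> simp <;> exact map_zero φ
  have hx' := hx (φ.comp (ContinuousLinearMap.inl 𝕜 X Y))
  have hy' := hy (φ.comp (ContinuousLinearMap.inr 𝕜 X Y))
  calc Φ φ = _ := congrArg Φ h
    _ = _ := map_add Φ _ _
    _ = φ (x, 0) + φ (0, y) := congrArg₂ (· + ·) hx' hy'
    _ = φ (x, y) := by rw [← map_add, Prod.mk_add_mk, add_zero, zero_add]

theorem exists_dual_ne_zero_of_notMem {M : Submodule 𝕜 Y} (hM : IsClosed (M : Set Y)) {y : Y}
    (hy : y ∉ M) : ∃ g : StrongDual 𝕜 Y, (∀ z ∈ M, g z = 0) ∧ g y ≠ 0 := by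
  have := hM
  have hne : M.mkQ y ≠ 0 := by simpa using hy
  obtain ⟨g, -, hg⟩ := exists_dual_vector 𝕜 (M.mkQ y) (norm_ne_zero_iff.2 hne)
  refine ⟨g.comp (M.mkQ.mkContinuous 1 fun z => by
    rw [one_mul]; exact Submodule.Quotient.norm_mk_le M z), fun z hz => ?_, ?_⟩
  · have : M.mkQ z = 0 := by simpa using hz
    simp [this]
  · change g (M.mkQ y) ≠ 0
    rw [hg]
    exact_mod_cast norm_ne_zero_iff.2 hne

/-- Pushed forward to `Y`, the bidual element is evaluation at some `y`. Separation puts `y` in the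
closed range of `J`, and Hahn–Banach extension shows that functionals pulled back from `Y` exhaust
the dual of `X`. -/
theorem ReflexiveSpace.of_isometry [CompleteSpace X] (hY : ReflexiveSpace 𝕜 Y) (J : X →ₗᵢ[𝕜] Y) :
    ReflexiveSpace 𝕜 X := fun Φ => by
  obtain ⟨y, hy⟩ := hY (Φ.comp ((ContinuousLinearMap.compL 𝕜 X Y 𝕜).flip J.toContinuousLinearMap))
  replace hy : ∀ g : StrongDual 𝕜 Y, Φ (g.comp J.toContinuousLinearMap) = g y := hy
  have hcl : IsClosed (J.range : Set Y) := by
    exact J.isometry.isClosedEmbedding.isClosed_range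
  have hmem : y ∈ J.range := by
    by_contra hn
    obtain ⟨g, hg, hgy⟩ := exists_dual_ne_zero_of_notMem hcl hn
    refine hgy ?_
    rw [← hy g]
    have : g.comp J.toContinuousLinearMap = 0 := by
      ext x
      exact hg _ ⟨x, rfl⟩
    rw [this, map_zero]
  obtain ⟨x, hx⟩ := hmem
  refine ⟨x, fun φ => ?_⟩
  obtain ⟨g, hg, -⟩ := exists_extension_norm_eq J.range
    (φ.comp J.equivRange.symm.toContinuousLinearEquiv.toContinuousLinearMap)
  have hgJ : ∀ z, g (J z) = φ z := fun z => by
    have h1 := hg (J.equivRange z)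
    simpa using h1
  have h2 : g.comp J.toContinuousLinearMap = φ := ContinuousLinearMap.ext hgJ
  rw [← h2, hy, ← hx]
  rfl

/-- Applying the duality twice represents `Φ` by a sequence of bidual elements of the summands. Each
is evaluation at a vector of the same norm, so these vectors form an element of the `ℓ^p` sum. -/
theorem reflexive_lp {p q : ℝ≥0∞} [Fact (1 ≤ p)] [Fact (1 ≤ q)]
    (hpq : p.toReal.HolderConjugate q.toReal) {G : ℕ → Type*} [∀ i, NormedAddCommGroup (G i)]
    [∀ i, NormedSpace 𝕜 (G i)] (hG : ∀ i, ReflexiveSpace 𝕜 (G i)) : ReflexiveSpace 𝕜 (lp G p) := fun Φ => by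
  have hqt : q ≠ ∞ := fun h => by simpa [h] using hpq.symm.pos
  set e := lpDualEquiv (𝕜 := 𝕜) (G := G) hpq with he
  set Ψ : StrongDual 𝕜 (lp (fun i => StrongDual 𝕜 (G i)) q) :=
    Φ.comp e.symm.toContinuousLinearMap with hΨ
  set χ := lpDualEquiv hpq.symm Ψ with hχ
  choose x hx using fun i => hG i (χ i)
  have hxn : ∀ i, ‖x i‖ = ‖χ i‖ := fun i => by
    have : χ i = NormedSpace.inclusionInDoubleDualLi 𝕜 (x i) :=
      ContinuousLinearMap.ext fun φ => hx i φ
    rw [this, LinearIsometry.norm_map]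
  have hmem : Memℓp x p := by
    refine memℓp_gen ?_
    simp only [hxn]
    exact (lp.memℓp χ).summable hpq.pos
  refine ⟨⟨x, hmem⟩, fun φ => ?_⟩
  have key : Ψ = ((NormedSpace.inclusionInDoubleDual 𝕜 (lp G p)) ⟨x, hmem⟩).comp
      e.symm.toContinuousLinearMap := by
    refine lp.ext_continuousLinearMap hqt fun i => ContinuousLinearMap.ext fun ψ => ?_
    exact (hx i ψ).trans (lpDualEquiv_symm_single hpq i ψ ⟨x, hmem⟩).symm
  have h2 := congrArg (fun F => F (e φ)) key
  simpa [hΨ] using h2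

end Reflexive

/-! ### The case `p < 2` -/

section LtTwo

theorem Factors.prod_dual (𝕜 : Type*) [RCLike 𝕜] (X Y : Type*) [NormedAddCommGroup X]
    [NormedSpace 𝕜 X] [NormedAddCommGroup Y] [NormedSpace 𝕜 Y] :
    Factors 𝕜 (StrongDual 𝕜 (X × Y)) (StrongDual 𝕜 X × StrongDual 𝕜 Y) := by
  refine ⟨((ContinuousLinearMap.compL 𝕜 X (X × Y) 𝕜).flip (ContinuousLinearMap.inl 𝕜 X Y)).prod
    ((ContinuousLinearMap.compL 𝕜 Y (X × Y) 𝕜).flip (ContinuousLinearMap.inr 𝕜 X Y)),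
    ((ContinuousLinearMap.compL 𝕜 (X × Y) X 𝕜).flip (ContinuousLinearMap.fst 𝕜 X Y)).comp
      (ContinuousLinearMap.fst 𝕜 _ _) +
    ((ContinuousLinearMap.compL 𝕜 (X × Y) Y 𝕜).flip (ContinuousLinearMap.snd 𝕜 X Y)).comp
      (ContinuousLinearMap.snd 𝕜 _ _), fun φ => ?_⟩
  ext z <;> simp <;> exact map_zero φ

theorem ReflexiveSpace.factors_bidual {𝕜 : Type*} [RCLike 𝕜] {X : Type*} [NormedAddCommGroup X]
    [NormedSpace 𝕜 X] [CompleteSpace X] (hX : ReflexiveSpace 𝕜 X) :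
    Factors 𝕜 X (StrongDual 𝕜 (StrongDual 𝕜 X)) ∧ Factors 𝕜 (StrongDual 𝕜 (StrongDual 𝕜 X)) X := by
  let e : X ≃ₗᵢ[𝕜] StrongDual 𝕜 (StrongDual 𝕜 X) :=
    LinearIsometryEquiv.ofSurjective (NormedSpace.inclusionInDoubleDualLi 𝕜) fun Φ => by
      obtain ⟨x, hx⟩ := hX Φ
      exact ⟨x, ContinuousLinearMap.ext fun φ => (hx φ).symm⟩
  exact ⟨e.toContinuousLinearEquiv.factors, e.symm.toContinuousLinearEquiv.factors⟩

/-- Dualizing replaces `ℓ²` by its dual. The results for `p > 2` ask only for the parallelogram law,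
so the dual need not be identified with `ℓ²`. -/
theorem parallelogram_dual {𝕜 : Type*} [RCLike 𝕜] {E : Type*} [NormedAddCommGroup E]
    [InnerProductSpace 𝕜 E] [CompleteSpace E] : Parallelogram (StrongDual 𝕜 E) := fun φ ψ => by
  obtain ⟨x, rfl⟩ := (InnerProductSpace.toDual 𝕜 E).surjective φ
  obtain ⟨y, rfl⟩ := (InnerProductSpace.toDual 𝕜 E).surjective ψ
  rw [← map_add, ← map_sub]
  simp only [LinearIsometryEquiv.norm_map]
  exact parallelogram_of_inner 𝕜 E x y

variable {𝕜 : Type u} [RCLike 𝕜] {p : ℝ} [hp : Fact (1 < p)]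

theorem toReal_ofReal_holderConjugate (p : ℝ) [hp : Fact (1 < p)] :
    (ENNReal.ofReal p).toReal.HolderConjugate (ENNReal.ofReal p.conjExponent).toReal := by
  have h := Real.HolderConjugate.conjExponent hp.out
  rwa [ENNReal.toReal_ofReal h.nonneg, ENNReal.toReal_ofReal h.symm.nonneg]

theorem reflexiveSpace_weightedSpace (w : ℕ → ℝ) : ReflexiveSpace 𝕜 (WeightedSpace 𝕜 p w) := by
  have h1 : ReflexiveSpace 𝕜 (lp (fun _ : ℕ => 𝕜) (ENNReal.ofReal p)) :=
    reflexive_lp (toReal_ofReal_holderConjugate p) fun _ => reflexive_self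
  have h2 : ReflexiveSpace 𝕜 (lp (fun _ : ℕ => 𝕜) 2) :=
    reflexive_lp (q := 2) (by simpa using Real.HolderConjugate.two_two) fun _ => reflexive_self
  exact (h1.prod h2).of_isometry ⟨WeightedSpace.toProd 𝕜 p w, fun _ => rfl⟩

theorem reflexiveSpace_weightedSum : ReflexiveSpace 𝕜 (WeightedSum 𝕜 p) :=
  reflexive_lp (toReal_ofReal_holderConjugate p) fun _ => reflexiveSpace_weightedSpace _

/-- The dual of the `ℓ^p` sum of copies of `X` is the `ℓ^q` sum of copies of the dual. -/
def lpSumDualEquiv (𝕜 : Type*) [RCLike 𝕜] (p : ℝ) [Fact (1 < p)] (X : Type*)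
    [NormedAddCommGroup X] [NormedSpace 𝕜 X] :
    StrongDual 𝕜 (LpSum p X) ≃L[𝕜] LpSum p.conjExponent (StrongDual 𝕜 X) :=
  lpDualEquiv (toReal_ofReal_holderConjugate p)

theorem two_lt_conjExponent (h2 : p < 2) : 2 < p.conjExponent := by
  have h1 : 0 < p - 1 := sub_pos.2 hp.out
  rw [Real.conjExponent, lt_div_iff₀ h1]
  linarith

/-- Dualizing a factorization reverses neither the source nor the target, since `T` and `P` exchange
roles. Reflexivity then removes the biduals, and the case of the conjugate index applies. -/
theorem ConditionStar.not_factors_dual_weightedSum {w : ℕ → ℝ} (h2 : p < 2)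
    (hw : ConditionStar p.conjExponent w) :
    ¬ Factors 𝕜 (StrongDual 𝕜 (WeightedSpace 𝕜 p.conjExponent w))
      (StrongDual 𝕜 (WeightedSum 𝕜 p.conjExponent)) := fun h =>
  hw.not_factors_weightedSum (two_lt_conjExponent h2)
    (((reflexiveSpace_weightedSpace w).factors_bidual.1.trans h.dual).trans
      reflexiveSpace_weightedSum.factors_bidual.2)

theorem ConditionStar.not_factors_dual_lpSum {w : ℕ → ℝ} (h2 : p < 2)
    (hw : ConditionStar p.conjExponent w) :
    ¬ Factors 𝕜 (StrongDual 𝕜 (WeightedSpace 𝕜 p.conjExponent w)) (LpSum p (EllTwo 𝕜)) := fun h =>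
  hw.not_factors_lpSum (two_lt_conjExponent h2) parallelogram_dual
    (((reflexiveSpace_weightedSpace w).factors_bidual.1.trans h.dual).trans
      (lpSumDualEquiv 𝕜 p (EllTwo 𝕜)).factors)

theorem not_factors_dual_weightedSum_prod (h2 : p < 2) (w : ℕ → ℝ) :
    ¬ Factors 𝕜 (StrongDual 𝕜 (WeightedSum 𝕜 p.conjExponent))
      (LpSum p (EllTwo 𝕜) × StrongDual 𝕜 (WeightedSpace 𝕜 p.conjExponent w)) := fun h =>
  not_factors_weightedSum_prod (two_lt_conjExponent h2) parallelogram_dual w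
    (((reflexiveSpace_weightedSum.factors_bidual.1.trans h.dual).trans
      (Factors.prod_dual _ _ _)).trans ((lpSumDualEquiv 𝕜 p (EllTwo 𝕜)).factors.prodMap
        (reflexiveSpace_weightedSpace w).factors_bidual.2))

theorem ConditionStar.not_factors_lpSum_dual_prod {w : ℕ → ℝ} (h2 : p < 2)
    (hw : ConditionStar p.conjExponent w) :
    ¬ Factors 𝕜 (LpSum p (StrongDual 𝕜 (WeightedSpace 𝕜 p.conjExponent w)))
      (StrongDual 𝕜 (WeightedSum 𝕜 p.conjExponent) ×
        StrongDual 𝕜 (WeightedSpace 𝕜 p.conjExponent w)) := fun h =>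
  hw.not_factors_lpSum_prod (two_lt_conjExponent h2)
    (reflexiveSpace_weightedSpace w).factors_bidual.1
    ((((lpSumDualEquiv 𝕜 p _).symm.factors.trans h.dual).trans (Factors.prod_dual _ _ _)).trans
      (reflexiveSpace_weightedSum.factors_bidual.2.prodMap
        (reflexiveSpace_weightedSpace w).factors_bidual.2))

end LtTwo

/-- The four non-factorizations from which all the others follow. -/
theorem not_complementablyEmbeds_of_not_factors {𝕜 : Type*} [RCLike 𝕜] {S B X SX : Type*}
    [NormedAddCommGroup S] [NormedSpace 𝕜 S] [NormedAddCommGroup B] [NormedSpace 𝕜 B]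
    [NormedAddCommGroup X] [NormedSpace 𝕜 X] [NormedAddCommGroup SX] [NormedSpace 𝕜 SX]
    (hXS : ¬ Factors 𝕜 X S) (hXB : ¬ Factors 𝕜 X B) (hBSX : ¬ Factors 𝕜 B (S × X))
    (hSX : ¬ Factors 𝕜 SX (B × X)) :
    ¬ ComplementablyEmbeds 𝕜 B S ∧ ¬ ComplementablyEmbeds 𝕜 (S × X) S ∧
    ¬ ComplementablyEmbeds 𝕜 B (S × X) ∧ ¬ ComplementablyEmbeds 𝕜 (S × X) B ∧
    ¬ ComplementablyEmbeds 𝕜 (B × X) B ∧ ¬ ComplementablyEmbeds 𝕜 (B × X) (S × X) ∧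
    ¬ ComplementablyEmbeds 𝕜 SX (B × X) :=
  ⟨fun h => hBSX (h.factors.trans Factors.fst), fun h => hXS (Factors.snd.trans h.factors),
    fun h => hBSX h.factors, fun h => hXB (Factors.snd.trans h.factors),
    fun h => hXB (Factors.snd.trans h.factors), fun h => hBSX (Factors.fst.trans h.factors),
    fun h => hSX h.factors⟩

end

theorem proposition2p49 {𝕜 : Type*} [RCLike 𝕜] (p : ℝ) [Fact (1 < p)] (hp2 : p ≠ 2)
    (w : ℕ → ℝ) (hw : RealizingWeight p w) :
    -- (a)
    ¬ ComplementablyEmbeds 𝕜 (RosenthalB 𝕜 p) (LpSum p (EllTwo 𝕜)) ∧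
    -- (b)
    ¬ ComplementablyEmbeds 𝕜 (LpSum p (EllTwo 𝕜) × RosenthalX 𝕜 p w) (LpSum p (EllTwo 𝕜)) ∧
    -- (c)
    ¬ ComplementablyEmbeds 𝕜 (RosenthalB 𝕜 p) (LpSum p (EllTwo 𝕜) × RosenthalX 𝕜 p w) ∧
    -- (d)
    ¬ ComplementablyEmbeds 𝕜 (LpSum p (EllTwo 𝕜) × RosenthalX 𝕜 p w) (RosenthalB 𝕜 p) ∧
    -- (e)
    ¬ ComplementablyEmbeds 𝕜 (RosenthalB 𝕜 p × RosenthalX 𝕜 p w) (RosenthalB 𝕜 p) ∧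
    -- (f)
    ¬ ComplementablyEmbeds 𝕜 (RosenthalB 𝕜 p × RosenthalX 𝕜 p w)
        (LpSum p (EllTwo 𝕜) × RosenthalX 𝕜 p w) ∧
    -- (g)
    ¬ ComplementablyEmbeds 𝕜 (LpSum p (RosenthalX 𝕜 p w))
        (RosenthalB 𝕜 p × RosenthalX 𝕜 p w) := by
  have hp := Fact.out (p := 1 < p)
  rcases lt_or_gt_of_ne hp2 with h2 | h2
  · have hw' : ConditionStar p.conjExponent w := by rwa [RealizingWeight, if_neg h2.not_gt] at hw
    rw [RosenthalB, RosenthalX, if_neg h2.not_gt, if_neg h2.not_gt]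
    exact not_complementablyEmbeds_of_not_factors (hw'.not_factors_dual_lpSum h2)
      (hw'.not_factors_dual_weightedSum h2)
      (not_factors_dual_weightedSum_prod h2 w) (hw'.not_factors_lpSum_dual_prod h2)
  · have hw' : ConditionStar p w := by rwa [RealizingWeight, if_pos h2] at hw
    rw [RosenthalB, RosenthalX, if_pos h2, if_pos h2]
    exact not_complementablyEmbeds_of_not_factors
      (hw'.not_factors_lpSum h2 (parallelogram_of_inner 𝕜 _))
      (hw'.not_factors_weightedSum h2)
      (not_factors_weightedSum_prod h2 (parallelogram_of_inner 𝕜 _) w)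
      (hw'.not_factors_lpSum_prod h2 Factors.refl)
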